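/- We work over $\mathbb C$. Let $C\subset\mathbb P^2$ be a (reduced, possibly reducible) plane curve of degree $d\ge 1$ that contains no line and all of whose singular points are nodes (points near which $C$ is analytically isomorphic to $xy=0$ at the origin). Let $\nu\colon\hat C\to C$ be its normalization, where $\hat C$ is a smooth projective curve. Let $(\mathbb P^2)^*$ be the dual plane; for $t\in(\mathbb P^2)^*$ let $t^\perp\subset\mathbb P^2$ be the corresponding line, and for $p\in\mathbb P^2$ let $p^\perp\subset(\mathbb P^2)^*$ be the set of lines through $p$. Let $C^*\subset(\mathbb P^2)^*$ be the dual of $C$, i.e. the closure of the set of lines tangent to $C$ at smooth points. Put $$X_C=\{(x,t)\in\hat C\times(\mathbb P^2)^* : \nu(x)\in t^\perp\},\qquad f_C\colon X_C\to(\mathbb P^2)^*,\quad f_C(x,t)=t.$$ Then: 1. $X_C$ is a smooth projective surface (closed in $\hat C\times(\mathbb P^2)^*$); 2. $f_C$ is a finite regular map of degree $d$ (it is proper with finite fibres, and the fibre over the general point of $(\mathbb P^2)^*$ consists of $d$ points); 3. the branch locus of $f_C$, that is, the set of images of the points of $X_C$ at which the derivative of $f_C$ is degenerate, is equal to $C^*$;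 4. for every $p\in\mathbb P^2\setminus C$ there is an isomorphism $\varphi\colon\hat C\to f_C^{-1}(p^\perp)$ such that $f_C\circ\varphi=\mathrm{pr}_p\circ\nu$, where $\mathrm{pr}_p\colon C\to p^\perp$ sends $x$ to the line joining $p$ and $x$. -/

import Mathlib

open scoped LinearAlgebra.Projectivization

/-! ### Complex projective spaces and projective algebraic sets -/

/-- The complex projective space `ℙⁿ`, with homogeneous coordinates indexed by `Fin (n + 1)`. -/
abbrev PSpace (n : ℕ) : Type := ℙ ℂ (Fin (n + 1) → ℂ)

/-- The classical topology of `ℙⁿ`: the quotient topology from `ℂⁿ⁺¹ ∖ {0}`. -/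
noncomputable instance PSpace.topologicalSpace (n : ℕ) : TopologicalSpace (PSpace n) :=
  TopologicalSpace.coinduced
    (fun v : {v : Fin (n + 1) → ℂ // v ≠ 0} => Projectivization.mk ℂ v.1 v.2) inferInstance

/-- The value of a polynomial at a chosen vector of homogeneous coordinates of `z ∈ ℙⁿ`.
For homogeneous polynomials all conditions imposed below do not depend on the choice. -/
noncomputable def PSpace.val {n : ℕ} (z : PSpace n) (G : MvPolynomial (Fin (n + 1)) ℂ) : ℂ :=
  MvPolynomial.eval z.rep G

/-- Homogeneous coordinates of a point of `ℙⁿ × ℙᵐ`. -/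
noncomputable def PSpace.coords {n m : ℕ} (z : PSpace n × PSpace m) :
    Fin (n + 1) ⊕ Fin (m + 1) → ℂ :=
  Sum.elim z.1.rep z.2.rep

/-- The value of a polynomial at chosen homogeneous coordinates of `z ∈ ℙⁿ × ℙᵐ`. -/
noncomputable def PSpace.val₂ {n m : ℕ} (z : PSpace n × PSpace m)
    (G : MvPolynomial (Fin (n + 1) ⊕ Fin (m + 1)) ℂ) : ℂ :=
  MvPolynomial.eval (PSpace.coords z) G

/-- Bihomogeneous polynomials of bidegree `e = (e₁, e₂)` in two groups of variables. -/
def IsBihomogeneous {n m : ℕ} (G : MvPolynomial (Fin (n + 1) ⊕ Fin (m + 1)) ℂ)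
    (e : ℕ × ℕ) : Prop :=
  MvPolynomial.IsWeightedHomogeneous
    (Sum.elim (fun _ => ((1, 0) : ℕ × ℕ)) (fun _ => ((0, 1) : ℕ × ℕ))) G e

/-- Zariski closed subsets of `ℙⁿ`. -/
def IsZariskiClosed {n : ℕ} (Z : Set (PSpace n)) : Prop :=
  ∃ I : Set (MvPolynomial (Fin (n + 1)) ℂ), (∀ G ∈ I, ∃ e, G.IsHomogeneous e) ∧
    ∀ z, z ∈ Z ↔ ∀ G ∈ I, z.val G = 0

/-- Zariski closed subsets of `ℙⁿ × ℙᵐ`. -/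
def IsZariskiClosed₂ {n m : ℕ} (Z : Set (PSpace n × PSpace m)) : Prop :=
  ∃ I : Set (MvPolynomial (Fin (n + 1) ⊕ Fin (m + 1)) ℂ),
    (∀ G ∈ I, ∃ e, IsBihomogeneous G e) ∧
    ∀ z, z ∈ Z ↔ ∀ G ∈ I, PSpace.val₂ z G = 0

/-- `Z ⊆ ℙⁿ` is smooth of pure dimension `k` (Jacobian criterion): on a Zariski neighbourhood
`{H ≠ 0}` of each of its points, `Z` is given by `n - k` homogeneous equations whose gradients
are linearly independent at the point. -/
def IsSmoothOfDim {n : ℕ} (Z : Set (PSpace n)) (k : ℕ) : Prop :=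
  ∀ z₀ ∈ Z, ∃ c : ℕ, c + k = n ∧
    ∃ G : Fin c → MvPolynomial (Fin (n + 1)) ℂ, (∀ j, ∃ e, (G j).IsHomogeneous e) ∧
    ∃ H : MvPolynomial (Fin (n + 1)) ℂ, (∃ e, H.IsHomogeneous e) ∧ z₀.val H ≠ 0 ∧
      (∀ z, z.val H ≠ 0 → (z ∈ Z ↔ ∀ j, z.val (G j) = 0)) ∧
      LinearIndependent ℂ (fun j i => z₀.val (MvPolynomial.pderiv i (G j)))

/-- `Z ⊆ ℙⁿ × ℙᵐ` is smooth of pure dimension `k` (Jacobian criterion). -/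
def IsSmoothOfDim₂ {n m : ℕ} (Z : Set (PSpace n × PSpace m)) (k : ℕ) : Prop :=
  ∀ z₀ ∈ Z, ∃ c : ℕ, c + k = n + m ∧
    ∃ G : Fin c → MvPolynomial (Fin (n + 1) ⊕ Fin (m + 1)) ℂ,
      (∀ j, ∃ e, IsBihomogeneous (G j) e) ∧
    ∃ H : MvPolynomial (Fin (n + 1) ⊕ Fin (m + 1)) ℂ,
      (∃ e, IsBihomogeneous H e) ∧ PSpace.val₂ z₀ H ≠ 0 ∧
      (∀ z, PSpace.val₂ z H ≠ 0 → (z ∈ Z ↔ ∀ j, PSpace.val₂ z (G j) = 0)) ∧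
      LinearIndependent ℂ (fun j i => PSpace.val₂ z₀ (MvPolynomial.pderiv i (G j)))

/-! ### Regular maps -/

/-- The tuple `Γ` of homogeneous polynomials of one degree represents `f : Z → ℙᵏ` near `z₀`:
the `Γ j` do not all vanish at `z₀`, and `f = [Γ₀ : … : Γₖ]` wherever they do not all vanish. -/
def IsLocalRep {n k : ℕ} {Z : Set (PSpace n)} (f : Z → PSpace k) (z₀ : Z)
    (Γ : Fin (k + 1) → MvPolynomial (Fin (n + 1)) ℂ) : Prop :=
  (∃ e, ∀ j, (Γ j).IsHomogeneous e) ∧ (fun j => z₀.1.val (Γ j)) ≠ 0 ∧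
    ∀ (z : Z) (h : (fun j => z.1.val (Γ j)) ≠ 0), f z = Projectivization.mk ℂ _ h

/-- Regular maps from a (locally closed) subset of `ℙⁿ` to `ℙᵏ`. -/
def IsRegularMap {n k : ℕ} {Z : Set (PSpace n)} (f : Z → PSpace k) : Prop :=
  ∀ z₀ : Z, ∃ Γ, IsLocalRep f z₀ Γ

/-- The tuple `Γ` of bihomogeneous polynomials of one bidegree represents `f : Z → ℙᵏ`
near `z₀`. -/
def IsLocalRep₂ {n m k : ℕ} {Z : Set (PSpace n × PSpace m)} (f : Z → PSpace k) (z₀ : Z)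
    (Γ : Fin (k + 1) → MvPolynomial (Fin (n + 1) ⊕ Fin (m + 1)) ℂ) : Prop :=
  (∃ e, ∀ j, IsBihomogeneous (Γ j) e) ∧ (fun j => PSpace.val₂ z₀.1 (Γ j)) ≠ 0 ∧
    ∀ (z : Z) (h : (fun j => PSpace.val₂ z.1 (Γ j)) ≠ 0), f z = Projectivization.mk ℂ _ h

/-- Regular maps from a (locally closed) subset of `ℙⁿ × ℙᵐ` to `ℙᵏ`. -/
def IsRegularMap₂ {n m k : ℕ} {Z : Set (PSpace n × PSpace m)} (f : Z → PSpace k) : Prop :=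
  ∀ z₀ : Z, ∃ Γ, IsLocalRep₂ f z₀ Γ

/-- A bijection between `Z ⊆ ℙⁿ` and `W ⊆ ℙᵏ × ℙᵐ` that is an isomorphism of varieties: it is
regular (that is, both of its components are) and so is its inverse. -/
def IsVarietyIso {n k m : ℕ} {Z : Set (PSpace n)} {W : Set (PSpace k × PSpace m)}
    (φ : Z ≃ W) : Prop :=
  IsRegularMap (fun x => (φ x).1.1) ∧ IsRegularMap (fun x => (φ x).1.2) ∧
    IsRegularMap₂ (fun w => (φ.symm w).1)

/-- A finite morphism of projective varieties: a regular map that is proper for the classical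
topology and has finite fibres. -/
def IsFiniteMorphism₂ {n m k : ℕ} {Z : Set (PSpace n × PSpace m)} (f : Z → PSpace k) : Prop :=
  IsRegularMap₂ f ∧ IsProperMap f ∧ ∀ t, (f ⁻¹' {t}).Finite

/-- The fibre of `f` over the general point of `ℙᵏ` (that is, over every point of some nonempty
Zariski open subset) consists of exactly `d` points. -/
def HasDegree₂ {n m k : ℕ} {Z : Set (PSpace n × PSpace m)} (f : Z → PSpace k) (d : ℕ) : Prop :=
  ∃ H : MvPolynomial (Fin (k + 1)) ℂ, H ≠ 0 ∧ (∃ e, H.IsHomogeneous e) ∧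
    ∀ t : PSpace k, t.val H ≠ 0 → (f ⁻¹' {t}).Finite ∧ (f ⁻¹' {t}).ncard = d

/-! ### Derivatives, ramification and branch locus -/

/-- The differential at (the chosen coordinates of) `z` of the polynomial `G`, applied to `u`. -/
noncomputable def PSpace.diff₂ {n m : ℕ} (z : PSpace n × PSpace m)
    (G : MvPolynomial (Fin (n + 1) ⊕ Fin (m + 1)) ℂ) (u : Fin (n + 1) ⊕ Fin (m + 1) → ℂ) : ℂ :=
  ∑ i, PSpace.val₂ z (MvPolynomial.pderiv i G) * u i

/-- `u ∈ ℂⁿ⁺¹ × ℂᵐ⁺¹` represents a Zariski tangent vector to `Z` at `z`: the differentials of all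
bihomogeneous polynomials vanishing on `Z` kill `u`. The tangent space `T_z Z` is the space of
these `u` modulo the vectors of `ℂ · z.1 × ℂ · z.2`. -/
def IsTangentVector₂ {n m : ℕ} (Z : Set (PSpace n × PSpace m)) (z : PSpace n × PSpace m)
    (u : Fin (n + 1) ⊕ Fin (m + 1) → ℂ) : Prop :=
  ∀ G : MvPolynomial (Fin (n + 1) ⊕ Fin (m + 1)) ℂ, (∃ e, IsBihomogeneous G e) →
    (∀ w ∈ Z, PSpace.val₂ w G = 0) → PSpace.diff₂ z G u = 0

/-- `u` represents the zero vector of the tangent space to `ℙⁿ × ℙᵐ` at `z`. -/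
def IsZeroTangent₂ {n m : ℕ} (z : PSpace n × PSpace m)
    (u : Fin (n + 1) ⊕ Fin (m + 1) → ℂ) : Prop :=
  ∃ a b : ℂ, u = Sum.elim (a • z.1.rep) (b • z.2.rep)

/-- The derivative of `f : Z → ℙᵏ` at `z` is degenerate: it sends some nonzero tangent vector
of `Z` at `z` to zero in the tangent space `ℂᵏ⁺¹ / ℂ · f z` of `ℙᵏ` at `f z`. (Used for `Z`
smooth of dimension `k`, where non-injective means non-invertible.) -/
def IsCriticalPoint₂ {n m k : ℕ} {Z : Set (PSpace n × PSpace m)} (f : Z → PSpace k)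
    (z : Z) : Prop :=
  ∃ Γ, IsLocalRep₂ f z Γ ∧ ∃ u, IsTangentVector₂ Z z.1 u ∧ ¬ IsZeroTangent₂ z.1 u ∧
    ∃ c : ℂ, ∀ j, PSpace.diff₂ z.1 (Γ j) u = c * PSpace.val₂ z.1 (Γ j)

/-- The branch locus of `f`: the set of its critical values. -/
def branchLocus₂ {n m k : ℕ} {Z : Set (PSpace n × PSpace m)} (f : Z → PSpace k) :
    Set (PSpace k) :=
  f '' {z | IsCriticalPoint₂ f z}

/-! ### Plane curves

A point `t` of the dual plane `(ℙ²)^*` is written in the dual homogeneous coordinates, so that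
`t` is the line `t^⊥ = {x | t₀ x₀ + t₁ x₁ + t₂ x₂ = 0}`. -/

/-- The dual projective plane. -/
abbrev DualPlane : Type := PSpace 2

/-- The point `x` lies on the line with dual coordinates `t`: `x ∈ t^⊥`. -/
def OnLine (x : PSpace 2) (t : DualPlane) : Prop := Projectivization.orthogonal x t

/-- The pencil `p^⊥ ⊆ (ℙ²)^*` of lines through `p`. -/
def pencil (p : PSpace 2) : Set DualPlane := {t | OnLine p t}

open Classical in
/-- The line joining two distinct points `p` and `x` (the junk value at `x = p` is not used).
As a function of `x`, this is the projection `pr_p` from `p`, with values in `p^⊥`. -/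
noncomputable def lineThrough (p x : PSpace 2) : DualPlane := Projectivization.cross p x

/-- The plane curve with equation `F = 0`. -/
def planeCurve (F : MvPolynomial (Fin 3) ℂ) : Set (PSpace 2) := {x | PSpace.val (n := 2) x F = 0}

/-- The gradient of `F` at the chosen coordinates of `x`. -/
noncomputable def gradientAt (F : MvPolynomial (Fin 3) ℂ) (x : PSpace 2) : Fin 3 → ℂ :=
  fun i => PSpace.val (n := 2) x (MvPolynomial.pderiv i F)

/-- The dual curve of the curve with reduced equation `F = 0`: the closure of the set of lines
tangent to it at its smooth points (those where the gradient of `F` is nonzero). -/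
def dualCurve (F : MvPolynomial (Fin 3) ℂ) : Set DualPlane :=
  closure {t | ∃ x ∈ planeCurve F, ∃ h : gradientAt F x ≠ 0,
    t = Projectivization.mk ℂ (gradientAt F x) h}

/-- The `i`-th standard affine chart `ℂ² → ℙ²`, inserting `1` as the `i`-th coordinate. -/
noncomputable def affineChart (i : Fin 3) (z : Fin 2 → ℂ) : PSpace 2 :=
  Projectivization.mk ℂ (i.insertNth (α := fun _ => ℂ) 1 z) (fun h => by
    have := congrFun h i
    simp at this)

/-- `q` is a node of `C ⊆ ℙ²`: near `q`, the curve is carried to `xy = 0`, and `q` to the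
origin, by a biholomorphic change of coordinates. -/
def IsNode (C : Set (PSpace 2)) (q : PSpace 2) : Prop :=
  ∃ (i : Fin 3) (Φ : OpenPartialHomeomorph (Fin 2 → ℂ) (Fin 2 → ℂ)),
    AnalyticOnNhd ℂ Φ Φ.source ∧ AnalyticOnNhd ℂ Φ.symm Φ.target ∧
    (∃ z₀ ∈ Φ.source, affineChart i z₀ = q ∧ Φ z₀ = 0) ∧
    ∀ z ∈ Φ.source, affineChart i z ∈ C ↔ Φ z 0 * Φ z 1 = 0

/-- `F = 0` is a reduced equation, of degree `d`, of a nodal plane curve: every singular point of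
the curve is a node. -/
structure IsNodalCurve (F : MvPolynomial (Fin 3) ℂ) (d : ℕ) : Prop where
  degree_pos : 0 < d
  homogeneous : F.IsHomogeneous d
  squarefree : Squarefree F
  nodal : ∀ q ∈ planeCurve F, gradientAt F q = 0 → IsNode (planeCurve F) q

/-- `ν : Chat → ℙ²` is the normalization of the curve `C ⊆ ℙ²`: `Chat` is a smooth projective
curve, and `ν` is a finite regular map onto `C` that is an isomorphism over the complement
of a finite subset of `C`. (Properness of `ν` is automatic, as `Chat` is projective.) -/
structure IsNormalization {n : ℕ} (C : Set (PSpace 2)) (Chat : Set (PSpace n))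
    (ν : Chat → PSpace 2) : Prop where
  closed : IsZariskiClosed Chat
  smooth : IsSmoothOfDim Chat 1
  regular : IsRegularMap ν
  range_eq : Set.range ν = C
  finite_fibers : ∀ q, (ν ⁻¹' {q}).Finite
  birational : ∃ S : Set (PSpace 2), S.Finite ∧ ∃ μ : ↥(C \ S) → PSpace n,
    IsRegularMap μ ∧ (∀ y, ∃ h : μ y ∈ Chat, ν ⟨μ y, h⟩ = y.1) ∧
      ∀ (x : Chat) (hx : ν x ∈ C \ S), μ ⟨ν x, hx⟩ = x.1

/-! ### The incidence surface -/

/-- `X_C = {(x, t) ∈ Chat × (ℙ²)^* | ν x ∈ t^⊥}`. -/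
def incidenceSurface {n : ℕ} {Chat : Set (PSpace n)} (ν : Chat → PSpace 2) :
    Set (PSpace n × DualPlane) :=
  {z | ∃ h : z.1 ∈ Chat, OnLine (ν ⟨z.1, h⟩) z.2}

/-- The projection `f_C : X_C → (ℙ²)^*`, `(x, t) ↦ t`. -/
def incidenceProj {n : ℕ} {Chat : Set (PSpace n)} (ν : Chat → PSpace 2)
    (z : incidenceSurface ν) : DualPlane := z.1.2

/-- The preimage `f_C⁻¹(p^⊥)`, as a subset of `ℙⁿ × (ℙ²)^*`. -/
def incidencePreimage {n : ℕ} {Chat : Set (PSpace n)} (ν : Chat → PSpace 2) (p : PSpace 2) :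
    Set (PSpace n × DualPlane) :=
  {z | ∃ h : z ∈ incidenceSurface ν, incidenceProj ν ⟨z, h⟩ ∈ pencil p}

/-! Near a point of `Chat` write `ν = [Γ₀ : Γ₁ : Γ₂]`. There `X_C` is cut out of `Chat × (ℙ²)^*` by
the single equation `∑ tⱼ Γⱼ = 0`, whose gradient in `t` is `(Γⱼ) ≠ 0`. Closedness and smoothness
follow from this.

The fibre of `f_C` over `t` is the preimage under `ν` of `C ∩ t^⊥`. It is finite because `C`
contains no line. For the count, `F` is restricted to a line `u ↦ uP + Q` with `P ∉ C`; the points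
are the roots of a polynomial of degree `d`. The discriminant of this restriction does not vanish
identically because `F` is squarefree (`lineDisc_generic_ne_zero`). A general line also avoids the
finite set over which `ν` may fail to be injective.

The kernel of the derivative of `f_C` consists of vertical vectors `(u, 0)` with `u` tangent to
`Chat`. Such a vector is tangent to `X_C` at `(x, t)` exactly when `t` annihilates both `ν x` and
the velocity of `ν` along `u`. Tangent vectors are handled through analytic arcs supplied by the
inverse function theorem. Tangent lines at smooth points of `C` satisfy both equations, and the
branch locus is closed by compactness, so it contains `C^*`.

The other inclusion is where nodality enters: it makes `ν` an immersion
(`IsArc.crossProduct_ne_zero`). Over a cusp the whole pencil through the image point would be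
critical. In the immersed case `t` is spanned by `q 0` and `q' 0` for an arc `q` on `C`, hence is a
limit of the lines spanned by `q s` and `q' s`, which are tangent to `C` at smooth points. To see
the immersion, take local coordinates in which `C` lies in `xy = 0`. One coordinate vanishes
identically along the arc. If the velocity were zero, the other would be constant or look like a
constant plus `s ^ k` with `k ≥ 2`, so it would repeat values; but `ν` is injective off a finite
set.

Finally, for `p ∉ C` the line joining `p` and `ν x` is determined by `x`, so the first projection
inverts `x ↦ (x, line through p and ν x)`. -/

/-! ### Differentials of polynomials -/

open MvPolynomial in
theorem hasStrictFDerivAt_eval {σ : Type*} [Fintype σ] (G : MvPolynomial σ ℂ) (v : σ → ℂ) :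
    HasStrictFDerivAt (fun x => eval x G)
      (∑ i, eval v (pderiv i G) • ContinuousLinearMap.proj (R := ℂ) (φ := fun _ : σ => ℂ) i) v := by
  classical
  induction G using MvPolynomial.induction_on with
  | C a =>
    simp only [eval_C, pderiv_C, map_zero]
    exact (hasStrictFDerivAt_const (𝕜 := ℂ) a v).congr_fderiv (by ext; simp)
  | add p q hp hq =>
    have h := hp.add hq
    rw [← Finset.sum_add_distrib] at h
    simp only [← add_smul] at h
    simpa only [map_add] using! h
  | mul_X p j hp =>
    have hj := (ContinuousLinearMap.proj (R := ℂ) (φ := fun _ : σ => ℂ) j).hasStrictFDerivAt (x := v)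
    have h := (hp.mul hj).congr_fderiv
      (g' := ∑ i, eval v (pderiv i (p * X j)) • ContinuousLinearMap.proj (R := ℂ) i) (by
        ext u
        simp [Finset.mul_sum, Pi.single_apply, mul_comm, apply_ite, mul_add,
          Finset.sum_add_distrib, mul_left_comm])
    simpa only [map_mul, eval_X] using! h

/-- The differential at `v` of the polynomial `G`, applied to `u`. -/
noncomputable def polyDiff {σ : Type*} [Fintype σ] (G : MvPolynomial σ ℂ) (v u : σ → ℂ) : ℂ :=
  ∑ i, MvPolynomial.eval v (MvPolynomial.pderiv i G) * u i

theorem hasDerivAt_eval_comp {σ : Type*} [Fintype σ] (G : MvPolynomial σ ℂ) {γ : ℂ → σ → ℂ}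
    {γ' : σ → ℂ} {s : ℂ} (h : HasDerivAt γ γ' s) :
    HasDerivAt (fun s => MvPolynomial.eval (γ s) G) (polyDiff G (γ s) γ') s := by
  have := (hasStrictFDerivAt_eval G (γ s)).hasFDerivAt.comp_hasDerivAt s h
  simpa [polyDiff] using! this

theorem polyDiff_add {σ : Type*} [Fintype σ] (G : MvPolynomial σ ℂ) (v u u' : σ → ℂ) :
    polyDiff G v (u + u') = polyDiff G v u + polyDiff G v u' := by
  simp [polyDiff, mul_add, Finset.sum_add_distrib]

theorem polyDiff_smul {σ : Type*} [Fintype σ] (G : MvPolynomial σ ℂ) (v u : σ → ℂ) (a : ℂ) :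
    polyDiff G v (a • u) = a * polyDiff G v u := by
  simp only [polyDiff, Finset.mul_sum, Pi.smul_apply, smul_eq_mul]
  exact Finset.sum_congr rfl fun _ _ => by ring

theorem polyDiff_mul {σ : Type*} [Fintype σ] (G H : MvPolynomial σ ℂ) (v u : σ → ℂ) :
    polyDiff (G * H) v u =
      MvPolynomial.eval v G * polyDiff H v u + MvPolynomial.eval v H * polyDiff G v u := by
  simp [polyDiff, Derivation.leibniz, add_mul, Finset.sum_add_distrib, Finset.mul_sum, mul_assoc]

theorem polyDiff_sub {σ : Type*} [Fintype σ] (G H : MvPolynomial σ ℂ) (v u : σ → ℂ) :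
    polyDiff (G - H) v u = polyDiff G v u - polyDiff H v u := by
  simp [polyDiff, sub_mul, Finset.sum_sub_distrib]

theorem polyDiff_sum {σ ι : Type*} [Fintype σ] (s : Finset ι) (G : ι → MvPolynomial σ ℂ)
    (v u : σ → ℂ) : polyDiff (∑ j ∈ s, G j) v u = ∑ j ∈ s, polyDiff (G j) v u := by
  simp only [polyDiff, map_sum, Finset.sum_mul]
  exact Finset.sum_comm

theorem polyDiff_X {σ : Type*} [Fintype σ] (i : σ) (v u : σ → ℂ) :
    polyDiff (MvPolynomial.X i) v u = u i := by
  classical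
  simp [polyDiff, MvPolynomial.pderiv_X, Pi.single_apply, apply_ite]

/-- Both sides are the derivative at `0` of the same function along the line `v + s u`. -/
theorem polyDiff_rename_inl {σ τ : Type*} [Fintype σ] [Fintype τ] (G : MvPolynomial σ ℂ)
    (v u : σ ⊕ τ → ℂ) :
    polyDiff (MvPolynomial.rename Sum.inl G) v u = polyDiff G (v ∘ Sum.inl) (u ∘ Sum.inl) := by
  have h1 : HasDerivAt (fun s : ℂ => v + s • u) u 0 := by
    simpa using ((hasDerivAt_id (0 : ℂ)).smul_const u).const_add v
  have h2 : HasDerivAt (fun s : ℂ => v ∘ Sum.inl + s • (u ∘ Sum.inl)) (u ∘ Sum.inl) 0 := by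
    simpa using ((hasDerivAt_id (0 : ℂ)).smul_const (u ∘ Sum.inl)).const_add (v ∘ Sum.inl)
  have h3 := hasDerivAt_eval_comp (MvPolynomial.rename Sum.inl G) h1
  have h4 := hasDerivAt_eval_comp G h2
  simp only [MvPolynomial.eval_rename, zero_smul, add_zero] at h3 h4
  exact h3.unique h4

/-! ### Homogeneous forms and change of homogeneous coordinates -/

/-- Scaling the coordinates of a homogeneous polynomial. -/
theorem MvPolynomial.IsHomogeneous.eval_smul {σ : Type*} {G : MvPolynomial σ ℂ} {e : ℕ}
    (hG : G.IsHomogeneous e) (a : ℂ) (v : σ → ℂ) :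
    MvPolynomial.eval (a • v) G = a ^ e * MvPolynomial.eval v G := by
  simp only [MvPolynomial.eval_eq, Finset.mul_sum, Pi.smul_apply, smul_eq_mul, mul_pow,
    Finset.prod_mul_distrib]
  refine Finset.sum_congr rfl fun m hm => ?_
  have h : m.degree = e := by
    have := hG (MvPolynomial.mem_support_iff.1 hm)
    rw [Finsupp.degree_eq_weight_one (R := ℕ)]; exact this
  rw [Finset.prod_pow_eq_pow_sum, ← h, Finsupp.degree_apply]
  ring

theorem IsBihomogeneous.eval_smul {n m : ℕ}
    {G : MvPolynomial (Fin (n + 1) ⊕ Fin (m + 1)) ℂ} {e : ℕ × ℕ}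
    (hG : IsBihomogeneous G e) (a b : ℂ) (v : Fin (n + 1) → ℂ) (w : Fin (m + 1) → ℂ) :
    MvPolynomial.eval (Sum.elim (a • v) (b • w)) G =
      a ^ e.1 * b ^ e.2 * MvPolynomial.eval (Sum.elim v w) G := by
  simp only [MvPolynomial.eval_eq', Finset.mul_sum]
  refine Finset.sum_congr rfl fun k hk => ?_
  have h := hG (MvPolynomial.mem_support_iff.1 hk)
  rw [Finsupp.weight_apply, Finsupp.sum_fintype _ _ (by simp)] at h
  simp only [Fintype.sum_sum_type, Sum.elim_inl, Sum.elim_inr] at h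
  have h1 : ∑ i, k (Sum.inl i) = e.1 := by
    rw [← h]; simp [Prod.fst_sum]
  have h2 : ∑ i, k (Sum.inr i) = e.2 := by
    rw [← h]; simp [Prod.snd_sum]
  simp only [Fintype.prod_sum_type, Sum.elim_inl, Sum.elim_inr, Pi.smul_apply, smul_eq_mul, mul_pow,
    Finset.prod_mul_distrib, Finset.prod_pow_eq_pow_sum, h1, h2]
  ring

theorem isBihomogeneous_rename_inl {n m : ℕ} {G : MvPolynomial (Fin (n + 1)) ℂ} {e : ℕ}
    (hG : G.IsHomogeneous e) :
    IsBihomogeneous (m := m) (MvPolynomial.rename Sum.inl G) (e, 0) := by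
  intro k hk
  obtain ⟨u, rfl, hu⟩ := MvPolynomial.coeff_rename_ne_zero _ _ _ hk
  have h := hG hu
  rw [Finsupp.weight_apply] at h ⊢
  rw [Finsupp.sum_mapDomain_index (by simp) (by simp [add_mul])]
  rw [Finsupp.sum_fintype _ _ (by simp)] at h ⊢
  ext <;> simp [Prod.fst_sum, Prod.snd_sum] at h ⊢
  exact h

theorem isBihomogeneous_X_inr {n m : ℕ} (j : Fin (m + 1)) :
    IsBihomogeneous (n := n) (m := m) (MvPolynomial.X (Sum.inr j)) (0, 1) :=
  MvPolynomial.isWeightedHomogeneous_X _ _ _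

theorem isBihomogeneous_X_inl {n m : ℕ} (j : Fin (n + 1)) :
    IsBihomogeneous (n := n) (m := m) (MvPolynomial.X (Sum.inl j)) (1, 0) :=
  MvPolynomial.isWeightedHomogeneous_X _ _ _

theorem PSpace.exists_rep_mk {n : ℕ} (v : Fin (n + 1) → ℂ) (hv : v ≠ 0) :
    ∃ a : ℂ, a ≠ 0 ∧ (Projectivization.mk ℂ v hv).rep = a • v := by
  obtain ⟨a, ha⟩ := Projectivization.exists_smul_eq_mk_rep ℂ v hv
  exact ⟨a, a.ne_zero, ha.symm⟩

theorem PSpace.val_mk_eq_zero {n : ℕ} {G : MvPolynomial (Fin (n + 1)) ℂ} {e : ℕ}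
    (hG : G.IsHomogeneous e) (v : Fin (n + 1) → ℂ) (hv : v ≠ 0) :
    PSpace.val (Projectivization.mk ℂ v hv) G = 0 ↔ MvPolynomial.eval v G = 0 := by
  obtain ⟨a, ha, h⟩ := PSpace.exists_rep_mk v hv
  rw [PSpace.val, h, hG.eval_smul]
  simp [ha]

theorem PSpace.val₂_mk_eq_zero {n m : ℕ} {G : MvPolynomial (Fin (n + 1) ⊕ Fin (m + 1)) ℂ}
    {e : ℕ × ℕ} (hG : IsBihomogeneous G e) (v : Fin (n + 1) → ℂ) (hv : v ≠ 0)
    (w : Fin (m + 1) → ℂ) (hw : w ≠ 0) :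
    PSpace.val₂ (Projectivization.mk ℂ v hv, Projectivization.mk ℂ w hw) G = 0 ↔
      MvPolynomial.eval (Sum.elim v w) G = 0 := by
  obtain ⟨a, ha, h⟩ := PSpace.exists_rep_mk v hv
  obtain ⟨b, hb, h'⟩ := PSpace.exists_rep_mk w hw
  rw [PSpace.val₂, PSpace.coords]
  simp only
  rw [h, h', hG.eval_smul]
  simp [ha, hb]

theorem PSpace.val₂_rename_inl {n m : ℕ} (z : PSpace n × PSpace m)
    (G : MvPolynomial (Fin (n + 1)) ℂ) :
    PSpace.val₂ z (MvPolynomial.rename Sum.inl G) = z.1.val G := by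
  simp only [PSpace.val₂, PSpace.val, MvPolynomial.eval_rename]
  rfl

/-- Scaling the differential of a bihomogeneous polynomial. -/
theorem IsBihomogeneous.polyDiff_smul {n m : ℕ}
    {G : MvPolynomial (Fin (n + 1) ⊕ Fin (m + 1)) ℂ} {e : ℕ × ℕ}
    (hG : IsBihomogeneous G e) (a b : ℂ) (v v' : Fin (n + 1) → ℂ) (w w' : Fin (m + 1) → ℂ) :
    polyDiff G (Sum.elim (a • v) (b • w)) (Sum.elim (a • v') (b • w')) =
      a ^ e.1 * b ^ e.2 * polyDiff G (Sum.elim v w) (Sum.elim v' w') := by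
  have h0 : ∀ x y : Fin (n + 1) ⊕ Fin (m + 1) → ℂ, HasDerivAt (fun s : ℂ => x + s • y) y 0 := by
    intro x y
    simpa using ((hasDerivAt_id (0 : ℂ)).smul_const y).const_add x
  have h1 := hasDerivAt_eval_comp G (h0 (Sum.elim (a • v) (b • w)) (Sum.elim (a • v') (b • w')))
  have h2 := (hasDerivAt_eval_comp G (h0 (Sum.elim v w) (Sum.elim v' w'))).const_mul
    (a ^ e.1 * b ^ e.2)
  simp only [zero_smul, add_zero] at h1 h2
  refine h1.unique (h2.congr_of_eventuallyEq (Filter.Eventually.of_forall fun s => ?_))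
  have e1 : Sum.elim (a • v) (b • w) + s • Sum.elim (a • v') (b • w') =
      Sum.elim (a • (v + s • v')) (b • (w + s • w')) := by
    ext i; rcases i with i | i <;> simp <;> ring
  have e2 : Sum.elim v w + s • Sum.elim v' w' = Sum.elim (v + s • v') (w + s • w') := by
    ext i; rcases i with i | i <;> simp
  simp only [e1, e2, hG.eval_smul]

/-- Euler's identity. -/
theorem MvPolynomial.IsHomogeneous.polyDiff_self {σ : Type*} [Fintype σ] {G : MvPolynomial σ ℂ}
    {e : ℕ} (hG : G.IsHomogeneous e) (v : σ → ℂ) :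
    polyDiff G v v = e * MvPolynomial.eval v G := by
  have := congrArg (MvPolynomial.eval v) hG.sum_X_mul_pderiv
  simpa [polyDiff, mul_comm] using this

/-! ### Topology of projective spaces -/

theorem PSpace.continuous_mk (n : ℕ) :
    Continuous (fun v : {v : Fin (n + 1) → ℂ // v ≠ 0} => Projectivization.mk ℂ v.1 v.2) :=
  continuous_coinduced_rng

theorem PSpace.exists_unit_rep {n : ℕ} (z : PSpace n) :
    ∃ v : Fin (n + 1) → ℂ, ‖v‖ = 1 ∧ ∃ h : v ≠ 0, Projectivization.mk ℂ v h = z := by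
  have h0 := z.rep_nonzero
  have h1 : (‖z.rep‖ : ℂ) ≠ 0 := by simpa using h0
  have h2 : ((‖z.rep‖ : ℂ)⁻¹ • z.rep) ≠ 0 := smul_ne_zero (inv_ne_zero h1) h0
  refine ⟨(‖z.rep‖ : ℂ)⁻¹ • z.rep, ?_, h2, ?_⟩
  · rw [norm_smul]
    simp [h0]
  · conv_rhs => rw [← z.mk_rep]
    rw [Projectivization.mk_eq_mk_iff']
    exact ⟨_, rfl⟩

/-- The orthogonal projection onto the line spanned by a vector. -/
noncomputable def PSpace.projMatrix {n : ℕ} : PSpace n → Fin (n + 1) → Fin (n + 1) → ℂ :=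
  Projectivization.lift
    (fun v i j => v.1 i * star (v.1 j) * (∑ k, v.1 k * star (v.1 k))⁻¹) (by
      rintro ⟨a, ha⟩ ⟨b, hb⟩ t rfl
      have ht : t ≠ 0 := by rintro rfl; simp at ha
      ext i j
      have : ∑ k, (t • b) k * star ((t • b) k) = (t * star t) * ∑ k, b k * star (b k) := by
        rw [Finset.mul_sum]
        exact Finset.sum_congr rfl fun k _ => by simp; ring
      simp only [this, mul_inv]
      simp only [Pi.smul_apply, smul_eq_mul, star_mul']
      have ht' : star t ≠ 0 := by simpa using ht
      field_simp)

theorem sum_mul_star_ne_zero {ι : Type*} [Fintype ι] {v : ι → ℂ} (hv : v ≠ 0) :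
    ∑ k, v k * star (v k) ≠ 0 := by
  intro h
  apply hv
  have : v ⬝ᵥ star v = 0 := h
  rw [dotProduct_comm] at this
  open ComplexOrder in
  exact dotProduct_star_self_eq_zero.1 this

theorem PSpace.continuous_projMatrix (n : ℕ) : Continuous (PSpace.projMatrix (n := n)) := by
  refine continuous_coinduced_dom.2 ?_
  refine continuous_pi fun i => continuous_pi fun j => ?_
  have hc : ∀ k : Fin (n + 1), Continuous fun v : {v : Fin (n + 1) → ℂ // v ≠ 0} => v.1 k :=
    fun k => (continuous_apply k).comp continuous_subtype_val
  refine ((hc i).mul (hc j).star).mul (Continuous.inv₀ ?_ fun v => sum_mul_star_ne_zero v.2)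
  exact continuous_finsetSum _ fun k _ => (hc k).mul (hc k).star

/-- Column `j` of the projection is a multiple of the vector, nonzero as soon as its `j`-th
coordinate is, so the matrix determines the line. -/
theorem PSpace.injective_projMatrix (n : ℕ) :
    Function.Injective (PSpace.projMatrix (n := n)) := by
  intro x y h
  induction x using Projectivization.ind with | h v hv =>
  induction y using Projectivization.ind with | h w hw =>
  obtain ⟨j, hj⟩ := Function.ne_iff.1 hw
  rw [Projectivization.mk_eq_mk_iff']
  have hs := sum_mul_star_ne_zero hw
  have h' : ∀ i, v i * star (v j) * (∑ k, v k * star (v k))⁻¹ =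
      w i * star (w j) * (∑ k, w k * star (w k))⁻¹ := fun i => congrFun (congrFun h i) j
  have hvj : star (v j) ≠ 0 := by
    intro h0
    have := h' j
    rw [h0] at this
    simp only [mul_zero, zero_mul] at this
    have := this.symm
    simp only [mul_eq_zero, inv_eq_zero, hs, or_false, star_eq_zero, or_self] at this
    exact hj this
  have hs' := sum_mul_star_ne_zero hv
  refine ⟨star (w j) * (∑ k, w k * star (w k))⁻¹ * ((star (v j))⁻¹ * ∑ k, v k * star (v k)), ?_⟩
  ext i
  have := h' i
  simp only [Pi.smul_apply, smul_eq_mul]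
  calc _ = (w i * star (w j) * (∑ k, w k * star (w k))⁻¹) *
        ((star (v j))⁻¹ * ∑ k, v k * star (v k)) := by ring
    _ = _ := by rw [← this]; field_simp

/-- A line is recovered from its orthogonal projection, which depends continuously on it. The
Hausdorff property is needed for properness of `f_C` and for closedness of compact images. -/
instance PSpace.t2Space (n : ℕ) : T2Space (PSpace n) :=
  T2Space.of_injective_continuous (PSpace.injective_projMatrix n) (PSpace.continuous_projMatrix n)

theorem continuous_eval_sumElim {n m : ℕ}
    (G : MvPolynomial (Fin (n + 1) ⊕ Fin (m + 1)) ℂ) :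
    Continuous fun p : (Fin (n + 1) → ℂ) × (Fin (m + 1) → ℂ) =>
      MvPolynomial.eval (Sum.elim p.1 p.2) G := by
  refine (MvPolynomial.continuous_eval G).comp (continuous_pi fun i => ?_)
  rcases i with i | i
  · exact (continuous_apply i).comp continuous_fst
  · exact (continuous_apply i).comp continuous_snd

/-- By bihomogeneity the equations can be imposed on unit vectors, where they cut out a compact set
that maps onto `Z`. -/
theorem IsZariskiClosed₂.isCompact {n m : ℕ} {Z : Set (PSpace n × PSpace m)}
    (hZ : IsZariskiClosed₂ Z) : IsCompact Z := by
  obtain ⟨I, hI, hZ⟩ := hZ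
  let K : Set ((Fin (n + 1) → ℂ) × (Fin (m + 1) → ℂ)) :=
    (Metric.sphere 0 1 ×ˢ Metric.sphere 0 1) ∩
      ⋂ G ∈ I, {p | MvPolynomial.eval (Sum.elim p.1 p.2) G = 0}
  have hK : IsCompact K := by
    refine ((isCompact_sphere _ _).prod (isCompact_sphere _ _)).inter_right ?_
    exact isClosed_biInter fun G _ => isClosed_eq (continuous_eval_sumElim G) continuous_const
  have h1 : ∀ p : K, p.1.1 ≠ 0 := fun p h => by
    have := p.2.1.1
    simp [h] at this
  have h2 : ∀ p : K, p.1.2 ≠ 0 := fun p h => by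
    have := p.2.1.2
    simp [h] at this
  have hc : Continuous fun p : K =>
      ((Projectivization.mk ℂ p.1.1 (h1 p), Projectivization.mk ℂ p.1.2 (h2 p)) :
        PSpace n × PSpace m) := by
    refine Continuous.prodMk ?_ ?_
    · exact (PSpace.continuous_mk n).comp
        (f := fun p : K => (⟨p.1.1, h1 p⟩ : {v : Fin (n + 1) → ℂ // v ≠ 0})) (by fun_prop)
    · exact (PSpace.continuous_mk m).comp
        (f := fun p : K => (⟨p.1.2, h2 p⟩ : {v : Fin (m + 1) → ℂ // v ≠ 0})) (by fun_prop)
  have : CompactSpace K := isCompact_iff_compactSpace.1 hK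
  convert isCompact_range hc
  ext z
  rw [hZ]
  constructor
  · intro h
    obtain ⟨v, hv, hv0, hvz⟩ := PSpace.exists_unit_rep z.1
    obtain ⟨w, hw, hw0, hwz⟩ := PSpace.exists_unit_rep z.2
    refine ⟨⟨(v, w), ⟨by simpa using hv, by simpa using hw⟩, ?_⟩, Prod.ext hvz hwz⟩
    simp only [Set.mem_iInter, Set.mem_ofPred_eq]
    intro G hG
    obtain ⟨e, he⟩ := hI G hG
    rw [← PSpace.val₂_mk_eq_zero he v hv0 w hw0, hvz, hwz]
    exact h G hG
  · rintro ⟨p, rfl⟩ G hG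
    obtain ⟨e, he⟩ := hI G hG
    rw [PSpace.val₂_mk_eq_zero he]
    have := p.2.2
    simp only [Set.mem_iInter] at this
    exact this G hG

/-! ### The incidence surface -/

theorem onLine_mk_iff {v : Fin 3 → ℂ} (hv : v ≠ 0) (t : DualPlane) :
    OnLine (Projectivization.mk ℂ v hv) t ↔ ∑ i, t.rep i * v i = 0 := by
  conv_lhs => rw [← t.mk_rep]
  rw [OnLine, Projectivization.orthogonal_mk, dotProduct]
  simp only [mul_comm]

/-- The equation of the incidence surface given by a local representation of `ν`. -/
noncomputable def incidencePoly {n : ℕ} (Γ : Fin 3 → MvPolynomial (Fin (n + 1)) ℂ) :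
    MvPolynomial (Fin (n + 1) ⊕ Fin (2 + 1)) ℂ :=
  ∑ j : Fin 3, MvPolynomial.X (Sum.inr j) * MvPolynomial.rename Sum.inl (Γ j)

theorem isBihomogeneous_incidencePoly {n : ℕ} {Γ : Fin 3 → MvPolynomial (Fin (n + 1)) ℂ} {e : ℕ}
    (hΓ : ∀ j, (Γ j).IsHomogeneous e) : IsBihomogeneous (incidencePoly Γ) (e, 1) := by
  refine Submodule.sum_mem (MvPolynomial.weightedHomogeneousSubmodule ℂ _ _) fun j _ => ?_
  have := (isBihomogeneous_X_inr (n := n) (m := 2) j).mul (isBihomogeneous_rename_inl (hΓ j))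
  simpa [MvPolynomial.mem_weightedHomogeneousSubmodule] using! this

theorem eval_incidencePoly {n : ℕ} (Γ : Fin 3 → MvPolynomial (Fin (n + 1)) ℂ)
    (v : Fin (n + 1) → ℂ) (w : Fin 3 → ℂ) :
    MvPolynomial.eval (Sum.elim v w) (incidencePoly Γ) =
      ∑ j, w j * MvPolynomial.eval v (Γ j) := by
  simp [incidencePoly, MvPolynomial.eval_rename]

theorem polyDiff_incidencePoly {n : ℕ} (Γ : Fin 3 → MvPolynomial (Fin (n + 1)) ℂ)
    (v v' : Fin (n + 1) → ℂ) (w w' : Fin 3 → ℂ) :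
    polyDiff (incidencePoly Γ) (Sum.elim v w) (Sum.elim v' w') =
      ∑ j, (w j * polyDiff (Γ j) v v' + MvPolynomial.eval v (Γ j) * w' j) := by
  simp [incidencePoly, polyDiff_sum, polyDiff_mul, MvPolynomial.eval_rename, polyDiff_X,
    polyDiff_rename_inl]

section

variable {n : ℕ} {Chat : Set (PSpace n)} {ν : Chat → PSpace 2}

theorem val₂_incidencePoly (Γ : Fin 3 → MvPolynomial (Fin (n + 1)) ℂ) (z : PSpace n × PSpace 2) :
    PSpace.val₂ z (incidencePoly Γ) = ∑ j, z.2.rep j * z.1.val (Γ j) :=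
  eval_incidencePoly Γ _ _

theorem IsLocalRep.onLine_iff {z₀ : Chat} {Γ : Fin 3 → MvPolynomial (Fin (n + 1)) ℂ}
    (hΓ : IsLocalRep ν z₀ Γ) (x : Chat) (hx : (fun j => x.1.val (Γ j)) ≠ 0) (t : DualPlane) :
    OnLine (ν x) t ↔ PSpace.val₂ (x.1, t) (incidencePoly Γ) = 0 := by
  rw [hΓ.2.2 x hx, onLine_mk_iff, val₂_incidencePoly]

/-- Where all `Γ j` vanish the equation holds trivially, so the local equation is valid on the whole
surface and not only near `z₀`. -/
theorem IsLocalRep.incidencePoly_eq_zero {z₀ : Chat} {Γ : Fin 3 → MvPolynomial (Fin (n + 1)) ℂ}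
    (hΓ : IsLocalRep ν z₀ Γ) (z : PSpace n × DualPlane) (hz : z ∈ incidenceSurface ν) :
    PSpace.val₂ z (incidencePoly Γ) = 0 := by
  obtain ⟨h, hl⟩ := hz
  by_cases hx : (fun j => z.1.val (Γ j)) = 0
  · rw [val₂_incidencePoly]
    exact Finset.sum_eq_zero fun j _ => by rw [show z.1.val (Γ j) = 0 from congrFun hx j, mul_zero]
  · exact (hΓ.onLine_iff ⟨z.1, h⟩ hx z.2).1 hl

/-- As `ν` is only locally given by forms, the equations taken are all bihomogeneous forms vanishing
on the surface. Among them are the equations of `Chat` and every local incidence equation, which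
suffice. -/
theorem isZariskiClosed_incidenceSurface (hC : IsZariskiClosed Chat) (hν : IsRegularMap ν) :
    IsZariskiClosed₂ (incidenceSurface ν) := by
  refine ⟨{G | (∃ e, IsBihomogeneous G e) ∧ ∀ w ∈ incidenceSurface ν, PSpace.val₂ w G = 0},
    fun G hG => hG.1, fun z => ⟨fun hz G hG => hG.2 z hz, fun h => ?_⟩⟩
  obtain ⟨I, hI, hC⟩ := hC
  have h1 : z.1 ∈ Chat := by
    rw [hC]
    intro G hG
    rw [← PSpace.val₂_rename_inl]
    obtain ⟨e, he⟩ := hI G hG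
    refine h _ ⟨⟨_, isBihomogeneous_rename_inl he⟩, fun w hw => ?_⟩
    rw [PSpace.val₂_rename_inl]
    exact (hC _).1 hw.1 G hG
  obtain ⟨Γ, hΓ⟩ := hν ⟨z.1, h1⟩
  refine ⟨h1, (hΓ.onLine_iff _ hΓ.2.1 _).2 ?_⟩
  obtain ⟨e, he⟩ := hΓ.1
  exact h _ ⟨⟨_, isBihomogeneous_incidencePoly he⟩, hΓ.incidencePoly_eq_zero⟩

theorem polyDiff_single {σ : Type*} [Fintype σ] [DecidableEq σ] (G : MvPolynomial σ ℂ) (v : σ → ℂ)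
    (i : σ) : polyDiff G v (Pi.single i 1) = MvPolynomial.eval v (MvPolynomial.pderiv i G) := by
  simp [polyDiff, Pi.single_apply]

/-- The Jacobian matrix is block triangular: the equations of `Chat` do not involve `t`, and the
incidence equation has `t`-derivative `Γ i ≠ 0` for a suitable `i`. Multiplying `H` by `Γ i`
restricts to the open set where `Γ` represents `ν`. -/
theorem isSmoothOfDim_incidenceSurface (hC : IsSmoothOfDim Chat 1) (hν : IsRegularMap ν) :
    IsSmoothOfDim₂ (incidenceSurface ν) 2 := by
  intro z hz
  obtain ⟨h1, hl⟩ := hz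
  obtain ⟨c, hc, G, hG, H, ⟨eH, hH⟩, hHz, hloc, hind⟩ := hC z.1 h1
  obtain ⟨Γ, hΓ⟩ := hν ⟨z.1, h1⟩
  obtain ⟨e, he⟩ := hΓ.1
  obtain ⟨i, hi⟩ := Function.ne_iff.1 hΓ.2.1
  refine ⟨c + 1, by omega,
    Fin.cons (incidencePoly Γ) (fun j => MvPolynomial.rename Sum.inl (G j)), ?_,
    MvPolynomial.rename Sum.inl (H * Γ i), ⟨_, isBihomogeneous_rename_inl (hH.mul (he i))⟩, ?_, ?_,
    ?_⟩
  · refine Fin.cases ⟨_, isBihomogeneous_incidencePoly he⟩ fun j => ?_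
    obtain ⟨e', he'⟩ := hG j
    exact ⟨_, isBihomogeneous_rename_inl he'⟩
  · rw [PSpace.val₂_rename_inl, PSpace.val, map_mul]
    exact mul_ne_zero hHz hi
  · intro w hw
    rw [PSpace.val₂_rename_inl, PSpace.val, map_mul] at hw
    have hw1 : w.1.val H ≠ 0 := left_ne_zero_of_mul hw
    have hw2 : (fun j => w.1.val (Γ j)) ≠ 0 :=
      fun h0 => right_ne_zero_of_mul hw (congrFun h0 i)
    rw [Fin.forall_fin_succ]
    simp only [Fin.cons_zero, Fin.cons_succ, PSpace.val₂_rename_inl]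
    rw [← hloc w.1 hw1]
    constructor
    · rintro ⟨hwC, hwl⟩
      exact ⟨(hΓ.onLine_iff ⟨w.1, hwC⟩ hw2 w.2).1 hwl, hwC⟩
    · rintro ⟨hwl, hwC⟩
      exact ⟨hwC, (hΓ.onLine_iff ⟨w.1, hwC⟩ hw2 w.2).2 hwl⟩
  · have key : ∀ (j : Fin c) (s : Fin (n + 1) ⊕ Fin (2 + 1)),
        PSpace.val₂ z (MvPolynomial.pderiv s (MvPolynomial.rename Sum.inl (G j))) =
          Sum.elim (fun i => z.1.val (MvPolynomial.pderiv i (G j))) 0 s := by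
      intro j s
      rw [PSpace.val₂, ← polyDiff_single, polyDiff_rename_inl]
      rcases s with s | s
      · have : (Pi.single (Sum.inl s) (1 : ℂ) : Fin (n + 1) ⊕ Fin (2 + 1) → ℂ) ∘ Sum.inl =
            Pi.single s 1 := by
          ext k; simp [Pi.single_apply]
        rw [this, polyDiff_single]
        rfl
      · have : (Pi.single (Sum.inr s) (1 : ℂ) : Fin (n + 1) ⊕ Fin (2 + 1) → ℂ) ∘ Sum.inl =
            0 := by
          ext k; simp
        rw [this]
        simp [polyDiff]
    have hcons : (fun (j : Fin (c + 1)) s => PSpace.val₂ z (MvPolynomial.pderiv s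
        ((Fin.cons (incidencePoly Γ) (fun j => MvPolynomial.rename Sum.inl (G j)) :
          Fin (c + 1) → MvPolynomial (Fin (n + 1) ⊕ Fin (2 + 1)) ℂ) j))) =
        Fin.cons (fun s => PSpace.val₂ z (MvPolynomial.pderiv s (incidencePoly Γ)))
          (fun j => Sum.elim (fun i => z.1.val (MvPolynomial.pderiv i (G j))) 0) := by
      ext j s
      refine Fin.cases ?_ (fun j => ?_) j
      · simp
      · simp only [Fin.cons_succ, key]
    rw [hcons, linearIndependent_finCons]
    constructor
    · refine LinearIndependent.of_comp
        (LinearMap.funLeft ℂ ℂ (Sum.inl : Fin (n + 1) → Fin (n + 1) ⊕ Fin (2 + 1))) ?_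
      exact hind
    · intro hmem
      have hle : Submodule.span ℂ (Set.range fun j =>
          (Sum.elim (fun i => z.1.val (MvPolynomial.pderiv i (G j))) 0 :
            Fin (n + 1) ⊕ Fin (2 + 1) → ℂ)) ≤
          LinearMap.ker (LinearMap.proj (R := ℂ) (φ := fun _ => ℂ)
            (Sum.inr i : Fin (n + 1) ⊕ Fin (2 + 1))) := by
        rw [Submodule.span_le]
        rintro _ ⟨j, rfl⟩
        simp
      have := hle hmem
      rw [LinearMap.mem_ker, LinearMap.proj_apply, PSpace.val₂, ← polyDiff_single] at this
      have hs : (Pi.single (Sum.inr i) (1 : ℂ) : Fin (n + 1) ⊕ Fin (2 + 1) → ℂ) =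
          Sum.elim (0 : Fin (n + 1) → ℂ) (Pi.single i 1) := by
        ext k; rcases k with k | k <;> simp [Pi.single_apply]
      rw [hs, PSpace.coords, polyDiff_incidencePoly] at this
      apply hi
      simpa [Pi.single_apply, polyDiff, PSpace.val] using this

end

/-! ### Lines in the plane -/

/-- The matrix with rows `v`, `P`, `Q` kills `t`, so its rows are dependent; since `P` and `Q` are
independent, the relation involves `v`. -/
theorem exists_eq_smul_add_smul_of_orthogonal {t P Q v : Fin 3 → ℂ} (ht : t ≠ 0)
    (hP : P ⬝ᵥ t = 0) (hQ : Q ⬝ᵥ t = 0) (hv : v ⬝ᵥ t = 0) (hPQ : crossProduct P Q ≠ 0) :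
    ∃ α β : ℂ, v = α • P + β • Q := by
  have hdet : (Matrix.of ![v, P, Q]).det = 0 := by
    refine Matrix.exists_mulVec_eq_zero_iff.1 ⟨t, ht, ?_⟩
    ext i
    fin_cases i
    · simpa [Matrix.mulVec] using hv
    · simpa [Matrix.mulVec] using hP
    · simpa [Matrix.mulVec] using hQ
  obtain ⟨c, hc, h⟩ := Matrix.exists_vecMul_eq_zero_iff.2 hdet
  have h' : c 0 • v + c 1 • P + c 2 • Q = 0 := by
    rw [← h]
    ext i
    simp [Matrix.vecMul, dotProduct, Fin.sum_univ_three]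
  have h0 : c 0 ≠ 0 := by
    intro h0
    rw [crossProduct_ne_zero_iff_linearIndependent, LinearIndependent.pair_iff] at hPQ
    rw [h0, zero_smul, zero_add] at h'
    obtain ⟨h1, h2⟩ := hPQ _ _ h'
    apply hc
    ext i
    fin_cases i <;> simp [h0, h1, h2]
  refine ⟨-(c 1 / c 0), -(c 2 / c 0), ?_⟩
  ext i
  have := congrFun h' i
  simp only [Pi.add_apply, Pi.smul_apply, smul_eq_mul, Pi.zero_apply] at this ⊢
  field_simp
  linear_combination this

theorem exists_dotProduct_eq {ι : Type*} [Fintype ι] {t : ι → ℂ} (ht : t ≠ 0) (a : ℂ) :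
    ∃ c : ι → ℂ, t ⬝ᵥ c = a := by
  classical
  obtain ⟨i, hi⟩ := Function.ne_iff.1 ht
  refine ⟨Pi.single i (a / t i), ?_⟩
  rw [dotProduct_single]
  exact mul_div_cancel₀ a hi

theorem crossProduct_crossProduct_eq {t c P : Fin 3 → ℂ} (hc : t ⬝ᵥ c = -1) (hP : P ⬝ᵥ t = 0) :
    crossProduct t (crossProduct c P) = P := by
  simp only [dotProduct, Fin.sum_univ_three] at hc hP
  ext i
  fin_cases i <;> simp [cross_apply]
  · linear_combination c 0 * hP - P 0 * hc
  · linear_combination c 1 * hP - P 1 * hc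
  · linear_combination c 2 * hP - P 2 * hc

theorem crossProduct_crossProduct_of_orthogonal {t P b : Fin 3 → ℂ} (hP : P ⬝ᵥ t = 0) :
    crossProduct P (crossProduct t b) = (P ⬝ᵥ b) • t := by
  simp only [dotProduct, Fin.sum_univ_three] at hP
  ext i
  fin_cases i <;> simp [cross_apply, dotProduct, Fin.sum_univ_three]
  · linear_combination -b 0 * hP
  · linear_combination -b 1 * hP
  · linear_combination -b 2 * hP

theorem smul_add_ne_zero_of_crossProduct_ne_zero {P Q : Fin 3 → ℂ} (h : crossProduct P Q ≠ 0)
    (u : ℂ) : u • P + Q ≠ 0 := by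
  rw [crossProduct_ne_zero_iff_linearIndependent, LinearIndependent.pair_iff] at h
  intro h0
  simpa using (h u 1 (by simpa using h0)).2

/-! ### Restriction of a form to a line -/

/-- The form `F` on the line through `P` and `Q`, in the parameter `u` of the point `u P + Q`. -/
noncomputable def linePoly {R : Type*} [CommRing R] [Algebra ℂ R] (F : MvPolynomial (Fin 3) ℂ)
    (P Q : Fin 3 → R) : Polynomial R :=
  MvPolynomial.aeval (fun i => Polynomial.C (P i) * Polynomial.X + Polynomial.C (Q i)) F

section

variable {R S : Type*} [CommRing R] [Algebra ℂ R] [CommRing S] [Algebra ℂ S]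
  (F : MvPolynomial (Fin 3) ℂ)

theorem linePoly_map (φ : R →ₐ[ℂ] S) (P Q : Fin 3 → R) :
    (linePoly F P Q).map (φ : R →+* S) = linePoly F (fun i => φ (P i)) (fun i => φ (Q i)) := by
  have h := MvPolynomial.comp_aeval_apply
    (fun i => Polynomial.C (P i) * Polynomial.X + Polynomial.C (Q i)) (Polynomial.mapAlgHom φ) F
  rw [Polynomial.coe_mapAlgHom] at h
  rw [linePoly, h, linePoly]
  simp

theorem linePoly_eval (P Q : Fin 3 → R) (r : R) :
    (linePoly F P Q).eval r = MvPolynomial.aeval (fun i => P i * r + Q i) F := by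
  induction F using MvPolynomial.induction_on with
  | C a => simp [linePoly, Polynomial.algebraMap_apply]
  | add p q hp hq => simp only [linePoly, map_add, Polynomial.eval_add] at hp hq ⊢; rw [hp, hq]
  | mul_X p i hp =>
    simp only [linePoly, map_mul, Polynomial.eval_mul, MvPolynomial.aeval_X] at hp ⊢
    rw [hp]; simp

theorem linePoly_eval_complex (P Q : Fin 3 → ℂ) (u : ℂ) :
    (linePoly F P Q).eval u = MvPolynomial.eval (u • P + Q) F := by
  rw [linePoly_eval, MvPolynomial.aeval_eq_eval]
  congr 2
  ext i
  simp [mul_comm]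

theorem linePoly_derivative_eval (P Q : Fin 3 → ℂ) (u : ℂ) :
    (Polynomial.derivative (linePoly F P Q)).eval u = polyDiff F (u • P + Q) P := by
  have h1 := (linePoly F P Q).hasDerivAt u
  have h2 : HasDerivAt (fun u : ℂ => u • P + Q) P u := by
    simpa using ((hasDerivAt_id u).smul_const P).add_const Q
  have h3 := hasDerivAt_eval_comp F h2
  simp only [← linePoly_eval_complex] at h3
  exact h1.unique h3

variable {F} {d : ℕ}

theorem linePoly_natDegree_coeff (hF : F.IsHomogeneous d) (P Q : Fin 3 → R) :
    (linePoly F P Q).natDegree ≤ d ∧ (linePoly F P Q).coeff d = MvPolynomial.aeval P F := by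
  have hlin : ∀ i, (Polynomial.C (P i) * Polynomial.X + Polynomial.C (Q i)).natDegree ≤ 1 :=
    fun i => Polynomial.natDegree_linear_le
  have hterm : ∀ m ∈ F.support,
      (∏ i, (Polynomial.C (P i) * Polynomial.X + Polynomial.C (Q i)) ^ m i).natDegree ≤ d ∧
      (∏ i, (Polynomial.C (P i) * Polynomial.X + Polynomial.C (Q i)) ^ m i).coeff d =
        ∏ i, P i ^ m i := by
    intro m hm
    have hd : m 0 + m 1 + m 2 = d := by
      have := hF (MvPolynomial.mem_support_iff.1 hm)
      change Finsupp.weight 1 m = d at this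
      rw [Finsupp.weight_apply, Finsupp.sum_fintype _ _ (by simp), Fin.sum_univ_three] at this
      simpa using this
    have hpow : ∀ i, ((Polynomial.C (P i) * Polynomial.X + Polynomial.C (Q i)) ^ m i).natDegree ≤
        m i := fun i => by simpa using Polynomial.natDegree_pow_le_of_le (m i) (hlin i)
    have hcoe : ∀ i, ((Polynomial.C (P i) * Polynomial.X + Polynomial.C (Q i)) ^ m i).coeff (m i) =
        P i ^ m i := fun i => by
      have := Polynomial.coeff_pow_of_natDegree_le (m := m i) (hlin i)
      simpa using this
    rw [Fin.prod_univ_three, Fin.prod_univ_three, ← hd]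
    have h01 := Polynomial.natDegree_mul_le_of_le (hpow 0) (hpow 1)
    refine ⟨Polynomial.natDegree_mul_le_of_le h01 (hpow 2), ?_⟩
    rw [Polynomial.coeff_mul_add_eq_of_natDegree_le h01 (hpow 2),
      Polynomial.coeff_mul_add_eq_of_natDegree_le (hpow 0) (hpow 1), hcoe, hcoe, hcoe]
  rw [linePoly, MvPolynomial.aeval_def, MvPolynomial.eval₂_eq', MvPolynomial.aeval_def,
    MvPolynomial.eval₂_eq']
  constructor
  · refine Polynomial.natDegree_sum_le_of_forall_le _ _ fun m hm => ?_
    rw [Polynomial.algebraMap_apply]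
    exact (Polynomial.natDegree_C_mul_le _ _).trans (hterm m hm).1
  · rw [Polynomial.finsetSum_coeff]
    refine Finset.sum_congr rfl fun m hm => ?_
    rw [Polynomial.algebraMap_apply, Polynomial.coeff_C_mul, (hterm m hm).2]

end

theorem linePoly_ne_zero {F : MvPolynomial (Fin 3) ℂ} {d : ℕ} (hF : F.IsHomogeneous d)
    {P : Fin 3 → ℂ} (hP : MvPolynomial.eval P F ≠ 0) (Q : Fin 3 → ℂ) : linePoly F P Q ≠ 0 := by
  intro h
  have := (linePoly_natDegree_coeff hF P Q).2
  rw [h, Polynomial.coeff_zero, MvPolynomial.aeval_eq_eval] at this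
  exact hP this.symm

theorem linePoly_natDegree {F : MvPolynomial (Fin 3) ℂ} {d : ℕ} (hF : F.IsHomogeneous d)
    {P : Fin 3 → ℂ} (hP : MvPolynomial.eval P F ≠ 0) (Q : Fin 3 → ℂ) :
    (linePoly F P Q).natDegree = d := by
  obtain ⟨h1, h2⟩ := linePoly_natDegree_coeff hF P Q
  refine le_antisymm h1 (Polynomial.le_natDegree_of_ne_zero ?_)
  rw [h2, MvPolynomial.aeval_eq_eval]
  exact hP

/-! ### Plane curves and lines -/

theorem mk_mem_planeCurve_iff {F : MvPolynomial (Fin 3) ℂ} {d : ℕ} (hF : F.IsHomogeneous d)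
    {v : Fin 3 → ℂ} (hv : v ≠ 0) :
    (Projectivization.mk ℂ v hv : PSpace 2) ∈ planeCurve F ↔ MvPolynomial.eval v F = 0 :=
  PSpace.val_mk_eq_zero (n := 2) hF v hv

theorem onLine_mk_mk {v w : Fin 3 → ℂ} (hv : v ≠ 0) (hw : w ≠ 0) :
    OnLine (Projectivization.mk ℂ v hv) (Projectivization.mk ℂ w hw) ↔ v ⬝ᵥ w = 0 :=
  Iff.rfl

/-- The parametrization `u ↦ u P + Q` misses only the point `P` of the line, and `P` is off the
curve. -/
theorem planeCurve_inter_line {F : MvPolynomial (Fin 3) ℂ} {d : ℕ} (hF : F.IsHomogeneous d)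
    {t P Q : Fin 3 → ℂ} (ht : t ≠ 0) (hPt : P ⬝ᵥ t = 0) (hQt : Q ⬝ᵥ t = 0)
    (hPQ : crossProduct P Q ≠ 0) (hP : MvPolynomial.eval P F ≠ 0) :
    planeCurve F ∩ {x | OnLine x (Projectivization.mk ℂ t ht)} =
      (fun u : ℂ => Projectivization.mk ℂ (u • P + Q)
        (smul_add_ne_zero_of_crossProduct_ne_zero hPQ u)) '' ((linePoly F P Q).rootSet ℂ) := by
  ext x
  simp only [Polynomial.mem_rootSet, Set.mem_image, Set.mem_inter_iff, Set.mem_ofPred_eq,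
    Polynomial.coe_aeval_eq_eval]
  constructor
  · induction x using Projectivization.ind with | h v hv =>
    rw [mk_mem_planeCurve_iff hF, onLine_mk_mk]
    rintro ⟨h1, h2⟩
    obtain ⟨α, β, rfl⟩ := exists_eq_smul_add_smul_of_orthogonal ht hPt hQt h2 hPQ
    have hβ : β ≠ 0 := by
      rintro rfl
      rw [zero_smul, add_zero, hF.eval_smul] at h1
      rw [zero_smul, add_zero] at hv
      have hα : α ≠ 0 := by rintro rfl; simp at hv
      exact (mul_ne_zero (pow_ne_zero d hα) hP) h1
    have he : α • P + β • Q = β • ((α / β) • P + Q) := by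
      rw [smul_add, smul_smul, mul_div_cancel₀ _ hβ]
    refine ⟨α / β, ⟨linePoly_ne_zero hF hP Q, ?_⟩, ?_⟩
    · rw [linePoly_eval_complex]
      rw [he, hF.eval_smul] at h1
      simpa [hβ] using h1
    · rw [Projectivization.mk_eq_mk_iff']
      exact ⟨β⁻¹, by rw [he, smul_smul, inv_mul_cancel₀ hβ, one_smul]⟩
  · rintro ⟨u, ⟨-, hu⟩, rfl⟩
    rw [mk_mem_planeCurve_iff hF, onLine_mk_mk, ← linePoly_eval_complex]
    exact ⟨hu, by rw [add_dotProduct, smul_dotProduct, hPt, hQt]; simp⟩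

theorem injective_mk_line {P Q : Fin 3 → ℂ} (hPQ : crossProduct P Q ≠ 0) :
    Function.Injective (fun u : ℂ => Projectivization.mk ℂ (u • P + Q)
        (smul_add_ne_zero_of_crossProduct_ne_zero hPQ u)) := by
  intro u u' h
  simp only [Projectivization.mk_eq_mk_iff'] at h
  obtain ⟨a, ha⟩ := h
  have h' := hPQ
  rw [crossProduct_ne_zero_iff_linearIndependent, LinearIndependent.pair_iff] at h'
  obtain ⟨h1, h2⟩ := h' (a * u' - u) (a - 1) (by
    rw [sub_smul, sub_smul, mul_smul, one_smul]
    rw [smul_add] at ha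
    linear_combination ha)
  rw [sub_eq_zero] at h1 h2
  rw [h2, one_mul] at h1
  exact h1.symm

theorem finite_planeCurve_inter_line {F : MvPolynomial (Fin 3) ℂ} {d : ℕ}
    (hF : F.IsHomogeneous d) (t : DualPlane) (ht : ∃ x, OnLine x t ∧ x ∉ planeCurve F) :
    (planeCurve F ∩ {x | OnLine x t}).Finite := by
  obtain ⟨x, hx, hxF⟩ := ht
  induction t using Projectivization.ind with | h t ht =>
  induction x using Projectivization.ind with | h P hP =>
  rw [mk_mem_planeCurve_iff hF] at hxF
  rw [onLine_mk_mk] at hx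
  obtain ⟨b, hb⟩ := exists_dotProduct_eq hP 1
  have hPQ : crossProduct P (crossProduct t b) ≠ 0 := by
    rw [crossProduct_crossProduct_of_orthogonal hx, hb, one_smul]
    exact ht
  rw [planeCurve_inter_line hF ht hx (by rw [dotProduct_comm, dot_self_cross]) hPQ hxF]
  exact ((linePoly F P _).rootSet_finite ℂ).image _

/-! ### The discriminant of the restriction of a form to a line -/

/-- The resultant of the restriction of `F`, of degree `d`, to a line, and its derivative. -/
noncomputable def lineDisc {R : Type*} [CommRing R] [Algebra ℂ R] (F : MvPolynomial (Fin 3) ℂ)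
    (d : ℕ) (P Q : Fin 3 → R) : R :=
  Polynomial.resultant (linePoly F P Q) (Polynomial.derivative (linePoly F P Q)) d (d - 1)

/-- The resultant is formed with the fixed sizes `d` and `d - 1`, so it commutes with every
specialization, even one in which degrees drop. -/
theorem lineDisc_map {R S : Type*} [CommRing R] [Algebra ℂ R] [CommRing S] [Algebra ℂ S]
    (F : MvPolynomial (Fin 3) ℂ) (d : ℕ) (φ : R →ₐ[ℂ] S) (P Q : Fin 3 → R) :
    φ (lineDisc F d P Q) = lineDisc F d (fun i => φ (P i)) (fun i => φ (Q i)) := by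
  have := Polynomial.resultant_map_map (linePoly F P Q) (Polynomial.derivative (linePoly F P Q))
    d (d - 1) (φ : R →+* S)
  rw [← Polynomial.derivative_map, linePoly_map] at this
  exact this.symm

/-- In characteristic zero the derivative has degree exactly `d - 1`, so the resultant detects
common factors, and separable means squarefree. -/
theorem resultant_derivative_ne_zero_iff {K : Type*} [Field K] [CharZero K] {f : Polynomial K}
    {d : ℕ} (hd : 0 < d) (hf : f.natDegree = d) :
    Polynomial.resultant f (Polynomial.derivative f) d (d - 1) ≠ 0 ↔ Squarefree f := by
  have h0 : f ≠ 0 := by rintro rfl; simp at hf; omega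
  have h1 : (Polynomial.derivative f).natDegree = d - 1 := by
    rw [Polynomial.natDegree_derivative, hf]
  rw [← PerfectField.separable_iff_squarefree, Polynomial.Separable]
  have := Polynomial.resultant_eq_zero_iff (f := f) (g := Polynomial.derivative f)
  rw [h1, hf] at this
  rw [Ne, this]
  simp [h0]

theorem lineDisc_ne_zero_iff {F : MvPolynomial (Fin 3) ℂ} {d : ℕ} (hd : 0 < d)
    (hF : F.IsHomogeneous d) {P : Fin 3 → ℂ} (hP : MvPolynomial.eval P F ≠ 0) (Q : Fin 3 → ℂ) :
    lineDisc F d P Q ≠ 0 ↔ Squarefree (linePoly F P Q) :=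
  resultant_derivative_ne_zero_iff hd (linePoly_natDegree hF hP Q)

/-- A factor occurring twice in a monic polynomial over an integrally closed domain. -/
theorem exists_monic_mul_self_dvd_of_not_squarefree_map {R : Type*} [CommRing R] [IsDomain R]
    [IsIntegrallyClosed R] {f : Polynomial R} (hf : f.Monic)
    (h : ¬ Squarefree (f.map (algebraMap R (FractionRing R)))) :
    ∃ g : Polynomial R, g.Monic ∧ 0 < g.natDegree ∧ g * g ∣ f := by
  simp only [Squarefree, not_forall] at h
  obtain ⟨g, hg, hu⟩ := h
  have hinj := IsFractionRing.injective R (FractionRing R)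
  obtain ⟨g', hg'⟩ := IsIntegrallyClosed.eq_map_mul_C_of_dvd (FractionRing R) hf
    ((Dvd.intro _ rfl).trans hg)
  have hg0 : g ≠ 0 := by
    rintro rfl
    rw [zero_mul, zero_dvd_iff] at hg
    exact (hf.map _).ne_zero hg
  have hl : g.leadingCoeff ≠ 0 := Polynomial.leadingCoeff_ne_zero.2 hg0
  have hm : (g'.map (algebraMap R (FractionRing R))).Monic := by
    have := congrArg Polynomial.leadingCoeff hg'
    rw [Polynomial.leadingCoeff_mul, Polynomial.leadingCoeff_C] at this
    exact mul_right_cancel₀ hl (by rw [this, one_mul])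
  have hm' : g'.Monic := Polynomial.monic_of_injective hinj hm
  refine ⟨g', hm', ?_, ?_⟩
  · rw [Nat.pos_iff_ne_zero]
    intro h0
    apply hu
    rw [Polynomial.eq_one_of_monic_natDegree_zero hm' h0] at hg'
    rw [← hg', Polynomial.map_one, one_mul]
    exact Polynomial.isUnit_C.2 hl.isUnit
  · rw [← Polynomial.map_dvd_map _ hinj (hm'.mul hm'), Polynomial.map_mul]
    refine Dvd.dvd.trans ?_ hg
    exact mul_dvd_mul (Dvd.intro _ hg') (Dvd.intro _ hg')

/-- Translation is an automorphism of the polynomial ring, so a translate of a squarefree polynomial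
is squarefree. -/
theorem isUnit_of_mul_self_dvd_translate {ι : Type*} {F : MvPolynomial ι ℂ} (hF : Squarefree F)
    (a : ι → ℂ) {g : MvPolynomial ι ℂ}
    (h : g * g ∣ MvPolynomial.aeval (fun i => MvPolynomial.C (a i) + MvPolynomial.X i) F) :
    IsUnit g := by
  let σ : MvPolynomial ι ℂ →ₐ[ℂ] MvPolynomial ι ℂ :=
    MvPolynomial.aeval fun i => MvPolynomial.C (a i) + MvPolynomial.X i
  let τ : MvPolynomial ι ℂ →ₐ[ℂ] MvPolynomial ι ℂ :=
    MvPolynomial.aeval fun i => MvPolynomial.X i - MvPolynomial.C (a i)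
  have hστ : σ.comp τ = AlgHom.id ℂ _ := by
    refine MvPolynomial.algHom_ext fun i => ?_
    simp only [σ, τ, AlgHom.comp_apply, MvPolynomial.aeval_X, map_sub, MvPolynomial.algHom_C,
      MvPolynomial.algebraMap_eq, AlgHom.id_apply, add_sub_cancel_left]
  have hτσ : τ.comp σ = AlgHom.id ℂ _ := by
    refine MvPolynomial.algHom_ext fun i => ?_
    simp only [σ, τ, AlgHom.comp_apply, MvPolynomial.aeval_X, map_add, MvPolynomial.algHom_C,
      MvPolynomial.algebraMap_eq, AlgHom.id_apply, add_sub_cancel]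
  have h1 := map_dvd τ h
  rw [map_mul, show τ (MvPolynomial.aeval _ F) = F from DFunLike.congr_fun hτσ F] at h1
  have h2 := (hF _ h1).map σ
  rwa [show σ (τ g) = g from DFunLike.congr_fun hστ g] at h2

/-- The generic line through a point outside a reduced curve is transversal to the curve. -/
theorem lineDisc_generic_ne_zero {F : MvPolynomial (Fin 3) ℂ} {d : ℕ} (hd : 0 < d)
    (hF : F.IsHomogeneous d) (hsq : Squarefree F) {P : Fin 3 → ℂ}
    (hP : MvPolynomial.eval P F ≠ 0) :
    lineDisc (R := MvPolynomial (Fin 3) ℂ) F d (fun i => MvPolynomial.C (P i))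
      MvPolynomial.X ≠ 0 := by
  intro hD
  let R := MvPolynomial (Fin 3) ℂ
  set f : Polynomial R := linePoly F (fun i => MvPolynomial.C (P i)) MvPolynomial.X with hf
  obtain ⟨hdeg, hcoeff⟩ := linePoly_natDegree_coeff (R := R) hF
    (fun i => MvPolynomial.C (P i)) MvPolynomial.X
  have hc : MvPolynomial.aeval (fun i => (MvPolynomial.C (P i) : R)) F =
      MvPolynomial.C (MvPolynomial.eval P F) := by
    have := MvPolynomial.comp_aeval_apply P (Algebra.ofId ℂ R) F
    rw [MvPolynomial.aeval_eq_eval] at this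
    exact this.symm
  rw [hc, ← hf] at hcoeff
  set c := MvPolynomial.eval P F
  -- The leading coefficient of `f` is the nonzero constant `F(P)`; dividing by it gives a monic
  -- polynomial, to which Gauss's lemma applies.
  set f0 : Polynomial R := Polynomial.C (MvPolynomial.C c⁻¹) * f with hf0
  have hmon : f0.Monic := by
    refine Polynomial.monic_of_natDegree_le_of_coeff_eq_one d
      ((Polynomial.natDegree_C_mul_le _ _).trans hdeg) ?_
    rw [hf0, Polynomial.coeff_C_mul, hcoeff, ← MvPolynomial.C_mul, inv_mul_cancel₀ hP,
      MvPolynomial.C_1]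
  have hf0f : f = Polynomial.C (MvPolynomial.C c) * f0 := by
    rw [hf0, ← mul_assoc, ← Polynomial.C_mul, ← MvPolynomial.C_mul, mul_inv_cancel₀ hP,
      MvPolynomial.C_1, Polynomial.C_1, one_mul]
  have hnd : f0.natDegree = d := by
    refine le_antisymm ((Polynomial.natDegree_C_mul_le _ _).trans hdeg)
      (Polynomial.le_natDegree_of_ne_zero ?_)
    rw [hf0, Polynomial.coeff_C_mul, hcoeff, ← MvPolynomial.C_mul, inv_mul_cancel₀ hP,
      MvPolynomial.C_1]
    exact one_ne_zero
  let ι := algebraMap R (FractionRing R)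
  have hinj : Function.Injective ι := IsFractionRing.injective R (FractionRing R)
  have : CharZero (FractionRing R) := charZero_of_injective_algebraMap hinj
  have hns : ¬ Squarefree (f0.map ι) := by
    rw [← resultant_derivative_ne_zero_iff hd (by rw [hmon.natDegree_map, hnd]), not_not,
      Polynomial.derivative_map, Polynomial.resultant_map_map]
    have h1 : Polynomial.resultant f (Polynomial.derivative f) d (d - 1) = 0 := hD
    rw [hf0, Polynomial.derivative_C_mul, Polynomial.resultant_C_mul_left,
      Polynomial.resultant_C_mul_right, h1, mul_zero, mul_zero, map_zero]
  obtain ⟨g, hg, hgpos, h, hgh⟩ := exists_monic_mul_self_dvd_of_not_squarefree_map hmon hns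
  -- For constant `w` the value `f(w) = F(wP + X)` is a translate of `F`, hence squarefree, while
  -- `g(w)²` divides it.
  have hunit : ∀ w : ℂ, IsUnit (g.eval (MvPolynomial.C w)) := by
    intro w
    have hfe : f.eval (MvPolynomial.C w) = MvPolynomial.aeval
        (fun i => (MvPolynomial.C (P i * w) + MvPolynomial.X i : R)) F := by
      simp only [MvPolynomial.C_mul]
      exact linePoly_eval F _ _ _
    refine isUnit_of_mul_self_dvd_translate hsq (fun i => P i * w) ?_
    rw [← hfe, hf0f, hgh, Polynomial.eval_mul, Polynomial.eval_mul, Polynomial.eval_mul]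
    exact (Dvd.intro _ rfl).mul_left _
  let ev : R →+* ℂ := MvPolynomial.eval 0
  -- At `X = 0` the polynomial `g` becomes monic and nonconstant over `ℂ`. At a root `w` the element
  -- `g(w)` vanishes at the origin and cannot be a unit.
  have hroot : (g.map ev).degree ≠ 0 := by
    rw [hg.degree_map, Polynomial.degree_eq_natDegree hg.ne_zero]
    exact_mod_cast hgpos.ne'
  obtain ⟨w, hw⟩ := IsAlgClosed.exists_root _ hroot
  rw [Polynomial.IsRoot] at hw
  have h2 : (g.map ev).eval w = ev (g.eval (MvPolynomial.C w)) := by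
    rw [Polynomial.eval_map, ← Polynomial.eval₂_at_apply]
    exact congrArg (fun a => Polynomial.eval₂ ev a g) (MvPolynomial.eval_C w).symm
  rw [h2] at hw
  exact ((hunit w).map ev).ne_zero hw

/-- A transversal line through a point outside a reduced curve. -/
theorem exists_transversal_line {F : MvPolynomial (Fin 3) ℂ} {d : ℕ} (hd : 0 < d)
    (hF : F.IsHomogeneous d) (hsq : Squarefree F) {P : Fin 3 → ℂ}
    (hP : MvPolynomial.eval P F ≠ 0) (hP0 : P ≠ 0) :
    ∃ y : Fin 3 → ℂ, lineDisc F d P y ≠ 0 ∧ crossProduct P y ≠ 0 := by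
  obtain ⟨i, hi⟩ := Function.ne_iff.1 hP0
  have hD := lineDisc_generic_ne_zero hd hF hsq hP
  have hk : ∃ k : Fin 3 → ℂ, k ≠ 0 ∧ P ⬝ᵥ k = 0 := by
    obtain ⟨b, hb⟩ : ∃ b, crossProduct P b ≠ 0 := by
      by_contra! h
      apply hi
      have h0 := h (Pi.single (i + 1) 1)
      have := congrFun h0 (i + 2)
      fin_cases i <;> simpa [cross_apply] using this
    exact ⟨_, hb, dot_self_cross P b⟩
  obtain ⟨k, hk0, hk⟩ := hk
  obtain ⟨j, hj⟩ := Function.ne_iff.1 hk0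
  -- `E` is a nonzero linear form that vanishes at `P`, so `E(y) ≠ 0` forces `y` to be independent
  -- of `P`.
  let E : MvPolynomial (Fin 3) ℂ := ∑ i, MvPolynomial.C (k i) * MvPolynomial.X i
  have hE : E ≠ 0 := by
    intro h
    have := congrArg (MvPolynomial.eval (Pi.single j 1)) h
    apply hj
    simpa [E, Pi.single_apply] using this
  have hne := mul_ne_zero hD hE
  obtain ⟨y, hy⟩ : ∃ y, MvPolynomial.eval y (lineDisc (R := MvPolynomial (Fin 3) ℂ) F d
      (fun i => MvPolynomial.C (P i)) MvPolynomial.X * E) ≠ 0 := by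
    by_contra! h
    exact hne (MvPolynomial.funext fun x => by simpa using h x)
  rw [map_mul] at hy
  refine ⟨y, ?_, ?_⟩
  · have h1 := lineDisc_map F d (MvPolynomial.aeval y : MvPolynomial (Fin 3) ℂ →ₐ[ℂ] ℂ)
      (fun i => MvPolynomial.C (P i)) MvPolynomial.X
    simp only [MvPolynomial.aeval_C, MvPolynomial.aeval_X, Algebra.algebraMap_self,
      RingHom.id_apply] at h1
    rw [← h1]
    exact left_ne_zero_of_mul hy
  · intro h0
    apply right_ne_zero_of_mul hy
    have hni : ¬ LinearIndependent ℂ ![P, y] := by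
      rwa [← crossProduct_ne_zero_iff_linearIndependent, not_not]
    rw [LinearIndependent.pair_iff' hP0] at hni
    push Not at hni
    obtain ⟨a, rfl⟩ := hni
    have : MvPolynomial.eval (a • P) E = a * (P ⬝ᵥ k) := by
      simp only [E, map_sum, map_mul, MvPolynomial.eval_C, MvPolynomial.eval_X, dotProduct,
        Finset.mul_sum, Pi.smul_apply, smul_eq_mul]
      exact Finset.sum_congr rfl fun _ _ => by ring
    rw [this, hk, mul_zero]

theorem gradientAt_eq_zero_eval {F : MvPolynomial (Fin 3) ℂ} {q : PSpace 2}
    (h : gradientAt F q = 0) (i : Fin 3) :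
    MvPolynomial.eval q.rep (MvPolynomial.pderiv i F) = 0 :=
  congrFun h i

/-- A reduced plane curve has finitely many singular points. -/
theorem finite_singularPoints {F : MvPolynomial (Fin 3) ℂ} {d : ℕ} (hd : 0 < d)
    (hF : F.IsHomogeneous d) (hsq : Squarefree F) {p : PSpace 2} (hp : p ∉ planeCurve F) :
    {q | q ∈ planeCurve F ∧ gradientAt F q = 0}.Finite := by
  induction p using Projectivization.ind with | h P hP0 =>
  have hpF := hp
  rw [mk_mem_planeCurve_iff hF] at hp
  obtain ⟨y, hy, hPy⟩ := exists_transversal_line hd hF hsq hp hP0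
  -- With `P`, `y`, `k` a basis, the pencil through `P` consists of the line through `k` and the
  -- lines through `y + l k`.
  obtain ⟨k, hk⟩ := exists_dotProduct_eq hPy 1
  have hPk : crossProduct P k ≠ 0 := by
    intro h
    have h1 : crossProduct P y ⬝ᵥ k = - (crossProduct P k ⬝ᵥ y) := by
      simp [cross_apply, dotProduct, Fin.sum_univ_three]; ring
    rw [h, hk] at h1
    simp at h1
  have hPQ : ∀ l : ℂ, crossProduct P (y + l • k) ≠ 0 := by
    intro l h
    have h1 : crossProduct P (y + l • k) ⬝ᵥ k = crossProduct P y ⬝ᵥ k := by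
      simp [cross_apply, dotProduct, Fin.sum_univ_three]; ring
    rw [h, hk] at h1
    simp at h1
  -- The discriminant along the pencil, nonzero because the line `l = 0` is transversal. A singular
  -- point lies on a line with `D(l) = 0` or on the line through `k`.
  let D : Polynomial ℂ := lineDisc (R := Polynomial ℂ) F d (fun i => Polynomial.C (P i))
    (fun i => Polynomial.C (y i) + Polynomial.X * Polynomial.C (k i))
  have hDe : ∀ l : ℂ, D.eval l = lineDisc F d P (y + l • k) := by
    intro l
    have := lineDisc_map F d (Polynomial.aeval l : Polynomial ℂ →ₐ[ℂ] ℂ)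
      (fun i => Polynomial.C (P i)) (fun i => Polynomial.C (y i) + Polynomial.X * Polynomial.C (k i))
    rw [Polynomial.coe_aeval_eq_eval] at this
    rw [this]
    congr 1
    · ext i
      simp
    · ext i
      simp only [Polynomial.eval_add, Polynomial.eval_mul, Polynomial.eval_C, Polynomial.eval_X,
        Pi.add_apply, Pi.smul_apply, smul_eq_mul]
  have hD : D ≠ 0 := by
    intro h
    apply hy
    have := hDe 0
    rw [h, zero_smul, add_zero] at this
    simpa using this.symm
  have hfin : ∀ t : DualPlane, OnLine (Projectivization.mk ℂ P hP0) t →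
      (planeCurve F ∩ {x | OnLine x t}).Finite := fun t ht =>
    finite_planeCurve_inter_line hF t ⟨_, ht, hpF⟩
  refine ((hfin (Projectivization.mk ℂ _ hPk) ((onLine_mk_mk _ _).2 (dot_self_cross _ _))).union
    ((D.rootSet_finite ℂ).biUnion fun l _ => hfin (Projectivization.mk ℂ _ (hPQ l))
      ((onLine_mk_mk _ _).2 (dot_self_cross _ _)))).subset ?_
  rintro q ⟨hqF, hq⟩
  have hv : MvPolynomial.eval q.rep F = 0 := hqF
  have hg := gradientAt_eq_zero_eval hq
  have hq0 := q.rep_nonzero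
  by_cases hqk : q.rep ⬝ᵥ crossProduct P k = 0
  · left
    refine ⟨hqF, ?_⟩
    rw [Set.mem_ofPred_eq, ← q.mk_rep, onLine_mk_mk]
    exact hqk
  right
  -- The value of `l` for which the line of the pencil passes through `q`.
  set l : ℂ := -(q.rep ⬝ᵥ crossProduct P y) / (q.rep ⬝ᵥ crossProduct P k) with hl
  have hql : q.rep ⬝ᵥ crossProduct P (y + l • k) = 0 := by
    rw [map_add, map_smul, dotProduct_add, dotProduct_smul, hl, smul_eq_mul]
    field_simp
    ring
  refine Set.mem_iUnion₂.2 ⟨l, ?_, hqF, ?_⟩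
  · rw [Polynomial.mem_rootSet, Polynomial.coe_aeval_eq_eval, hDe]
    refine ⟨hD, ?_⟩
    obtain ⟨α, β, hab⟩ := exists_eq_smul_add_smul_of_orthogonal (hPQ l) (dot_self_cross _ _)
      (dot_cross_self _ _) hql (hPQ l)
    have hβ : β ≠ 0 := by
      rintro rfl
      rw [zero_smul, add_zero] at hab
      have hα : α ≠ 0 := by rintro rfl; exact hq0 (by rw [hab, zero_smul])
      rw [hab, hF.eval_smul] at hv
      exact (mul_ne_zero (pow_ne_zero d hα) hp) hv
    have he : (α / β) • P + (y + l • k) = β⁻¹ • q.rep := by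
      rw [hab, smul_add, smul_smul, smul_smul, inv_mul_cancel₀ hβ, one_smul, div_eq_inv_mul]
    by_contra hne
    -- If `D(l) ≠ 0`, the restriction of `F` has simple roots; but at a singular point of the curve
    -- the restriction and its derivative both vanish.
    have hsf : (linePoly F P (y + l • k)).Separable := by
      rw [PerfectField.separable_iff_squarefree]
      exact (lineDisc_ne_zero_iff hd hF hp _).1 hne
    have h1 : Polynomial.aeval (α / β) (linePoly F P (y + l • k)) = 0 := by
      rw [Polynomial.coe_aeval_eq_eval, linePoly_eval_complex, he, hF.eval_smul, hv, mul_zero]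
    apply hsf.aeval_derivative_ne_zero h1
    rw [Polynomial.coe_aeval_eq_eval, linePoly_derivative_eval, he, polyDiff]
    refine Finset.sum_eq_zero fun i _ => ?_
    rw [hF.pderiv.eval_smul, hg, mul_zero, zero_mul]
  · rw [Set.mem_ofPred_eq, ← q.mk_rep, onLine_mk_mk]
    exact hql

/-! ### Homogeneity of the discriminant -/

/-- All coefficients of `p` are forms of degree `k`. -/
def HasHomogeneousCoeffs (p : Polynomial (MvPolynomial (Fin 3) ℂ)) (k : ℕ) : Prop :=
  ∀ j, (p.coeff j).IsHomogeneous k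

theorem HasHomogeneousCoeffs.mul {p q : Polynomial (MvPolynomial (Fin 3) ℂ)} {k l : ℕ}
    (hp : HasHomogeneousCoeffs p k) (hq : HasHomogeneousCoeffs q l) :
    HasHomogeneousCoeffs (p * q) (k + l) := by
  intro j
  rw [Polynomial.coeff_mul]
  exact MvPolynomial.IsHomogeneous.sum _ _ _ fun i _ => (hp i.1).mul (hq i.2)

theorem HasHomogeneousCoeffs.pow {p : Polynomial (MvPolynomial (Fin 3) ℂ)}
    (hp : HasHomogeneousCoeffs p 1) (l : ℕ) : HasHomogeneousCoeffs (p ^ l) l := by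
  induction l with
  | zero =>
    intro j
    rw [pow_zero, Polynomial.coeff_one]
    split_ifs
    · exact MvPolynomial.isHomogeneous_one _ _
    · exact MvPolynomial.isHomogeneous_zero _ _ _
  | succ l ih => rw [pow_succ]; exact ih.mul hp

/-- The entries of `P` and `Q` are both linear, so with the parameter given degree zero each factor
is homogeneous of degree one. -/
theorem hasHomogeneousCoeffs_linePoly {F : MvPolynomial (Fin 3) ℂ} {d : ℕ}
    (hF : F.IsHomogeneous d) {P Q : Fin 3 → MvPolynomial (Fin 3) ℂ}
    (hP : ∀ i, (P i).IsHomogeneous 1) (hQ : ∀ i, (Q i).IsHomogeneous 1) :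
    HasHomogeneousCoeffs (linePoly F P Q) d := by
  have hlin : ∀ i, HasHomogeneousCoeffs
      (Polynomial.C (P i) * Polynomial.X + Polynomial.C (Q i)) 1 := by
    intro i j
    rw [Polynomial.coeff_add, Polynomial.coeff_C_mul, Polynomial.coeff_X, Polynomial.coeff_C]
    refine MvPolynomial.IsHomogeneous.add ?_ ?_
    · split_ifs
      · rw [mul_one]; exact hP i
      · rw [mul_zero]; exact MvPolynomial.isHomogeneous_zero _ _ _
    · split_ifs
      · exact hQ i
      · exact MvPolynomial.isHomogeneous_zero _ _ _
  intro j
  rw [linePoly, MvPolynomial.aeval_def, MvPolynomial.eval₂_eq', Polynomial.finsetSum_coeff]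
  refine MvPolynomial.IsHomogeneous.sum _ _ _ fun m hm => ?_
  have hd : m 0 + m 1 + m 2 = d := by
    have := hF (MvPolynomial.mem_support_iff.1 hm)
    change Finsupp.weight 1 m = d at this
    rw [Finsupp.weight_apply, Finsupp.sum_fintype _ _ (by simp), Fin.sum_univ_three] at this
    simpa using this
  rw [Polynomial.algebraMap_apply, Polynomial.coeff_C_mul, Fin.prod_univ_three, ← hd]
  refine MvPolynomial.IsHomogeneous.C_mul ?_ _
  exact ((((hlin 0).pow _).mul ((hlin 1).pow _)).mul ((hlin 2).pow _)) j

/-- The Sylvester matrix has size `d + (d - 1)` and each entry is zero or a form of degree `d`, so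
every term of its determinant has the same degree. -/
theorem isHomogeneous_lineDisc {F : MvPolynomial (Fin 3) ℂ} {d : ℕ}
    (hF : F.IsHomogeneous d) {P Q : Fin 3 → MvPolynomial (Fin 3) ℂ}
    (hP : ∀ i, (P i).IsHomogeneous 1) (hQ : ∀ i, (Q i).IsHomogeneous 1) :
    (lineDisc F d P Q).IsHomogeneous ((d + (d - 1)) * d) := by
  have hf := hasHomogeneousCoeffs_linePoly hF hP hQ
  have hf' : HasHomogeneousCoeffs (Polynomial.derivative (linePoly F P Q)) d := by
    intro j
    rw [Polynomial.coeff_derivative, mul_comm, ← Nat.cast_succ, ← map_natCast MvPolynomial.C]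
    exact (hf _).C_mul _
  rw [lineDisc, Polynomial.resultant, Matrix.det_apply]
  refine MvPolynomial.IsHomogeneous.sum _ _ _ fun σ _ => ?_
  rw [Units.smul_def, zsmul_eq_mul,
    ← map_intCast (MvPolynomial.C : ℂ →+* MvPolynomial (Fin 3) ℂ)]
  refine MvPolynomial.IsHomogeneous.C_mul ?_ _
  have := MvPolynomial.IsHomogeneous.prod Finset.univ
    (fun i => (Polynomial.sylvester (linePoly F P Q) (Polynomial.derivative (linePoly F P Q))
      d (d - 1)) (σ i) i) (fun _ => d) (fun i _ => ?_)
  · simpa using this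
  · rw [Polynomial.sylvester, Matrix.of_apply]
    refine Fin.addCases (fun j => ?_) (fun j => ?_) i
    · rw [Fin.addCases_left]
      split_ifs
      · exact hf' _
      · exact MvPolynomial.isHomogeneous_zero _ _ _
    · rw [Fin.addCases_right]
      split_ifs
      · exact hf _
      · exact MvPolynomial.isHomogeneous_zero _ _ _

/-! ### The number of points on a general line -/

theorem isHomogeneous_crossProduct_X (a : Fin 3 → ℂ) (i : Fin 3) :
    (crossProduct (MvPolynomial.X : Fin 3 → MvPolynomial (Fin 3) ℂ)
      (fun i => MvPolynomial.C (a i)) i).IsHomogeneous 1 := by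
  have h : ∀ j k : Fin 3, (MvPolynomial.X j * MvPolynomial.C (a k) :
      MvPolynomial (Fin 3) ℂ).IsHomogeneous 1 := fun j k => by
    rw [mul_comm]
    exact MvPolynomial.isHomogeneous_C_mul_X _ _
  fin_cases i <;> simp only [cross_apply] <;> exact (h _ _).sub (h _ _)

theorem aeval_crossProduct_X (a t : Fin 3 → ℂ) (i : Fin 3) :
    MvPolynomial.aeval t (crossProduct (MvPolynomial.X : Fin 3 → MvPolynomial (Fin 3) ℂ)
      (fun i => MvPolynomial.C (a i)) i) = crossProduct t a i := by
  fin_cases i <;> simp [cross_apply]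

/-- The linear form `t ↦ t ⬝ᵥ s`. -/
noncomputable def linearForm (s : Fin 3 → ℂ) : MvPolynomial (Fin 3) ℂ :=
  ∑ i, MvPolynomial.C (s i) * MvPolynomial.X i

theorem isHomogeneous_linearForm (s : Fin 3 → ℂ) : (linearForm s).IsHomogeneous 1 :=
  MvPolynomial.IsHomogeneous.sum _ _ _ fun _ _ => MvPolynomial.isHomogeneous_C_mul_X _ _

theorem eval_linearForm (s t : Fin 3 → ℂ) : MvPolynomial.eval t (linearForm s) = s ⬝ᵥ t := by
  simp [linearForm, dotProduct]

theorem linearForm_ne_zero {s : Fin 3 → ℂ} (hs : s ≠ 0) : linearForm s ≠ 0 := by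
  obtain ⟨c, hc⟩ := exists_dotProduct_eq hs 1
  intro h
  have := eval_linearForm s c
  rw [h, hc, map_zero] at this
  exact zero_ne_one this

/-- A line outside a suitable algebraic curve of the dual plane meets a reduced curve in `d` points,
and avoids a given finite set. -/
theorem exists_form_ncard_planeCurve_inter_line {F : MvPolynomial (Fin 3) ℂ} {d : ℕ} (hd : 0 < d)
    (hF : F.IsHomogeneous d) (hsq : Squarefree F) {p : PSpace 2} (hp : p ∉ planeCurve F)
    {S : Set (PSpace 2)} (hS : S.Finite) :
    ∃ H : MvPolynomial (Fin 3) ℂ, H ≠ 0 ∧ (∃ e, H.IsHomogeneous e) ∧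
      ∀ t : DualPlane, PSpace.val (n := 2) t H ≠ 0 → (∀ s ∈ S, ¬ OnLine s t) ∧
        (planeCurve F ∩ {x | OnLine x t}).Finite ∧
        (planeCurve F ∩ {x | OnLine x t}).ncard = d := by
  induction p using Projectivization.ind with | h P hP0 =>
  rw [mk_mem_planeCurve_iff hF] at hp
  obtain ⟨y, hy, hPy⟩ := exists_transversal_line hd hF hsq hp hP0
  -- The line `t` is to be spanned by `t × a` and `t × b`, which are linear in `t`. The choice `t₀ ⬝
  -- c = -1` makes these vectors equal to `P` and `y` on the transversal line `t₀`, so that the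
  -- first three factors below are nonzero there.
  obtain ⟨c, hc⟩ := exists_dotProduct_eq hPy (-1)
  set t₀ := crossProduct P y with ht₀
  set a := crossProduct c P with ha
  set b := crossProduct c y with hb
  have hta : crossProduct t₀ a = P := crossProduct_crossProduct_eq hc (dot_self_cross _ _)
  have htb : crossProduct t₀ b = y := crossProduct_crossProduct_eq hc (dot_cross_self _ _)
  have hPb : P ⬝ᵥ b = 1 := by
    have h1 : P ⬝ᵥ b = -(t₀ ⬝ᵥ c) := by
      simp [ht₀, hb, cross_apply, dotProduct, Fin.sum_univ_three]; ring
    rw [h1, hc, neg_neg]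
  let T : Fin 3 → MvPolynomial (Fin 3) ℂ := MvPolynomial.X
  let A : Fin 3 → MvPolynomial (Fin 3) ℂ := crossProduct T fun i => MvPolynomial.C (a i)
  let B : Fin 3 → MvPolynomial (Fin 3) ℂ := crossProduct T fun i => MvPolynomial.C (b i)
  have hA : ∀ i, (A i).IsHomogeneous 1 := isHomogeneous_crossProduct_X a
  have hB : ∀ i, (B i).IsHomogeneous 1 := isHomogeneous_crossProduct_X b
  -- Nonvanishing of the four factors means in turn: simple roots, `t × a` off the curve,
  -- independence of `t × a` and `t × b`, and avoidance of `S`.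
  let H₁ : MvPolynomial (Fin 3) ℂ := lineDisc F d A B
  let H₂ : MvPolynomial (Fin 3) ℂ := MvPolynomial.aeval A F
  let H₃ : MvPolynomial (Fin 3) ℂ := ∑ i, A i * MvPolynomial.C (b i)
  let H₄ : MvPolynomial (Fin 3) ℂ := ∏ s ∈ hS.toFinset, linearForm s.rep
  have e₁ : ∀ t, MvPolynomial.eval t H₁ = lineDisc F d (crossProduct t a) (crossProduct t b) := by
    intro t
    have := lineDisc_map F d (MvPolynomial.aeval t : MvPolynomial (Fin 3) ℂ →ₐ[ℂ] ℂ) A B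
    simp only [A, B, T, aeval_crossProduct_X] at this
    rw [MvPolynomial.aeval_eq_eval] at this
    exact this
  have e₂ : ∀ t, MvPolynomial.eval t H₂ = MvPolynomial.eval (crossProduct t a) F := by
    intro t
    have := MvPolynomial.comp_aeval_apply A (MvPolynomial.aeval t :
      MvPolynomial (Fin 3) ℂ →ₐ[ℂ] ℂ) F
    simp only [A, T, aeval_crossProduct_X] at this
    rw [MvPolynomial.aeval_eq_eval, MvPolynomial.aeval_eq_eval] at this
    exact this
  have e₃ : ∀ t, MvPolynomial.eval t H₃ = crossProduct t a ⬝ᵥ b := by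
    intro t
    simp only [H₃, map_sum, map_mul, MvPolynomial.eval_C, dotProduct]
    refine Finset.sum_congr rfl fun i _ => ?_
    have := aeval_crossProduct_X a t i
    rw [MvPolynomial.aeval_eq_eval] at this
    exact congrArg (· * b i) this
  refine ⟨H₁ * H₂ * H₃ * H₄, mul_ne_zero ?_ ?_, ?_, ?_⟩
  · intro h
    have h0 := congrArg (MvPolynomial.eval t₀) h
    rw [map_mul, map_mul, e₁, e₂, e₃, hta, htb, hPb, mul_one, map_zero] at h0
    exact mul_ne_zero hy hp h0
  · exact Finset.prod_ne_zero_iff.2 fun s _ => linearForm_ne_zero s.rep_nonzero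
  · have h2 : H₂.IsHomogeneous (1 * d) := hF.aeval _ hA
    have h3 : H₃.IsHomogeneous 1 := MvPolynomial.IsHomogeneous.sum _ _ _ fun i _ => by
      rw [mul_comm]; exact (hA i).C_mul _
    have h4 := MvPolynomial.IsHomogeneous.prod hS.toFinset (fun s => linearForm s.rep)
      (fun _ => 1) fun s _ => isHomogeneous_linearForm _
    exact ⟨_, (((isHomogeneous_lineDisc hF hA hB).mul h2).mul h3).mul h4⟩
  · intro t ht
    have ht0 := t.rep_nonzero
    set τ := t.rep with hτ
    change MvPolynomial.eval τ _ ≠ 0 at ht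
    rw [map_mul, map_mul, map_mul, e₁, e₂, e₃] at ht
    have h4 := right_ne_zero_of_mul ht
    have h3 := right_ne_zero_of_mul (left_ne_zero_of_mul ht)
    have h2 := right_ne_zero_of_mul (left_ne_zero_of_mul (left_ne_zero_of_mul ht))
    have h1 := left_ne_zero_of_mul (left_ne_zero_of_mul (left_ne_zero_of_mul ht))
    have htmk : t = Projectivization.mk ℂ τ ht0 := t.mk_rep.symm
    refine ⟨fun s hs hst => ?_, ?_⟩
    · rw [map_prod, Finset.prod_ne_zero_iff] at h4
      apply h4 s (by simpa using hs)
      rw [eval_linearForm]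
      rw [htmk, ← s.mk_rep, onLine_mk_mk] at hst
      exact hst
    have hPt : crossProduct τ a ⬝ᵥ τ = 0 := by rw [dotProduct_comm, dot_self_cross]
    have hQt : crossProduct τ b ⬝ᵥ τ = 0 := by rw [dotProduct_comm, dot_self_cross]
    have hPQ : crossProduct (crossProduct τ a) (crossProduct τ b) ≠ 0 := by
      rw [crossProduct_crossProduct_of_orthogonal hPt]
      exact smul_ne_zero h3 ht0
    rw [htmk, planeCurve_inter_line hF ht0 hPt hQt hPQ h2]
    refine ⟨(Polynomial.rootSet_finite _ ℂ).image _, ?_⟩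
    rw [Set.ncard_image_of_injective _ (injective_mk_line hPQ), ← Nat.card_coe_set_eq,
      Nat.card_eq_fintype_card, Polynomial.card_rootSet_eq_natDegree, linePoly_natDegree hF h2]
    · rw [PerfectField.separable_iff_squarefree]
      exact (lineDisc_ne_zero_iff hd hF h2 _).1 h1
    · exact IsAlgClosed.splits _

/-! ### Finiteness and degree of the projection -/

section

variable {n : ℕ} {Chat : Set (PSpace n)} {ν : Chat → PSpace 2}

theorem image_incidenceProj_fiber {C : Set (PSpace 2)} (hν : Set.range ν = C) (t : DualPlane) :
    (fun z : incidenceSurface ν => ν ⟨z.1.1, z.2.1⟩) '' (incidenceProj ν ⁻¹' {t}) =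
      C ∩ {x | OnLine x t} := by
  ext y
  constructor
  · rintro ⟨⟨⟨x, t'⟩, hx, hl⟩, ht, rfl⟩
    have ht' : t' = t := ht
    subst ht'
    exact ⟨hν ▸ Set.mem_range_self _, hl⟩
  · rintro ⟨hy, hl⟩
    rw [← hν] at hy
    obtain ⟨x, rfl⟩ := hy
    exact ⟨⟨(x.1, t), x.2, hl⟩, rfl, rfl⟩

/-- A general line avoids `S`, off which `μ` inverts `ν`. Hence the fibre is in bijection with the
`d` points of the curve on the line. -/
theorem hasDegree_incidenceProj {F : MvPolynomial (Fin 3) ℂ} {d : ℕ} (hd : 0 < d)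
    (hF : F.IsHomogeneous d) (hsq : Squarefree F) {p : PSpace 2} (hp : p ∉ planeCurve F)
    (hν : IsNormalization (planeCurve F) Chat ν) : HasDegree₂ (incidenceProj ν) d := by
  obtain ⟨S, hS, μ, -, -, hμ⟩ := hν.birational
  obtain ⟨H, hH0, hH, h⟩ := exists_form_ncard_planeCurve_inter_line hd hF hsq hp hS
  refine ⟨H, hH0, hH, fun t ht => ?_⟩
  obtain ⟨h1, h2, h3⟩ := h t ht
  rw [← image_incidenceProj_fiber hν.range_eq] at h2 h3
  have hinj : Set.InjOn (fun z : incidenceSurface ν => ν ⟨z.1.1, z.2.1⟩)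
      (incidenceProj ν ⁻¹' {t}) := by
    have key : ∀ z ∈ incidenceProj ν ⁻¹' {t},
        ∃ hx : ν ⟨z.1.1, z.2.1⟩ ∈ planeCurve F \ S, μ ⟨ν ⟨z.1.1, z.2.1⟩, hx⟩ = z.1.1 := by
      rintro z hz
      have hz' : z.1.2 = t := hz
      refine ⟨⟨hν.range_eq ▸ Set.mem_range_self _, fun hs => h1 _ hs ?_⟩, hμ _ _⟩
      rw [← hz']
      exact z.2.2
    intro z hz w hw hzw
    obtain ⟨hx, hxe⟩ := key z hz
    obtain ⟨hy, hye⟩ := key w hw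
    have h1 : z.1.1 = w.1.1 := by
      rw [← hxe, ← hye]
      congr 1
      exact Subtype.ext hzw
    have h2 : z.1.2 = w.1.2 := Eq.trans (b := t) hz (Eq.symm hw)
    exact Subtype.ext (Prod.ext h1 h2)
  refine ⟨Set.Finite.of_finite_image h2 hinj, ?_⟩
  rw [← hinj.ncard_image, h3]

theorem isLocalRep_incidenceProj (z : incidenceSurface ν) :
    IsLocalRep₂ (incidenceProj ν) z fun j => MvPolynomial.X (Sum.inr j) := by
  refine ⟨⟨(0, 1), isBihomogeneous_X_inr⟩, ?_, ?_⟩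
  · simpa [PSpace.val₂, PSpace.coords] using! z.1.2.rep_nonzero
  · intro w h
    rw [incidenceProj]
    conv_lhs => rw [← w.1.2.mk_rep]
    simp [PSpace.val₂, PSpace.coords]

/-- Properness comes from compactness of the surface. The fibres are finite because each line meets
the curve in finitely many points and `ν` has finite fibres. -/
theorem isFiniteMorphism_incidenceProj {F : MvPolynomial (Fin 3) ℂ} {d : ℕ}
    (hF : F.IsHomogeneous d) (hline : ∀ t : DualPlane, ∃ x, OnLine x t ∧ x ∉ planeCurve F)
    (hν : IsNormalization (planeCurve F) Chat ν) : IsFiniteMorphism₂ (incidenceProj ν) := by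
  refine ⟨fun z => ⟨_, isLocalRep_incidenceProj z⟩, ?_, fun t => ?_⟩
  · have : CompactSpace (incidenceSurface ν) := isCompact_iff_compactSpace.1
      (isZariskiClosed_incidenceSurface hν.closed hν.regular).isCompact
    exact (continuous_snd.comp continuous_subtype_val).isProperMap
  · have h1 := finite_planeCurve_inter_line hF t (hline t)
    rw [← image_incidenceProj_fiber hν.range_eq] at h1
    refine Set.Finite.of_finite_fibers (f := fun z : incidenceSurface ν => ν ⟨z.1.1, z.2.1⟩) h1
      fun q _ => ?_
    refine Set.Finite.of_finite_image
      (f := fun z : incidenceSurface ν => (⟨z.1.1, z.2.1⟩ : Chat)) ?_ ?_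
    · refine (hν.finite_fibers q).subset ?_
      rintro _ ⟨z, ⟨_, hz⟩, rfl⟩
      exact hz
    · rintro z ⟨hz, _⟩ w ⟨hw, _⟩ h
      exact Subtype.ext (Prod.ext (congrArg Subtype.val h)
        (Eq.trans (b := t) hz (Eq.symm hw)))

end

open scoped Topology

/-! ### Local complex analysis -/

/-- An analytic function with vanishing derivative is not injective on punctured neighbourhoods. -/
theorem AnalyticAt.exists_ne_of_deriv_eq_zero {g : ℂ → ℂ} (hg : AnalyticAt ℂ g 0)
    (hg' : deriv g 0 = 0) {U : Set ℂ} (hU : U ∈ 𝓝 (0 : ℂ)) :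
    ∃ s ∈ U, ∃ s' ∈ U, s ≠ 0 ∧ s' ≠ 0 ∧ s ≠ s' ∧ g s = g s' := by
  have hg0 : AnalyticAt ℂ (fun z => g z - g 0) 0 := hg.sub analyticAt_const
  by_cases htop : analyticOrderAt (fun z => g z - g 0) 0 = ⊤
  -- If `g` is constant near `0`, any two distinct nonzero points of a small ball will do.
  · rw [analyticOrderAt_eq_top] at htop
    obtain ⟨ε, hε, hball⟩ := Metric.mem_nhds_iff.1 (Filter.inter_mem hU htop)
    have hmem : ∀ r : ℝ, 0 < r → r < ε → (r : ℂ) ∈ U ∧ g r - g 0 = 0 := fun r h0 h1 =>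
      hball (by simpa [abs_of_pos h0] using h1)
    refine ⟨((ε / 2 : ℝ) : ℂ), (hmem _ (by positivity) (by linarith)).1, ((ε / 3 : ℝ) : ℂ),
      (hmem _ (by positivity) (by linarith)).1, ?_, ?_, ?_, ?_⟩
    · exact_mod_cast (by positivity : (ε / 2 : ℝ) ≠ 0)
    · exact_mod_cast (by positivity : (ε / 3 : ℝ) ≠ 0)
    · intro h
      have : ε / 2 = ε / 3 := by exact_mod_cast h
      linarith
    · have h1 := (hmem (ε / 2) (by positivity) (by linarith)).2
      have h2 := (hmem (ε / 3) (by positivity) (by linarith)).2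
      rw [sub_eq_zero] at h1 h2
      rw [h1, h2]
  -- Otherwise `g z - g 0 = z ^ k * h z` with `h 0 ≠ 0`, and the vanishing derivative gives `k ≥ 2`.
  obtain ⟨h, hh, hh0, hgh⟩ := hg0.analyticOrderAt_ne_top.1 htop
  set k := analyticOrderNatAt (fun z => g z - g 0) 0 with hk
  simp only [sub_zero, smul_eq_mul] at hgh
  have hk2 : 2 ≤ k := by
    by_contra hlt
    have hg0d : HasDerivAt (fun z => g z - g 0) 0 0 := by
      have := hg.differentiableAt.hasDerivAt.sub_const (g 0)
      rwa [hg'] at this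
    have hkk : k = 0 ∨ k = 1 := by omega
    rcases hkk with h0 | h1
    · rw [h0] at hgh
      have := hgh.self_of_nhds
      simp only [sub_self, pow_zero, one_mul] at this
      exact hh0 this.symm
    · rw [h1] at hgh
      have hd : HasDerivAt (fun z : ℂ => z ^ 1 * h z) (h 0) 0 := by
        have := (hasDerivAt_id (0 : ℂ)).mul hh.differentiableAt.hasDerivAt
        simpa [Pi.mul_def] using this
      exact hh0 (hd.unique (hg0d.congr_of_eventuallyEq (hgh.mono fun _ h => h.symm)))
  have hk0 : k ≠ 0 := by omega
  obtain ⟨c, hc⟩ := IsAlgClosed.exists_pow_nat_eq (h 0) (n := k) (by omega)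
  have hc0 : c ≠ 0 := by
    rintro rfl
    rw [zero_pow hk0] at hc
    exact hh0 hc.symm
  -- A local `k`-th root of `h`. Then `g z - g 0 = (z * r z) ^ k`, and `z * r z` is a local
  -- coordinate.
  let r : ℂ → ℂ := fun z => c * Complex.exp (Complex.log (h z / h 0) / k)
  have hr : AnalyticAt ℂ r 0 := by
    have h1 : AnalyticAt ℂ (fun z => h z / h 0) 0 := hh.div analyticAt_const hh0
    have h2 : AnalyticAt ℂ (fun z => Complex.log (h z / h 0)) 0 :=
      h1.clog (by simp [div_self hh0])
    exact analyticAt_const.mul ((h2.div analyticAt_const (by exact_mod_cast hk0)).cexp)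
  have hr0 : r 0 ≠ 0 := mul_ne_zero hc0 (Complex.exp_ne_zero _)
  have hrk : ∀ᶠ z in 𝓝 (0 : ℂ), r z ^ k = h z := by
    filter_upwards [hh.continuousAt.eventually_ne hh0] with z hz
    simp only [r]
    rw [mul_pow, hc, ← Complex.exp_nat_mul, mul_div_cancel₀ _ (by exact_mod_cast hk0),
      Complex.exp_log (div_ne_zero hz hh0), mul_div_cancel₀ _ hh0]
  have hψ : HasStrictDerivAt (fun z => z * r z) (r 0) 0 := by
    have h1 : AnalyticAt ℂ (fun z => z * r z) 0 := analyticAt_id.mul hr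
    have h2 : HasDerivAt (fun z => z * r z) (r 0) 0 := by
      have := (hasDerivAt_id (0 : ℂ)).mul hr.differentiableAt.hasDerivAt
      simpa [Pi.mul_def] using this
    have := h1.hasStrictDerivAt
    rwa [h2.deriv] at this
  have hmap := hψ.map_nhds_eq hr0
  rw [zero_mul] at hmap
  have hV : (fun z => z * r z) '' (U ∩ {z | g z - g 0 = (z * r z) ^ k}) ∈ 𝓝 (0 : ℂ) := by
    rw [← hmap]
    refine Filter.image_mem_map (Filter.inter_mem hU ?_)
    filter_upwards [hgh, hrk] with z h1 h2
    rw [h1, mul_pow, h2]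
  -- The points with local coordinates `w` and `ζ w` have the same `k`-th power.
  obtain ⟨ζ, hζ⟩ : ∃ ζ : ℂ, IsPrimitiveRoot ζ k :=
    ⟨_, Complex.isPrimitiveRoot_exp k hk0⟩
  have hV' : Filter.Tendsto (fun w : ℂ => ζ * w) (𝓝 0) (𝓝 0) := by
    have : Continuous fun w : ℂ => ζ * w := by fun_prop
    simpa using this.tendsto 0
  have hev : ∀ᶠ w in 𝓝[≠] (0 : ℂ), w ∈ (fun z => z * r z) '' (U ∩ {z | g z - g 0 = (z * r z) ^ k}) ∧
      ζ * w ∈ (fun z => z * r z) '' (U ∩ {z | g z - g 0 = (z * r z) ^ k}) :=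
    nhdsWithin_le_nhds (Filter.inter_mem hV (hV' hV))
  obtain ⟨w, ⟨⟨s, ⟨hs, hgs⟩, hsw⟩, ⟨s', ⟨hs', hgs'⟩, hsw'⟩⟩, hw⟩ :=
    (hev.and self_mem_nhdsWithin).exists
  simp only [Set.mem_ofPred_eq] at hgs hgs' hsw hsw'
  have hw0 : w ≠ 0 := hw
  have hζ0 : ζ ≠ 0 := hζ.ne_zero hk0
  refine ⟨s, hs, s', hs', ?_, ?_, ?_, ?_⟩
  · rintro rfl
    rw [zero_mul] at hsw
    exact hw0 hsw.symm
  · rintro rfl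
    rw [zero_mul] at hsw'
    exact mul_ne_zero hζ0 hw0 hsw'.symm
  · rintro rfl
    rw [hsw] at hsw'
    exact hζ.ne_one (by omega) (mul_right_cancel₀ hw0 (by rw [← hsw', one_mul]))
  · rw [hsw] at hgs
    rw [hsw', mul_pow, hζ.pow_eq_one, one_mul, ← hgs] at hgs'
    exact (sub_left_inj.1 hgs').symm

/-- A singular analytic arc that is injective off its centre is not contained in a normal crossing
of two curves. -/
theorem false_of_singular_arc {E : Type*} [NormedAddCommGroup E] [NormedSpace ℂ E] {z : ℂ → E}
    (hz : AnalyticAt ℂ z 0) (hz' : HasDerivAt z 0 0)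
    (hinj : ∃ U ∈ 𝓝 (0 : ℂ), ∀ s ∈ U, ∀ s' ∈ U, s ≠ 0 → s' ≠ 0 → z s = z s' → s = s')
    {W : E → Fin 2 → ℂ} (hW : AnalyticAt ℂ W (z 0)) {V : Set E} (hV : V ∈ 𝓝 (z 0))
    (hWV : Set.InjOn W V) (h0 : ∀ᶠ s in 𝓝 (0 : ℂ), W (z s) 0 * W (z s) 1 = 0) : False := by
  have hWi : ∀ i, AnalyticAt ℂ (fun x => W x i) (z 0) := fun i =>
    (ContinuousLinearMap.proj (R := ℂ) (φ := fun _ : Fin 2 => ℂ) i).analyticAt _ |>.comp hW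
  have ha : ∀ i, AnalyticAt ℂ (fun s => W (z s) i) 0 := fun i =>
    AnalyticAt.fun_comp (g := fun x => W x i) (hWi i) hz
  have hd : ∀ i, deriv (fun s => W (z s) i) 0 = 0 := by
    intro i
    have := (hWi i).differentiableAt.hasFDerivAt.comp_hasDerivAt 0 hz'
    rw [map_zero] at this
    exact this.deriv
  obtain ⟨U, hU, hUinj⟩ := hinj
  -- If the coordinate `i` vanishes along the arc, the coordinate `j` alone separates its points;
  -- but its derivative is zero, so it repeats a value.
  have key : ∀ i j : Fin 2, (∀ k, k = i ∨ k = j) →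
      (∀ᶠ s in 𝓝 (0 : ℂ), W (z s) i = 0) → False := by
    intro i j hij hi
    obtain ⟨s, hs, s', hs', hs0, hs0', hne, heq⟩ := (ha j).exists_ne_of_deriv_eq_zero (hd j)
      (Filter.inter_mem (Filter.inter_mem hU hi) (hz.continuousAt.preimage_mem_nhds hV))
    refine hne (hUinj s hs.1.1 s' hs'.1.1 hs0 hs0' (hWV hs.2 hs'.2 ?_))
    ext k
    rcases hij k with rfl | rfl
    · exact (show W (z s) k = 0 from hs.1.2).trans (show W (z s') k = 0 from hs'.1.2).symm
    · exact heq
  -- By isolated zeros, the first coordinate vanishes identically or has no zero near the centre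
  -- except possibly there; in the second case the other coordinate vanishes identically.
  rcases (ha 0).eventually_eq_zero_or_eventually_ne_zero with h | h
  · exact key 0 1 (fun k => by fin_cases k <;> simp) h
  · refine key 1 0 (fun k => by fin_cases k <;> simp) ?_
    rw [← (ha 1).frequently_zero_iff_eventually_zero]
    refine ((h.and (nhdsWithin_le_nhds h0)).mono fun s hs => ?_).frequently
    exact (mul_eq_zero.1 hs.2).resolve_left hs.1

open scoped ContDiff in
/-- An analytic arc with given velocity on a complete intersection at a smooth point. -/
theorem exists_analytic_arc {σ : Type*} [Fintype σ] {c : ℕ} (G : Fin c → MvPolynomial σ ℂ)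
    (v u : σ → ℂ)
    (hind : LinearIndependent ℂ fun j i => MvPolynomial.eval v (MvPolynomial.pderiv i (G j)))
    (hv : ∀ j, MvPolynomial.eval v (G j) = 0) (hu : ∀ j, polyDiff (G j) v u = 0) :
    ∃ γ : ℂ → σ → ℂ, AnalyticAt ℂ γ 0 ∧ γ 0 = v ∧ HasDerivAt γ u 0 ∧
      ∀ᶠ s in 𝓝 (0 : ℂ), ∀ j, MvPolynomial.eval (γ s) (G j) = 0 := by
  classical
  let A : Matrix (Fin c) σ ℂ :=
    Matrix.of fun j i => MvPolynomial.eval v (MvPolynomial.pderiv i (G j))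
  have hA : ∀ w j, A.mulVecLin w j = polyDiff (G j) v w := fun w j => rfl
  have hsurj : LinearMap.range A.mulVecLin = ⊤ := by
    apply Submodule.eq_top_of_finrank_eq
    have : A.rank = Fintype.card (Fin c) := LinearIndependent.rank_matrix hind
    rw [Matrix.rank] at this
    rw [this]
    simp
  obtain ⟨R₀, hR₀⟩ := A.mulVecLin.exists_rightInverse_of_surjective hsurj
  let R : (Fin c → ℂ) →L[ℂ] (σ → ℂ) := LinearMap.toContinuousLinearMap R₀
  have hR : ∀ y j, polyDiff (G j) v (R y) = y j := fun y j => by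
    rw [← hA]
    exact congrFun (LinearMap.congr_fun hR₀ y) j
  let T : ℂ × (Fin c → ℂ) →L[ℂ] (σ → ℂ) :=
    (ContinuousLinearMap.fst ℂ ℂ (Fin c → ℂ)).smulRight u +
      R.comp (ContinuousLinearMap.snd ℂ ℂ (Fin c → ℂ))
  -- With `R` a right inverse of the Jacobian and `u` in its kernel, the derivative of `Ψ` at `0` is
  -- the identity. The arc is `v + T` applied to the local inverse of `Ψ` on the points `(s, 0)`.
  let Ψ : ℂ × (Fin c → ℂ) → ℂ × (Fin c → ℂ) := fun p =>
    (p.1, fun j => MvPolynomial.eval (v + T p) (G j))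
  have hTan : AnalyticAt ℂ (fun p => v + T p) 0 := analyticAt_const.add (T.analyticAt 0)
  have hΨan : AnalyticAt ℂ Ψ 0 := by
    refine analyticAt_fst.prod (analyticAt_pi_iff.2 fun j => ?_)
    exact AnalyticAt.fun_comp (g := fun x => MvPolynomial.eval x (G j))
      (AnalyticOnNhd.eval_mvPolynomial (G j) _ (Set.mem_univ _)) hTan
  have hΨd : HasFDerivAt Ψ
      ((ContinuousLinearEquiv.refl ℂ (ℂ × (Fin c → ℂ)) :
        ℂ × (Fin c → ℂ) →L[ℂ] ℂ × (Fin c → ℂ))) 0 := by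
    have h1 : ∀ j, HasFDerivAt (fun p => MvPolynomial.eval (v + T p) (G j))
        ((ContinuousLinearMap.proj j).comp (ContinuousLinearMap.snd ℂ ℂ (Fin c → ℂ))) 0 := by
      intro j
      have h2 : HasFDerivAt (fun p => v + T p) T 0 := T.hasFDerivAt.const_add v
      have h3 := (hasStrictFDerivAt_eval (G j) (v + T 0)).hasFDerivAt.comp 0 h2
      refine h3.congr_fderiv ?_
      refine ContinuousLinearMap.ext fun p => ?_
      have h4 : polyDiff (G j) v (T p) = p.2 j := by
        have : T p = p.1 • u + R p.2 := rfl
        rw [this, polyDiff_add, polyDiff_smul, hu, mul_zero, zero_add, hR]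
      rw [map_zero, add_zero]
      simpa [polyDiff] using h4
    exact hasFDerivAt_fst.prodMk (hasFDerivAt_pi.2 h1)
  have hΨc : ContDiffAt ℂ ω Ψ 0 := hΨan.contDiffAt
  have hω : (ω : WithTop ℕ∞) ≠ 0 := by simp
  have hs := hΨc.hasStrictFDerivAt' hΨd hω
  have hΨ0 : Ψ 0 = 0 := by
    ext
    · rfl
    · simp [Ψ, hv]
  let φ := hΨc.localInverse hΨd hω
  have hφ : AnalyticAt ℂ φ 0 := by
    have := hΨc.to_localInverse hΨd hω
    rw [hΨ0] at this
    exact this.analyticAt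
  have hφ0 : φ 0 = 0 := by
    have := hΨc.localInverse_apply_image hΨd hω
    rwa [hΨ0] at this
  have hφd : HasFDerivAt φ (ContinuousLinearMap.id ℂ (ℂ × (Fin c → ℂ))) 0 := by
    have := hs.to_localInverse.hasFDerivAt
    rw [hΨ0] at this
    exact this
  have hφr : ∀ᶠ p in 𝓝 (0 : ℂ × (Fin c → ℂ)), Ψ (φ p) = p := by
    have := hs.eventually_right_inverse
    rwa [hΨ0] at this
  have hι : HasDerivAt (fun s : ℂ => ((s, 0) : ℂ × (Fin c → ℂ))) (1, 0) 0 :=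
    (hasDerivAt_id 0).prodMk (hasDerivAt_const 0 0)
  have hιan : AnalyticAt ℂ (fun s : ℂ => ((s, 0) : ℂ × (Fin c → ℂ))) 0 :=
    analyticAt_id.prod analyticAt_const
  refine ⟨fun s => v + T (φ (s, 0)), ?_, ?_, ?_, ?_⟩
  · have h1 : AnalyticAt ℂ (fun s : ℂ => φ (s, 0)) 0 := AnalyticAt.fun_comp (g := φ) hφ hιan
    exact analyticAt_const.add (AnalyticAt.fun_comp (g := T) (T.analyticAt _) h1)
  · change v + T (φ 0) = v
    rw [hφ0, map_zero, add_zero]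
  · have h1 : HasDerivAt (fun s : ℂ => φ (s, 0)) (1, 0) 0 :=
      HasFDerivAt.comp_hasDerivAt (f := fun s : ℂ => ((s, 0) : ℂ × (Fin c → ℂ))) 0 hφd hι
    have h2 := (T.hasFDerivAt.comp_hasDerivAt 0 h1).const_add v
    have h3 : T (1, 0) = u := by simp [T]
    rw [h3] at h2
    exact h2
  · have h1 : Filter.Tendsto (fun s : ℂ => ((s, 0) : ℂ × (Fin c → ℂ))) (𝓝 0) (𝓝 0) :=
      hιan.continuousAt
    filter_upwards [h1 hφr] with s hs j
    exact congrFun (congrArg Prod.snd hs) j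

/-- An analytic arc in a projective space with nonzero velocity is locally injective. -/
theorem exists_nhds_arc_injective {σ : Type*} [Fintype σ] {γ : ℂ → σ → ℂ} {u : σ → ℂ}
    (hγ : AnalyticAt ℂ γ 0) (hγ' : HasDerivAt γ u 0) (h0 : γ 0 ≠ 0) (hu : ∀ a : ℂ, u ≠ a • γ 0) :
    ∃ U ∈ 𝓝 (0 : ℂ), ∀ s ∈ U, ∀ s' ∈ U, (∃ a : ℂ, γ s = a • γ s') → s = s' := by
  obtain ⟨i, hi⟩ := Function.ne_iff.1 h0
  -- The multiple of `γ 0` that agrees with `u` in coordinate `i` differs from `u` in some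
  -- coordinate `j`. Hence the affine coordinate `γ j / γ i` has nonzero derivative.
  obtain ⟨j, hj⟩ := Function.ne_iff.1 (hu (u i / γ 0 i))
  have hc : ∀ k, AnalyticAt ℂ (fun s => γ s k) 0 := analyticAt_pi_iff.1 hγ
  have hd : ∀ k, HasDerivAt (fun s => γ s k) (u k) 0 := hasDerivAt_pi.1 hγ'
  have hi' : γ 0 i ≠ 0 := hi
  have hg : AnalyticAt ℂ (fun s => γ s j / γ s i) 0 := (hc j).div (hc i) hi
  have hgd := (hd j).div (hd i) hi'
  have hne : (u j * γ 0 i - γ 0 j * u i) / γ 0 i ^ 2 ≠ 0 := by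
    refine div_ne_zero ?_ (pow_ne_zero 2 hi')
    intro h
    apply hj
    rw [Pi.smul_apply, smul_eq_mul]
    field_simp
    linear_combination h
  have hgs : HasStrictDerivAt (fun s => γ s j / γ s i)
      ((u j * γ 0 i - γ 0 j * u i) / γ 0 i ^ 2) 0 := by
    have := hg.hasStrictDerivAt
    rwa [show deriv (fun s => γ s j / γ s i) 0 = _ from hgd.deriv] at this
  have hinv := (hgs.hasStrictFDerivAt_equiv hne).eventually_left_inverse
  refine ⟨_, Filter.inter_mem hinv ((hc i).continuousAt.eventually_ne hi'), ?_⟩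
  rintro s ⟨hs, hsi⟩ s' ⟨hs', hsi'⟩ ⟨a, ha⟩
  have heq : γ s j / γ s i = γ s' j / γ s' i := by
    have hsi2 : γ s i ≠ 0 := hsi
    rw [ha] at hsi2 ⊢
    simp only [Pi.smul_apply, smul_eq_mul] at hsi2 ⊢
    rw [mul_div_mul_left _ _ (left_ne_zero_of_mul hsi2)]
  rw [← hs, ← hs', heq]

/-! ### Arcs on nodal curves -/

/-- The affine coordinates of `v` in the `i`-th chart. -/
noncomputable def affineCoords (i : Fin 3) (v : Fin 3 → ℂ) : Fin 2 → ℂ :=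
  fun k => v (i.succAbove k) / v i

theorem insertNth_affineCoords {i : Fin 3} {v : Fin 3 → ℂ} (hv : v i ≠ 0) :
    i.insertNth (α := fun _ => ℂ) 1 (affineCoords i v) = (v i)⁻¹ • v := by
  ext j
  refine Fin.succAboveCases i ?_ (fun k => ?_) j
  · simp [hv]
  · simp [affineCoords, div_eq_inv_mul]

theorem affineChart_affineCoords {i : Fin 3} {v : Fin 3 → ℂ} (hv : v i ≠ 0) (hv0 : v ≠ 0) :
    affineChart i (affineCoords i v) = Projectivization.mk ℂ v hv0 := by
  rw [affineChart, Projectivization.mk_eq_mk_iff']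
  exact ⟨(v i)⁻¹, (insertNth_affineCoords hv).symm⟩

theorem eq_affineCoords_of_affineChart_eq {i : Fin 3} {z : Fin 2 → ℂ} {v : Fin 3 → ℂ}
    (hv0 : v ≠ 0) (h : affineChart i z = Projectivization.mk ℂ v hv0) :
    v i ≠ 0 ∧ z = affineCoords i v := by
  rw [affineChart, Projectivization.mk_eq_mk_iff'] at h
  obtain ⟨a, ha⟩ := h
  have h1 : a * v i = 1 := by simpa using congrFun ha i
  have hvi : v i ≠ 0 := right_ne_zero_of_mul (h1 ▸ one_ne_zero)
  refine ⟨hvi, ?_⟩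
  ext k
  have h2 : a * v (i.succAbove k) = z k := by simpa using congrFun ha (i.succAbove k)
  rw [← h2, affineCoords, eq_div_iff hvi]
  linear_combination v (i.succAbove k) * h1

theorem affineCoords_eq_iff {i : Fin 3} {v w : Fin 3 → ℂ} (hv : v i ≠ 0) (hw : w i ≠ 0)
    (h : affineCoords i v = affineCoords i w) : ∃ a : ℂ, v = a • w := by
  have h1 := insertNth_affineCoords hv
  rw [h, insertNth_affineCoords hw] at h1
  refine ⟨v i * (w i)⁻¹, ?_⟩
  rw [mul_smul, h1, smul_smul, mul_inv_cancel₀ hv, one_smul]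

section

variable {q : ℂ → Fin 3 → ℂ} {q' : Fin 3 → ℂ}

/-- A projective analytic arc, injective off its centre and with vanishing velocity, is not
contained in a normal crossing of two curves. -/
theorem false_of_singular_projective_arc (hq : AnalyticAt ℂ q 0) (hq' : HasDerivAt q q' 0)
    {c : ℂ} (hc : q' = c • q 0)
    (hinj : ∃ U ∈ 𝓝 (0 : ℂ), ∀ s ∈ U, ∀ s' ∈ U, s ≠ 0 → s' ≠ 0 →
      (∃ a : ℂ, q s = a • q s') → s = s')
    {i : Fin 3} (hi : q 0 i ≠ 0) {W : (Fin 2 → ℂ) → Fin 2 → ℂ}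
    (hW : AnalyticAt ℂ W (affineCoords i (q 0))) {V : Set (Fin 2 → ℂ)}
    (hV : V ∈ 𝓝 (affineCoords i (q 0))) (hWV : Set.InjOn W V)
    (h0 : ∀ᶠ s in 𝓝 (0 : ℂ), W (affineCoords i (q s)) 0 * W (affineCoords i (q s)) 1 = 0) :
    False := by
  have hqk : ∀ k, AnalyticAt ℂ (fun s => q s k) 0 := analyticAt_pi_iff.1 hq
  have hdk : ∀ k, HasDerivAt (fun s => q s k) (q' k) 0 := hasDerivAt_pi.1 hq'
  have hz : AnalyticAt ℂ (fun s => affineCoords i (q s)) 0 :=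
    analyticAt_pi_iff.2 fun k => (hqk _).div (hqk i) hi
  -- A radial velocity disappears in affine coordinates.
  have hz' : HasDerivAt (fun s => affineCoords i (q s)) 0 0 := by
    refine hasDerivAt_pi.2 fun k => ?_
    have h1 : HasDerivAt (fun s => affineCoords i (q s) k) _ 0 :=
      (hdk (i.succAbove k)).div (hdk i) hi
    refine h1.congr_deriv ?_
    rw [hc]
    simp only [Pi.smul_apply, smul_eq_mul, Pi.zero_apply]
    ring
  obtain ⟨U, hU, hUinj⟩ := hinj
  refine false_of_singular_arc hz hz' ⟨_, Filter.inter_mem hU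
    ((hqk i).continuousAt.eventually_ne hi), ?_⟩ hW hV hWV h0
  rintro s ⟨hs, hsi⟩ s' ⟨hs', hsi'⟩ hs0 hs0' h
  exact hUinj s hs s' hs' hs0 hs0' (affineCoords_eq_iff hsi hsi' h)

theorem analyticAt_insertNth (i : Fin 3) (F : MvPolynomial (Fin 3) ℂ) (z : Fin 2 → ℂ) :
    AnalyticAt ℂ (fun z : Fin 2 → ℂ =>
      MvPolynomial.eval (i.insertNth (α := fun _ => ℂ) 1 z : Fin 3 → ℂ) F) z := by
  refine AnalyticAt.fun_comp (g := fun x => MvPolynomial.eval x F)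
    (AnalyticOnNhd.eval_mvPolynomial F _ (Set.mem_univ _)) (analyticAt_pi_iff.2 fun j => ?_)
  refine Fin.succAboveCases i ?_ (fun k => ?_) j
  · simp only [Fin.insertNth_apply_same]
    exact analyticAt_const
  · simp only [Fin.insertNth_apply_succAbove]
    exact (ContinuousLinearMap.proj (R := ℂ) (φ := fun _ : Fin 2 => ℂ) k).analyticAt z

theorem hasDerivAt_insertNth (i : Fin 3) (F : MvPolynomial (Fin 3) ℂ) (z w : Fin 2 → ℂ) :
    HasDerivAt (fun s : ℂ =>
      MvPolynomial.eval (i.insertNth (α := fun _ => ℂ) 1 (z + s • w) : Fin 3 → ℂ) F)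
      (∑ k, MvPolynomial.eval (i.insertNth (α := fun _ => ℂ) 1 z)
        (MvPolynomial.pderiv (i.succAbove k) F) * w k) 0 := by
  have h : HasDerivAt (fun s : ℂ => (i.insertNth (α := fun _ => ℂ) 1 (z + s • w) : Fin 3 → ℂ))
      (i.insertNth (α := fun _ => ℂ) 0 w) 0 := by
    refine hasDerivAt_pi.2 fun j => ?_
    refine Fin.succAboveCases i ?_ (fun k => ?_) j
    · simp only [Fin.insertNth_apply_same]
      exact hasDerivAt_const _ _
    · simp only [Fin.insertNth_apply_succAbove, Pi.add_apply, Pi.smul_apply, smul_eq_mul]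
      simpa using ((hasDerivAt_id (0 : ℂ)).mul_const (w k)).const_add (z k)
  have := hasDerivAt_eval_comp F h
  convert this using 1
  rw [polyDiff, Fin.sum_univ_succAbove _ i]
  simp

/-- Local coordinates of the plane in which a curve is straight at a smooth point. -/
theorem exists_injOn_of_smooth {F : MvPolynomial (Fin 3) ℂ} {d : ℕ} (hF : F.IsHomogeneous d)
    {i : Fin 3} {z₀ : Fin 2 → ℂ}
    (h0 : MvPolynomial.eval (i.insertNth (α := fun _ => ℂ) 1 z₀ : Fin 3 → ℂ) F = 0)
    (hgrad : ∃ j, MvPolynomial.eval (i.insertNth (α := fun _ => ℂ) 1 z₀ : Fin 3 → ℂ)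
      (MvPolynomial.pderiv j F) ≠ 0) :
    ∃ W : (Fin 2 → ℂ) → Fin 2 → ℂ, AnalyticAt ℂ W z₀ ∧ (∃ V ∈ 𝓝 z₀, Set.InjOn W V) ∧
      ∀ z, W z 0 = MvPolynomial.eval (i.insertNth (α := fun _ => ℂ) 1 z : Fin 3 → ℂ) F := by
  set D : Fin 2 → ℂ := fun k => MvPolynomial.eval
    (i.insertNth (α := fun _ => ℂ) 1 z₀ : Fin 3 → ℂ) (MvPolynomial.pderiv (i.succAbove k) F) with hD
  -- By Euler's identity at a zero of `F` with `i`-th coordinate `1`, the `i`-th partial derivative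
  -- vanishes if the other two do.
  have hk : ∃ k, D k ≠ 0 := by
    by_contra! h
    have he := hF.polyDiff_self (i.insertNth (α := fun _ => ℂ) 1 z₀)
    rw [h0, mul_zero, polyDiff, Fin.sum_univ_succAbove _ i] at he
    simp only [Fin.insertNth_apply_same, mul_one, Fin.insertNth_apply_succAbove] at he
    rw [Finset.sum_eq_zero fun k _ => by
      have hk := h k
      simp only [hD] at hk
      rw [hk, zero_mul], add_zero] at he
    obtain ⟨j, hj⟩ := hgrad
    apply hj
    rcases Fin.eq_self_or_eq_succAbove i j with rfl | ⟨k, rfl⟩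
    · exact he
    · exact h k
  obtain ⟨k, hk⟩ := hk
  -- `F` is completed to a coordinate system by the affine coordinate other than `k`; in `Fin 2`
  -- this is `k + 1`.
  let W : (Fin 2 → ℂ) → Fin 2 → ℂ := fun z =>
    ![MvPolynomial.eval (i.insertNth (α := fun _ => ℂ) 1 z : Fin 3 → ℂ) F, z (k + 1)]
  have hW : AnalyticAt ℂ W z₀ := by
    refine analyticAt_pi_iff.2 fun j => ?_
    fin_cases j
    · exact analyticAt_insertNth i F z₀
    · exact (ContinuousLinearMap.proj (R := ℂ) (φ := fun _ : Fin 2 => ℂ) (k + 1)).analyticAt z₀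
  have hL : ∀ w, fderiv ℂ W z₀ w = ![∑ k, D k * w k, w (k + 1)] := by
    intro w
    have hl : HasDerivAt (fun s : ℂ => z₀ + s • w) w 0 := by
      simpa using ((hasDerivAt_id (0 : ℂ)).smul_const w).const_add z₀
    have hWd : HasFDerivAt W (fderiv ℂ W z₀) (z₀ + (0 : ℂ) • w) := by
      rw [zero_smul, add_zero]
      exact hW.differentiableAt.hasFDerivAt
    refine (hWd.comp_hasDerivAt 0 hl).unique (hasDerivAt_pi.2 fun j => ?_)
    fin_cases j
    · exact hasDerivAt_insertNth i F z₀ w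
    · exact hasDerivAt_pi.1 hl (k + 1)
  have hinj : Function.Injective (fderiv ℂ W z₀) := by
    rw [injective_iff_map_eq_zero]
    intro w hw
    rw [hL] at hw
    have h1 : ∑ k, D k * w k = 0 := congrFun hw 0
    have h2 : w (k + 1) = 0 := congrFun hw 1
    have h3 : w k = 0 := by
      rw [Fin.sum_univ_two] at h1
      fin_cases k
      · have h2' : w 1 = 0 := h2
        rw [h2', mul_zero, add_zero] at h1
        exact (mul_eq_zero.1 h1).resolve_left hk
      · have h2' : w 0 = 0 := h2
        rw [h2', mul_zero, zero_add] at h1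
        exact (mul_eq_zero.1 h1).resolve_left hk
    ext j
    fin_cases k <;> fin_cases j <;> first | exact h2 | exact h3
  let e : (Fin 2 → ℂ) ≃L[ℂ] (Fin 2 → ℂ) :=
    (LinearEquiv.ofInjectiveEndo (fderiv ℂ W z₀ : (Fin 2 → ℂ) →ₗ[ℂ] (Fin 2 → ℂ))
      hinj).toContinuousLinearEquiv
  have hs : HasStrictFDerivAt W (e : (Fin 2 → ℂ) →L[ℂ] (Fin 2 → ℂ)) z₀ :=
    hW.hasStrictFDerivAt.congr_fderiv (by ext1; rfl)
  refine ⟨W, hW, ⟨_, hs.eventually_left_inverse, fun x hx y hy hxy => ?_⟩, fun z => rfl⟩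
  have hx' := show hs.localInverse W e z₀ (W x) = x from hx
  have hy' := show hs.localInverse W e z₀ (W y) = y from hy
  rw [← hx', ← hy', hxy]

/-- An arc on a nodal curve, injective off its centre, is immersed. -/
theorem crossProduct_ne_zero_of_arc {F : MvPolynomial (Fin 3) ℂ} {d : ℕ} (hF : F.IsHomogeneous d)
    (hnode : ∀ q ∈ planeCurve F, gradientAt F q = 0 → IsNode (planeCurve F) q)
    (hq : AnalyticAt ℂ q 0) (hq' : HasDerivAt q q' 0) (hq0 : q 0 ≠ 0)
    (hqF : ∀ᶠ s in 𝓝 (0 : ℂ), MvPolynomial.eval (q s) F = 0)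
    (hinj : ∃ U ∈ 𝓝 (0 : ℂ), ∀ s ∈ U, ∀ s' ∈ U, s ≠ 0 → s' ≠ 0 →
      (∃ a : ℂ, q s = a • q s') → s = s') :
    crossProduct (q 0) q' ≠ 0 := by
  intro hcr
  obtain ⟨c, hc⟩ : ∃ c : ℂ, c • q 0 = q' := by
    have hni : ¬ LinearIndependent ℂ ![q 0, q'] := by
      rwa [← crossProduct_ne_zero_iff_linearIndependent, not_not]
    rw [LinearIndependent.pair_iff' hq0] at hni
    push Not at hni
    exact hni
  have hF0 := hqF.self_of_nhds
  have hqk : ∀ k, AnalyticAt ℂ (fun s => q s k) 0 := analyticAt_pi_iff.1 hq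
  have hzc : ∀ i, q 0 i ≠ 0 → ContinuousAt (fun s => affineCoords i (q s)) 0 := fun i hi =>
    (analyticAt_pi_iff.2 fun k => (hqk (i.succAbove k)).div (hqk i) hi).continuousAt
  by_cases hg : gradientAt F (Projectivization.mk ℂ (q 0) hq0) = 0
  -- At a singular point the coordinates are those given by the node.
  · obtain ⟨i, Φ, hΦ, -, ⟨z₀, hz₀, hz₀q, -⟩, hΦC⟩ :=
      hnode _ ((mk_mem_planeCurve_iff hF hq0).2 hF0) hg
    obtain ⟨hi, rfl⟩ := eq_affineCoords_of_affineChart_eq hq0 hz₀q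
    refine false_of_singular_projective_arc hq hq' hc.symm hinj hi (hΦ _ hz₀)
      (Φ.open_source.mem_nhds hz₀) Φ.injOn ?_
    filter_upwards [(hzc i hi).preimage_mem_nhds (Φ.open_source.mem_nhds hz₀), hqF,
      (hqk i).continuousAt.eventually_ne hi] with s hs hsF hsi
    have hs0 : q s ≠ 0 := fun h => hsi (congrFun h i)
    rw [← hΦC _ hs, affineChart_affineCoords hsi hs0]
    exact (mk_mem_planeCurve_iff hF hs0).2 hsF
  -- At a smooth point `F` itself is the first coordinate; it vanishes along the arc, so the product
  -- of the coordinates does too.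
  · obtain ⟨i, hi⟩ := Function.ne_iff.1 hq0
    have hi' : q 0 i ≠ 0 := hi
    have hgr : ∃ j, MvPolynomial.eval (i.insertNth (α := fun _ => ℂ) 1 (affineCoords i (q 0)) :
        Fin 3 → ℂ) (MvPolynomial.pderiv j F) ≠ 0 := by
      by_contra! h
      apply hg
      ext j
      rw [gradientAt]
      refine (PSpace.val_mk_eq_zero (n := 2) hF.pderiv _ _).2 ?_
      have := h j
      rw [insertNth_affineCoords hi', hF.pderiv.eval_smul] at this
      exact (mul_eq_zero.1 this).resolve_left (pow_ne_zero _ (inv_ne_zero hi'))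
    have heval : ∀ s, q s i ≠ 0 → MvPolynomial.eval (q s) F = 0 → MvPolynomial.eval
        (i.insertNth (α := fun _ => ℂ) 1 (affineCoords i (q s)) : Fin 3 → ℂ) F = 0 := by
      intro s hs h
      rw [insertNth_affineCoords hs, hF.eval_smul, h, mul_zero]
    obtain ⟨W, hW, ⟨V, hV, hWV⟩, hWF⟩ := exists_injOn_of_smooth hF (heval 0 hi' hF0) hgr
    refine false_of_singular_projective_arc hq hq' hc.symm hinj hi hW hV hWV ?_
    filter_upwards [hqF, (hqk i).continuousAt.eventually_ne hi] with s hsF hsi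
    rw [hWF, heval s hsi hsF, zero_mul]

end

/-! ### Arcs on a smooth projective curve -/

section

variable {n : ℕ} {Chat : Set (PSpace n)} {ν : Chat → PSpace 2}

/-- `γ` is an analytic arc on `Chat`, in homogeneous coordinates, through `x` with velocity `u`. -/
structure IsArc (Chat : Set (PSpace n)) (x : PSpace n) (u : Fin (n + 1) → ℂ)
    (γ : ℂ → Fin (n + 1) → ℂ) : Prop where
  analyticAt : AnalyticAt ℂ γ 0
  map_zero : γ 0 = x.rep
  hasDerivAt : HasDerivAt γ u 0
  eventually_mem : ∀ᶠ s in 𝓝 (0 : ℂ), ∃ h : γ s ≠ 0, Projectivization.mk ℂ (γ s) h ∈ Chat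

/-- `K` is the kernel of the Jacobian of the local equations. It contains the radial direction,
whence dimension two for a curve. -/
theorem exists_tangentSpace_arc (hC : IsSmoothOfDim Chat 1) {x : PSpace n} (hx : x ∈ Chat) :
    ∃ K : Submodule ℂ (Fin (n + 1) → ℂ), 2 ≤ Module.finrank ℂ K ∧
      (∀ u, (∀ G : MvPolynomial (Fin (n + 1)) ℂ, (∃ e, G.IsHomogeneous e) →
        (∀ y ∈ Chat, y.val G = 0) → polyDiff G x.rep u = 0) → u ∈ K) ∧
      ∀ u ∈ K, ∃ γ, IsArc Chat x u γ := by
  obtain ⟨c, hc, G, hG, H, ⟨eH, hH⟩, hHx, hloc, hind⟩ := hC x hx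
  have hGx : ∀ j, MvPolynomial.eval x.rep (G j) = 0 := (hloc x hHx).1 hx
  let A : Matrix (Fin c) (Fin (n + 1)) ℂ :=
    Matrix.of fun j i => MvPolynomial.eval x.rep (MvPolynomial.pderiv i (G j))
  have hA : ∀ w j, A.mulVecLin w j = polyDiff (G j) x.rep w := fun w j => rfl
  refine ⟨LinearMap.ker A.mulVecLin, ?_, ?_, ?_⟩
  · have h1 := A.mulVecLin.finrank_range_add_finrank_ker
    have h2 : Module.finrank ℂ (LinearMap.range A.mulVecLin) ≤ c := by
      simpa using Submodule.finrank_le (LinearMap.range A.mulVecLin)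
    rw [Module.finrank_fin_fun] at h1
    omega
  · intro u hu
    rw [LinearMap.mem_ker]
    ext j
    rw [hA]
    obtain ⟨e, he⟩ := hG j
    -- The local equation `G j` need not vanish on all of `Chat`, but `G j * H` does, and at `x` its
    -- differential is `H` times that of `G j`.
    have := hu (G j * H) ⟨_, he.mul hH⟩ fun y hy => by
      rw [PSpace.val, map_mul]
      by_cases hyH : y.val H = 0
      · exact mul_eq_zero_of_right _ hyH
      · exact mul_eq_zero_of_left ((hloc y hyH).1 hy j) _
    rw [polyDiff_mul, hGx, zero_mul, zero_add] at this
    exact (mul_eq_zero.1 this).resolve_left hHx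
  · intro u hu
    rw [LinearMap.mem_ker] at hu
    obtain ⟨γ, hγ, hγ0, hγ', hγG⟩ := exists_analytic_arc G x.rep u hind hGx
      fun j => by rw [← hA, hu]; rfl
    refine ⟨γ, hγ, hγ0, hγ', ?_⟩
    have h1 : ∀ᶠ s in 𝓝 (0 : ℂ), MvPolynomial.eval (γ s) H ≠ 0 := by
      have : ContinuousAt (fun s => MvPolynomial.eval (γ s) H) 0 :=
        (MvPolynomial.continuous_eval H).continuousAt.comp hγ.continuousAt
      exact this.eventually_ne (by rw [hγ0]; exact hHx)
    have h2 : ∀ᶠ s in 𝓝 (0 : ℂ), γ s ≠ 0 :=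
      hγ.continuousAt.eventually_ne (by rw [hγ0]; exact x.rep_nonzero)
    filter_upwards [h1, h2, hγG] with s hs1 hs2 hs3
    refine ⟨hs2, (hloc _ ?_).2 fun j => ?_⟩
    · exact fun h => hs1 ((PSpace.val_mk_eq_zero hH _ _).1 h)
    · obtain ⟨e, he⟩ := hG j
      exact (PSpace.val_mk_eq_zero he _ _).2 (hs3 j)

theorem exists_arc_of_smooth (hC : IsSmoothOfDim Chat 1) {x : PSpace n} (hx : x ∈ Chat) :
    ∃ u, (∀ a : ℂ, u ≠ a • x.rep) ∧ ∃ γ, IsArc Chat x u γ := by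
  obtain ⟨K, hK, -, hγ⟩ := exists_tangentSpace_arc hC hx
  by_contra! h
  have hle : K ≤ Submodule.span ℂ {x.rep} := by
    intro u hu
    rw [Submodule.mem_span_singleton]
    by_contra! hne
    obtain ⟨γ, hγ⟩ := hγ u hu
    exact h u (fun a => (hne a).symm) γ hγ
  have h1 := Submodule.finrank_mono hle
  have h2 := finrank_span_singleton (K := ℂ) x.rep_nonzero
  omega

/-- A local representation of `ν` in arbitrary homogeneous coordinates. -/
theorem IsLocalRep.apply_mk {z₀ : Chat} {Γ : Fin 3 → MvPolynomial (Fin (n + 1)) ℂ}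
    (hΓ : IsLocalRep ν z₀ Γ) {v : Fin (n + 1) → ℂ} (hv : v ≠ 0)
    (hvC : Projectivization.mk ℂ v hv ∈ Chat) (h : (fun j => MvPolynomial.eval v (Γ j)) ≠ 0) :
    ν ⟨Projectivization.mk ℂ v hv, hvC⟩ =
      Projectivization.mk ℂ (fun j => MvPolynomial.eval v (Γ j)) h := by
  obtain ⟨e, he⟩ := hΓ.1
  obtain ⟨a, ha, hrep⟩ := PSpace.exists_rep_mk v hv
  have hval : (fun j => PSpace.val (Projectivization.mk ℂ v hv) (Γ j)) =
      a ^ e • fun j => MvPolynomial.eval v (Γ j) := by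
    ext j
    rw [PSpace.val, hrep, (he j).eval_smul]
    rfl
  have hne : (fun j => PSpace.val (Projectivization.mk ℂ v hv) (Γ j)) ≠ 0 := by
    rw [hval]
    exact smul_ne_zero (pow_ne_zero _ ha) h
  rw [hΓ.2.2 ⟨_, hvC⟩ hne, Projectivization.mk_eq_mk_iff']
  exact ⟨a ^ e, hval.symm⟩

/-! ### Images of arcs under the normalization -/

section

variable {x : Chat} {u : Fin (n + 1) → ℂ} {γ : ℂ → Fin (n + 1) → ℂ}

theorem IsArc.exists_nhds_injective (hγ : IsArc Chat x.1 u γ) (hu : ∀ a : ℂ, u ≠ a • x.1.rep) :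
    ∃ U ∈ 𝓝 (0 : ℂ), ∀ s ∈ U, ∀ s' ∈ U, (∃ a : ℂ, γ s = a • γ s') → s = s' := by
  refine exists_nhds_arc_injective hγ.analyticAt hγ.hasDerivAt ?_ ?_
  · rw [hγ.map_zero]; exact x.1.rep_nonzero
  · rw [hγ.map_zero]; exact hu

/-- The arc is injective near `0` and `ν` has finite fibres, so only finitely many small parameters
are sent into `T`. -/
theorem IsArc.eventually_notMem (hγ : IsArc Chat x.1 u γ) (hu : ∀ a : ℂ, u ≠ a • x.1.rep)
    (hfin : ∀ q, (ν ⁻¹' {q}).Finite) {T : Set (PSpace 2)} (hT : T.Finite) :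
    ∀ᶠ s in 𝓝[≠] (0 : ℂ), ∀ (h : γ s ≠ 0) (hC : Projectivization.mk ℂ (γ s) h ∈ Chat),
      ν ⟨_, hC⟩ ∉ T := by
  obtain ⟨U, hU, hinj⟩ := hγ.exists_nhds_injective hu
  let B : Set ℂ := {s | s ∈ U ∧ ∃ (h : γ s ≠ 0) (hC : Projectivization.mk ℂ (γ s) h ∈ Chat),
    ν ⟨_, hC⟩ ∈ T}
  have hpre : (ν ⁻¹' T).Finite := by
    rw [← Set.biUnion_preimage_singleton]
    exact hT.biUnion fun q _ => hfin q
  have hB : B.Finite := by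
    classical
    refine Set.Finite.of_injOn (f := fun s => if h : γ s ≠ 0 then
      Projectivization.mk ℂ (γ s) h else x.1) (t := Subtype.val '' (ν ⁻¹' T)) ?_ ?_
      (hpre.image _)
    · rintro s ⟨-, h, hC, hs⟩
      simp only [h, ne_eq, not_false_eq_true, dif_pos]
      exact ⟨⟨_, hC⟩, hs, rfl⟩
    · rintro s ⟨hsU, h, -⟩ s' ⟨hsU', h', -⟩ heq
      simp only [h, h', ne_eq, not_false_eq_true, dif_pos] at heq
      rw [Projectivization.mk_eq_mk_iff'] at heq
      obtain ⟨a, ha⟩ := heq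
      exact hinj s hsU s' hsU' ⟨a, ha.symm⟩
  have hB' : (B \ {0})ᶜ ∈ 𝓝 (0 : ℂ) :=
    (hB.subset Set.sdiff_subset).isClosed.isOpen_compl.mem_nhds (by simp)
  filter_upwards [nhdsWithin_le_nhds hU, nhdsWithin_le_nhds hB', self_mem_nhdsWithin]
    with s hsU hsB hs0 h hC hmem
  exact hsB ⟨⟨hsU, h, hC, hmem⟩, hs0⟩

variable {Γ : Fin 3 → MvPolynomial (Fin (n + 1)) ℂ}

theorem IsArc.analyticAt_image (hγ : IsArc Chat x.1 u γ)
    (Γ : Fin 3 → MvPolynomial (Fin (n + 1)) ℂ) :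
    AnalyticAt ℂ (fun s j => MvPolynomial.eval (γ s) (Γ j)) 0 :=
  analyticAt_pi_iff.2 fun j => AnalyticAt.fun_comp (g := fun x => MvPolynomial.eval x (Γ j))
    (AnalyticOnNhd.eval_mvPolynomial (Γ j) _ (Set.mem_univ _)) hγ.analyticAt

theorem IsArc.hasDerivAt_image (hγ : IsArc Chat x.1 u γ)
    (Γ : Fin 3 → MvPolynomial (Fin (n + 1)) ℂ) :
    HasDerivAt (fun s j => MvPolynomial.eval (γ s) (Γ j))
      (fun j => polyDiff (Γ j) x.1.rep u) 0 := by
  refine hasDerivAt_pi.2 fun j => ?_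
  have := hasDerivAt_eval_comp (Γ j) hγ.hasDerivAt
  rwa [hγ.map_zero] at this

theorem IsArc.image_ne_zero (hγ : IsArc Chat x.1 u γ) (hΓ : IsLocalRep ν x Γ) :
    (fun j => MvPolynomial.eval (γ 0) (Γ j)) ≠ 0 := by
  rw [hγ.map_zero]
  exact hΓ.2.1

theorem IsArc.eventually_image (hγ : IsArc Chat x.1 u γ) (hΓ : IsLocalRep ν x Γ) :
    ∀ᶠ s in 𝓝 (0 : ℂ), ∃ (h : γ s ≠ 0) (hC : Projectivization.mk ℂ (γ s) h ∈ Chat)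
      (hq : (fun j => MvPolynomial.eval (γ s) (Γ j)) ≠ 0),
      ν ⟨_, hC⟩ = Projectivization.mk ℂ _ hq := by
  filter_upwards [hγ.eventually_mem,
    (hγ.analyticAt_image Γ).continuousAt.eventually_ne (hγ.image_ne_zero hΓ)] with s ⟨h, hC⟩ hq
  exact ⟨h, hC, hq, hΓ.apply_mk h hC hq⟩

theorem IsArc.eventually_eval_eq_zero {F : MvPolynomial (Fin 3) ℂ} {d : ℕ}
    (hF : F.IsHomogeneous d) (hν : Set.range ν = planeCurve F)
    (hγ : IsArc Chat x.1 u γ) (hΓ : IsLocalRep ν x Γ) :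
    ∀ᶠ s in 𝓝 (0 : ℂ), MvPolynomial.eval (fun j => MvPolynomial.eval (γ s) (Γ j)) F = 0 := by
  filter_upwards [hγ.eventually_image hΓ] with s ⟨h, hC, hq, hs⟩
  rw [← mk_mem_planeCurve_iff hF hq, ← hs, ← hν]
  exact Set.mem_range_self _

/-- The normalization of a nodal curve is an immersion. -/
theorem IsArc.crossProduct_ne_zero {F : MvPolynomial (Fin 3) ℂ} {d : ℕ} (hF : IsNodalCurve F d)
    (hν : IsNormalization (planeCurve F) Chat ν) (hγ : IsArc Chat x.1 u γ)
    (hu : ∀ a : ℂ, u ≠ a • x.1.rep) (hΓ : IsLocalRep ν x Γ) :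
    crossProduct (fun j => MvPolynomial.eval x.1.rep (Γ j))
      (fun j => polyDiff (Γ j) x.1.rep u) ≠ 0 := by
  obtain ⟨S, hS, μ, -, -, hμ⟩ := hν.birational
  have hq' := hγ.hasDerivAt_image Γ
  have := crossProduct_ne_zero_of_arc hF.homogeneous hF.nodal (hγ.analyticAt_image Γ) hq'
    (hγ.image_ne_zero hΓ) (hγ.eventually_eval_eq_zero hF.homogeneous hν.range_eq hΓ) ?_
  · rwa [hγ.map_zero] at this
  -- Injectivity of the image arc off its centre: there it avoids `S`, so `μ` recovers the point of
  -- `Chat`, and the arc on `Chat` is itself injective.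
  obtain ⟨U, hU, hinj⟩ := hγ.exists_nhds_injective hu
  have h1 := eventually_nhdsWithin_iff.1 (hγ.eventually_notMem hu hν.finite_fibers hS)
  refine ⟨_, Filter.inter_mem hU (Filter.inter_mem h1 (hγ.eventually_image hΓ)), ?_⟩
  rintro s ⟨hsU, hsS, h, hC, hq, hs⟩ s' ⟨hsU', hsS', h', hC', hq', hs'⟩ hs0 hs0' ⟨a, ha⟩
  refine hinj s hsU s' hsU' ?_
  have heq : ν ⟨_, hC⟩ = ν ⟨_, hC'⟩ := by
    rw [hs, hs', Projectivization.mk_eq_mk_iff']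
    exact ⟨a, ha.symm⟩
  have hm : ν ⟨_, hC⟩ ∈ planeCurve F \ S :=
    ⟨hν.range_eq ▸ Set.mem_range_self _, hsS hs0 h hC⟩
  have hm' : ν ⟨_, hC'⟩ ∈ planeCurve F \ S :=
    ⟨hν.range_eq ▸ Set.mem_range_self _, hsS' hs0' h' hC'⟩
  have h2 : Projectivization.mk ℂ (γ s) h = Projectivization.mk ℂ (γ s') h' := by
    refine (hμ ⟨_, hC⟩ hm).symm.trans (Eq.trans ?_ (hμ ⟨_, hC'⟩ hm'))
    congr 1
    exact Subtype.ext heq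
  rw [Projectivization.mk_eq_mk_iff'] at h2
  obtain ⟨b, hb⟩ := h2
  exact ⟨b, hb.symm⟩

end

end

/-! ### The branch locus -/

section

variable {n : ℕ} {Chat : Set (PSpace n)} {ν : Chat → PSpace 2}

/-- `(u, 0)` represents a Zariski tangent vector of `X` at `(v, w)`, in homogeneous coordinates. -/
def IsVerticalTangent {m : ℕ} (X : Set (PSpace n × PSpace m)) (v : Fin (n + 1) → ℂ)
    (w : Fin (m + 1) → ℂ) (u : Fin (n + 1) → ℂ) : Prop :=
  ∀ G : MvPolynomial (Fin (n + 1) ⊕ Fin (m + 1)) ℂ, (∃ e, IsBihomogeneous G e) →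
    (∀ y ∈ X, PSpace.val₂ y G = 0) → polyDiff G (Sum.elim v w) (Sum.elim u 0) = 0

theorem IsVerticalTangent.smul {m : ℕ} {X : Set (PSpace n × PSpace m)} {v u : Fin (n + 1) → ℂ}
    {w : Fin (m + 1) → ℂ} (h : IsVerticalTangent X v w u) {a : ℂ} (ha : a ≠ 0) (b c : ℂ) :
    IsVerticalTangent X (a • v) (b • w) (c • u) := by
  rintro G ⟨e, he⟩ hG
  have h1 := he.polyDiff_smul a b v u w 0
  rw [h G ⟨e, he⟩ hG, mul_zero, smul_zero] at h1
  have h2 : (Sum.elim (c • u) 0 : Fin (n + 1) ⊕ Fin (m + 1) → ℂ) =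
      (c / a) • Sum.elim (a • u) 0 := by
    ext i
    rcases i with i | i
    · simp only [Sum.elim_inl, Pi.smul_apply, smul_eq_mul]
      field_simp
    · simp
  rw [h2, polyDiff_smul, h1, mul_zero]

/-- Radial motion in each factor only rescales the value of a bihomogeneous form, so a zero stays a
zero. -/
theorem polyDiff_self_eq_zero {m : ℕ} {G : MvPolynomial (Fin (n + 1) ⊕ Fin (m + 1)) ℂ} {e : ℕ × ℕ}
    (hG : IsBihomogeneous G e) {v : Fin (n + 1) → ℂ} {w : Fin (m + 1) → ℂ}
    (h : MvPolynomial.eval (Sum.elim v w) G = 0) (a b : ℂ) :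
    polyDiff G (Sum.elim v w) (Sum.elim (a • v) (b • w)) = 0 := by
  have h1 : HasDerivAt (fun s : ℂ => Sum.elim v w + s • (Sum.elim (a • v) (b • w) :
      Fin (n + 1) ⊕ Fin (m + 1) → ℂ)) (Sum.elim (a • v) (b • w)) 0 := by
    simpa using ((hasDerivAt_id (0 : ℂ)).smul_const
      (Sum.elim (a • v) (b • w) : Fin (n + 1) ⊕ Fin (m + 1) → ℂ)).const_add (Sum.elim v w)
  have h2 := hasDerivAt_eval_comp G h1
  simp only [zero_smul, add_zero] at h2
  refine h2.unique ((hasDerivAt_const (0 : ℂ) (0 : ℂ)).congr_of_eventuallyEq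
    (Filter.Eventually.of_forall fun s => ?_))
  have h3 : Sum.elim v w + s • (Sum.elim (a • v) (b • w) : Fin (n + 1) ⊕ Fin (m + 1) → ℂ) =
      Sum.elim ((1 + s * a) • v) ((1 + s * b) • w) := by
    ext i
    rcases i with i | i <;> simp <;> ring
  simp only [h3, hG.eval_smul, h, mul_zero]

/-- Reduces criticality, which may be witnessed by any local representation, to the representation
by the coordinates of `t`. For these the `t`-part of a kernel vector is radial and can be
subtracted. -/
theorem isCriticalPoint_incidenceProj_iff (z : incidenceSurface ν) :
    IsCriticalPoint₂ (incidenceProj ν) z ↔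
      ∃ u, IsVerticalTangent (incidenceSurface ν) z.1.1.rep z.1.2.rep u ∧
        ∀ a : ℂ, u ≠ a • z.1.1.rep := by
  constructor
  · rintro ⟨Γ, hΓ, u, hu, hu0, c, hc⟩
    obtain ⟨e, he⟩ := hΓ.1
    have ht0 := z.1.2.rep_nonzero
    obtain ⟨k, hk⟩ := Function.ne_iff.1 ht0
    have hk' : z.1.2.rep k ≠ 0 := hk
    have hz := hΓ.2.2 z hΓ.2.1
    rw [incidenceProj, ← z.1.2.mk_rep, Projectivization.mk_eq_mk_iff'] at hz
    obtain ⟨a, ha⟩ := hz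
    have ha' : ∀ j, a * PSpace.val₂ z.1 (Γ j) = z.1.2.rep j := fun j => congrFun ha j
    -- On the surface `Γ` is proportional to `t`, so the forms `Γ j * t k - Γ k * t j` vanish on it
    -- and their differentials kill `u`.
    have hX : ∀ j, u (Sum.inr j) = u (Sum.inr k) / z.1.2.rep k * z.1.2.rep j := by
      intro j
      have hE := hu (Γ j * MvPolynomial.X (Sum.inr k) - Γ k * MvPolynomial.X (Sum.inr j))
        ⟨e + (0, 1), ((he j).mul (isBihomogeneous_X_inr k)).sub
          ((he k).mul (isBihomogeneous_X_inr j))⟩ (by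
          intro w hw
          rw [PSpace.val₂, map_sub, map_mul, map_mul, MvPolynomial.eval_X, MvPolynomial.eval_X]
          by_cases hw0 : (fun j => PSpace.val₂ w (Γ j)) = 0
          · rw [show MvPolynomial.eval _ (Γ j) = 0 from congrFun hw0 j,
              show MvPolynomial.eval _ (Γ k) = 0 from congrFun hw0 k]
            ring
          · have h1 := hΓ.2.2 ⟨w, hw⟩ hw0
            rw [incidenceProj, ← w.2.mk_rep, Projectivization.mk_eq_mk_iff'] at h1
            obtain ⟨b, hb⟩ := h1
            have hb' : ∀ j, b * PSpace.val₂ w (Γ j) = w.2.rep j := fun j => congrFun hb j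
            change PSpace.val₂ w (Γ j) * w.2.rep k - PSpace.val₂ w (Γ k) * w.2.rep j = 0
            rw [← hb', ← hb']
            ring)
      change polyDiff _ _ _ = 0 at hE
      have hcj : ∀ j, polyDiff (Γ j) (PSpace.coords z.1) u = c * PSpace.val₂ z.1 (Γ j) := hc
      rw [polyDiff_sub, polyDiff_mul, polyDiff_mul, polyDiff_X, polyDiff_X, hcj, hcj,
        MvPolynomial.eval_X, MvPolynomial.eval_X] at hE
      change PSpace.val₂ z.1 (Γ j) * u (Sum.inr k) + z.1.2.rep k * _ -
        (PSpace.val₂ z.1 (Γ k) * u (Sum.inr j) + z.1.2.rep j * _) = 0 at hE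
      rw [div_mul_eq_mul_div, eq_div_iff hk']
      linear_combination (-a) * hE + (u (Sum.inr k) + c * z.1.2.rep k) * (ha' j)
        - (u (Sum.inr j) + c * z.1.2.rep j) * ha' k
    set b := u (Sum.inr k) / z.1.2.rep k
    have hu2 : u = Sum.elim (u ∘ Sum.inl) (b • z.1.2.rep) := by
      ext i
      rcases i with i | i
      · rfl
      · exact hX i
    refine ⟨u ∘ Sum.inl, ?_, ?_⟩
    · rintro G ⟨e, he⟩ hG
      have h1 := hu G ⟨e, he⟩ hG
      have h2 : MvPolynomial.eval (Sum.elim z.1.1.rep z.1.2.rep) G = 0 := hG z.1 z.2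
      have h3 := polyDiff_self_eq_zero he h2 0 b
      change polyDiff G (Sum.elim z.1.1.rep z.1.2.rep) u = 0 at h1
      have h4 : u = Sum.elim (u ∘ Sum.inl) 0 + Sum.elim ((0 : ℂ) • z.1.1.rep) (b • z.1.2.rep) := by
        conv_lhs => rw [hu2]
        ext i
        rcases i with i | i <;> simp
      rw [h4, polyDiff_add, h3, add_zero] at h1
      exact h1
    · intro a ha
      exact hu0 ⟨a, b, by rw [← ha]; exact hu2⟩
  · rintro ⟨u, hu, hu0⟩
    refine ⟨_, isLocalRep_incidenceProj z, Sum.elim u 0, hu, ?_, 0, ?_⟩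
    · rintro ⟨a, b, hab⟩
      exact hu0 a (by ext i; exact congrFun hab (Sum.inl i))
    · intro j
      rw [zero_mul]
      exact polyDiff_X _ _ _

theorem IsZariskiClosed₂.mem_of_forall {m : ℕ} {Z : Set (PSpace n × PSpace m)}
    (hZ : IsZariskiClosed₂ Z) {v : Fin (n + 1) → ℂ} (hv : v ≠ 0) {w : Fin (m + 1) → ℂ} (hw : w ≠ 0)
    (h : ∀ G : MvPolynomial (Fin (n + 1) ⊕ Fin (m + 1)) ℂ, (∃ e, IsBihomogeneous G e) →
      (∀ y ∈ Z, PSpace.val₂ y G = 0) → MvPolynomial.eval (Sum.elim v w) G = 0) :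
    (Projectivization.mk ℂ v hv, Projectivization.mk ℂ w hw) ∈ Z := by
  obtain ⟨I, hI, hZ⟩ := hZ
  rw [hZ]
  intro G hG
  obtain ⟨e, he⟩ := hI G hG
  rw [PSpace.val₂_mk_eq_zero he]
  exact h G ⟨e, he⟩ fun y hy => (hZ y).1 hy G hG

theorem continuous_polyDiff_sumElim {m : ℕ} (G : MvPolynomial (Fin (n + 1) ⊕ Fin (m + 1)) ℂ) :
    Continuous fun p : (Fin (n + 1) → ℂ) × (Fin (m + 1) → ℂ) × (Fin (n + 1) → ℂ) =>
      polyDiff G (Sum.elim p.1 p.2.1) (Sum.elim p.2.2 0) := by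
  refine continuous_finsetSum _ fun i _ => ?_
  refine ((continuous_eval_sumElim (MvPolynomial.pderiv i G)).comp
    (continuous_fst.prodMk (continuous_fst.comp continuous_snd))).mul ?_
  rcases i with i | i
  · exact (continuous_apply i).comp (continuous_snd.comp continuous_snd)
  · exact continuous_const

/-- Homogeneous coordinates of the points of `X` with vectors representing vertical tangents. -/
def verticalTangentSet {m : ℕ} (X : Set (PSpace n × PSpace m)) :
    Set ((Fin (n + 1) → ℂ) × (Fin (m + 1) → ℂ) × (Fin (n + 1) → ℂ)) :=
  {p | ∀ G : MvPolynomial (Fin (n + 1) ⊕ Fin (m + 1)) ℂ, (∃ e, IsBihomogeneous G e) →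
    (∀ y ∈ X, PSpace.val₂ y G = 0) → MvPolynomial.eval (Sum.elim p.1 p.2.1) G = 0 ∧
      polyDiff G (Sum.elim p.1 p.2.1) (Sum.elim p.2.2 0) = 0}

theorem isClosed_verticalTangentSet {m : ℕ} (X : Set (PSpace n × PSpace m)) :
    IsClosed (verticalTangentSet X) := by
  have h : ∀ G : MvPolynomial (Fin (n + 1) ⊕ Fin (m + 1)) ℂ,
      IsClosed {p : (Fin (n + 1) → ℂ) × (Fin (m + 1) → ℂ) × (Fin (n + 1) → ℂ) |
        MvPolynomial.eval (Sum.elim p.1 p.2.1) G = 0 ∧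
          polyDiff G (Sum.elim p.1 p.2.1) (Sum.elim p.2.2 0) = 0} := by
    intro G
    have h1 : Continuous fun p : (Fin (n + 1) → ℂ) × (Fin (m + 1) → ℂ) × (Fin (n + 1) → ℂ) =>
        (p.1, p.2.1) := by fun_prop
    exact (isClosed_eq ((continuous_eval_sumElim G).comp h1) continuous_const).inter
      (isClosed_eq (continuous_polyDiff_sumElim G) continuous_const)
  have heq : verticalTangentSet X =
      ⋂ (G : MvPolynomial (Fin (n + 1) ⊕ Fin (m + 1)) ℂ) (_ : ∃ e, IsBihomogeneous G e)
        (_ : ∀ y ∈ X, PSpace.val₂ y G = 0),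
        {p | MvPolynomial.eval (Sum.elim p.1 p.2.1) G = 0 ∧
          polyDiff G (Sum.elim p.1 p.2.1) (Sum.elim p.2.2 0) = 0} := by
    ext p
    simp only [Set.mem_iInter]
    rfl
  rw [heq]
  exact isClosed_iInter fun G => isClosed_iInter fun _ => isClosed_iInter fun _ => h G

/-- Critical points with normalized vertical tangent vectors form a compact set, and the branch
locus is its continuous image. -/
theorem isClosed_branchLocus (hX : IsZariskiClosed₂ (incidenceSurface ν)) :
    IsClosed (branchLocus₂ (incidenceProj ν)) := by
  let K : Set ((Fin (n + 1) → ℂ) × (Fin 3 → ℂ) × (Fin (n + 1) → ℂ)) :=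
    -- Requiring the tangent vector to be a unit vector orthogonal to the point excludes the radial
    -- direction by a closed condition.
    (Metric.sphere 0 1 ×ˢ (Metric.sphere 0 1 ×ˢ Metric.sphere 0 1)) ∩
      ({p | star p.1 ⬝ᵥ p.2.2 = 0} ∩ verticalTangentSet (incidenceSurface ν))
  have hK : IsCompact K := by
    refine ((isCompact_sphere _ _).prod ((isCompact_sphere _ _).prod
      (isCompact_sphere _ _))).inter_right (IsClosed.inter ?_ (isClosed_verticalTangentSet _))
    refine isClosed_eq ?_ continuous_const
    simp only [dotProduct, Pi.star_apply]
    fun_prop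
  have h0 : ∀ p : K, p.1.1 ≠ 0 ∧ p.1.2.1 ≠ 0 ∧ p.1.2.2 ≠ 0 := fun p => by
    obtain ⟨⟨h1, h2, h3⟩, -⟩ := p.2
    refine ⟨fun h => ?_, fun h => ?_, fun h => ?_⟩
    · simp [h] at h1
    · simp [h] at h2
    · simp [h] at h3
  have hc : Continuous fun p : K =>
      (Projectivization.mk ℂ p.1.2.1 (h0 p).2.1 : PSpace 2) :=
    (PSpace.continuous_mk 2).comp
      (f := fun p : K => (⟨p.1.2.1, (h0 p).2.1⟩ : {v : Fin (2 + 1) → ℂ // v ≠ 0})) (by fun_prop)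
  have : CompactSpace K := isCompact_iff_compactSpace.1 hK
  convert (isCompact_range hc).isClosed
  ext t
  constructor
  · rintro ⟨z, hz, rfl⟩
    obtain ⟨u, hu, hu0⟩ := (isCriticalPoint_incidenceProj_iff z).1 hz
    obtain ⟨v, hv, hv0, hvz⟩ := PSpace.exists_unit_rep z.1.1
    obtain ⟨w, hw, hw0, hwz⟩ := PSpace.exists_unit_rep z.1.2
    obtain ⟨a, ha, hav⟩ := PSpace.exists_rep_mk v hv0
    obtain ⟨b, hb, hbw⟩ := PSpace.exists_rep_mk w hw0
    rw [hvz] at hav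
    rw [hwz] at hbw
    have hss : star v ⬝ᵥ v ≠ 0 := by
      rw [dotProduct_comm]; exact sum_mul_star_ne_zero hv0
    -- The coefficient of the orthogonal projection of `u` to the radial direction `v`, which is
    -- subtracted before normalizing.
    set c := (star v ⬝ᵥ u) / (star v ⬝ᵥ v) with hcdef
    have hu1 : u - c • v ≠ 0 := by
      intro h
      refine hu0 (c / a) ?_
      rw [hav, smul_smul, div_mul_cancel₀ _ ha]
      exact sub_eq_zero.1 h
    have hnz : (‖u - c • v‖ : ℂ) ≠ 0 := by simpa using hu1
    have hXz : ∀ G : MvPolynomial (Fin (n + 1) ⊕ Fin (2 + 1)) ℂ, (∃ e, IsBihomogeneous G e) →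
        (∀ y ∈ incidenceSurface ν, PSpace.val₂ y G = 0) →
        MvPolynomial.eval (Sum.elim v w) G = 0 := by
      rintro G ⟨e, he⟩ hG
      have := hG z.1 z.2
      rw [show z.1 = (Projectivization.mk ℂ v hv0, Projectivization.mk ℂ w hw0) from
        Prod.ext hvz.symm hwz.symm, PSpace.val₂_mk_eq_zero he] at this
      exact this
    have hvt : IsVerticalTangent (incidenceSurface ν) v w
        ((‖u - c • v‖ : ℂ)⁻¹ • (u - c • v)) := by
      have h1 : IsVerticalTangent (incidenceSurface ν) v w u := by
        have := hu.smul (inv_ne_zero ha) b⁻¹ 1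
        rwa [hav, hbw, smul_smul, smul_smul, inv_mul_cancel₀ ha, inv_mul_cancel₀ hb, one_smul,
          one_smul, one_smul] at this
      have h2 : IsVerticalTangent (incidenceSurface ν) v w (u - c • v) := by
        rintro G ⟨e, he⟩ hG
        have h3 := polyDiff_self_eq_zero he (hXz G ⟨e, he⟩ hG) (-c) 0
        have h4 : (Sum.elim (u - c • v) 0 : Fin (n + 1) ⊕ Fin (2 + 1) → ℂ) =
            Sum.elim u 0 + Sum.elim (-c • v) ((0 : ℂ) • w) := by
          ext i
          rcases i with i | i
          · simp [sub_eq_add_neg]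
          · simp
        rw [h4, polyDiff_add, h3, h1 G ⟨e, he⟩ hG, add_zero]
      have := h2.smul one_ne_zero 1 (‖u - c • v‖ : ℂ)⁻¹
      rwa [one_smul, one_smul] at this
    refine ⟨⟨(v, w, (‖u - c • v‖ : ℂ)⁻¹ • (u - c • v)), ⟨?_, ?_, ?_⟩, ?_, ?_⟩, hwz⟩
    · simpa using hv
    · simpa using hw
    · rw [mem_sphere_zero_iff_norm, norm_smul]
      simp [hu1]
    · change star v ⬝ᵥ _ = 0
      rw [dotProduct_smul, dotProduct_sub, dotProduct_smul, hcdef, smul_eq_mul, smul_eq_mul,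
        div_mul_cancel₀ _ hss, sub_self, mul_zero]
    · exact fun G hG hGX => ⟨hXz G hG hGX, hvt G hG hGX⟩
  · rintro ⟨p, rfl⟩
    obtain ⟨hp1, hp2, hp3⟩ := h0 p
    obtain ⟨⟨v, w, u⟩, hs, horth, hG⟩ := p
    have hz := hX.mem_of_forall hp1 hp2 fun G hGe hGX => (hG G hGe hGX).1
    refine ⟨⟨_, hz⟩, ?_, rfl⟩
    rw [Set.mem_ofPred_eq, isCriticalPoint_incidenceProj_iff]
    obtain ⟨a, ha, hav⟩ := PSpace.exists_rep_mk v hp1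
    obtain ⟨b, hb, hbw⟩ := PSpace.exists_rep_mk w hp2
    have hvt : IsVerticalTangent (incidenceSurface ν) v w u :=
      fun G hGe hGX => (hG G hGe hGX).2
    have h1 := hvt.smul ha b 1
    rw [one_smul, ← hav, ← hbw] at h1
    refine ⟨u, h1, fun c hc => ?_⟩
    change star v ⬝ᵥ u = 0 at horth
    simp only [hav, smul_smul] at hc
    rw [hc, dotProduct_smul, smul_eq_mul] at horth
    have hss : star v ⬝ᵥ v ≠ 0 := by
      rw [dotProduct_comm]; exact sum_mul_star_ne_zero hp1
    have hca := (mul_eq_zero.1 horth).resolve_right hss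
    rw [hca, zero_smul] at hc
    exact hp3 hc

end

/-! ### The branch locus and the dual curve -/

/-- The first equation is Euler's identity, the second the derivative of `F ∘ q = 0`. The gradient
is taken at the chosen representative, hence the rescaling by `a`. -/
theorem gradientAt_dotProduct_of_arc {F : MvPolynomial (Fin 3) ℂ} {d : ℕ} (hF : F.IsHomogeneous d)
    {q : ℂ → Fin 3 → ℂ} {q' : Fin 3 → ℂ} {s : ℂ} (hq : HasDerivAt q q' s) (h : q s ≠ 0)
    (h0 : ∀ᶠ r in 𝓝 s, MvPolynomial.eval (q r) F = 0) :
    gradientAt F (Projectivization.mk ℂ (q s) h) ⬝ᵥ q s = 0 ∧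
      gradientAt F (Projectivization.mk ℂ (q s) h) ⬝ᵥ q' = 0 := by
  obtain ⟨a, ha, hrep⟩ := PSpace.exists_rep_mk (q s) h
  have hg : ∀ u, gradientAt F (Projectivization.mk ℂ (q s) h) ⬝ᵥ u = polyDiff F (a • q s) u := by
    intro u
    rw [← hrep]
    rfl
  have hcancel : ∀ u, polyDiff F (a • q s) (a • u) = 0 → polyDiff F (a • q s) u = 0 := by
    intro u hu
    rw [polyDiff_smul] at hu
    exact (mul_eq_zero.1 hu).resolve_left ha
  rw [hg, hg]
  refine ⟨hcancel _ ?_, hcancel _ ?_⟩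
  · rw [hF.polyDiff_self, hF.eval_smul, h0.self_of_nhds, mul_zero, mul_zero]
  · refine (hasDerivAt_eval_comp F (hq.const_smul a)).unique
      ((hasDerivAt_const s (0 : ℂ)).congr_of_eventuallyEq ?_)
    filter_upwards [h0] with r hr
    rw [Pi.smul_apply, hF.eval_smul, hr, mul_zero]

theorem mk_eq_mk_crossProduct {g a b : Fin 3 → ℂ} (hg : g ≠ 0) (hab : crossProduct a b ≠ 0)
    (ha : g ⬝ᵥ a = 0) (hb : g ⬝ᵥ b = 0) :
    Projectivization.mk ℂ g hg = Projectivization.mk ℂ (crossProduct a b) hab := by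
  rw [Projectivization.mk_eq_mk_iff_crossProduct_eq_zero, cross_cross_eq_smul_sub_smul', hb,
    dotProduct_comm a g, ha, zero_smul, zero_smul, sub_zero]

theorem eventually_mk_mem {m : ℕ} {o : Set (PSpace m)} (ho : IsOpen o) {w : ℂ → Fin (m + 1) → ℂ}
    {s : ℂ} (hw : ContinuousAt w s) (h0 : w s ≠ 0) (h : Projectivization.mk ℂ (w s) h0 ∈ o) :
    ∀ᶠ r in 𝓝 s, ∃ hr : w r ≠ 0, Projectivization.mk ℂ (w r) hr ∈ o := by
  have h1 : IsOpen (Subtype.val '' ((fun v : {v : Fin (m + 1) → ℂ // v ≠ 0} =>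
      (Projectivization.mk ℂ v.1 v.2 : PSpace m)) ⁻¹' o)) :=
    isOpen_ne.isOpenMap_subtype_val _ (ho.preimage (PSpace.continuous_mk m))
  filter_upwards [hw.eventually_mem (h1.mem_nhds ⟨⟨w s, h0⟩, h, rfl⟩)] with r hr
  obtain ⟨⟨v, hv⟩, hvo, hvr⟩ := hr
  change v = w r at hvr
  subst hvr
  exact ⟨hv, hvo⟩

section

variable {n : ℕ} {Chat : Set (PSpace n)} {ν : Chat → PSpace 2} {x : Chat} {u : Fin (n + 1) → ℂ}
  {γ : ℂ → Fin (n + 1) → ℂ} {Γ : Fin 3 → MvPolynomial (Fin (n + 1)) ℂ}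

theorem IsLocalRep.dotProduct_eq_zero_of_isVerticalTangent (hΓ : IsLocalRep ν x Γ)
    {w : Fin 3 → ℂ} (h : IsVerticalTangent (incidenceSurface ν) x.1.rep w u) :
    w ⬝ᵥ (fun j => polyDiff (Γ j) x.1.rep u) = 0 := by
  obtain ⟨e, he⟩ := hΓ.1
  have h1 := h _ ⟨_, isBihomogeneous_incidencePoly he⟩ hΓ.incidencePoly_eq_zero
  rw [polyDiff_incidencePoly] at h1
  simpa [dotProduct] using h1

/-- The arc on `Chat` is lifted to an arc `(γ, τ)` on the surface with `τ' 0 = 0`; forms vanishing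
on the surface are then differentiated along it. -/
theorem IsArc.isVerticalTangent (hγ : IsArc Chat x.1 u γ) (hΓ : IsLocalRep ν x Γ) {w : Fin 3 → ℂ}
    (hw : w ≠ 0) (h0 : w ⬝ᵥ (fun j => MvPolynomial.eval x.1.rep (Γ j)) = 0)
    (h1 : w ⬝ᵥ (fun j => polyDiff (Γ j) x.1.rep u) = 0) :
    IsVerticalTangent (incidenceSurface ν) x.1.rep w u := by
  rintro G ⟨e, he⟩ hG
  set q : ℂ → Fin 3 → ℂ := fun s j => MvPolynomial.eval (γ s) (Γ j) with hq
  have hq0 : q 0 = fun j => MvPolynomial.eval x.1.rep (Γ j) := by rw [hq, ← hγ.map_zero]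
  have hq' : HasDerivAt q (fun j => polyDiff (Γ j) x.1.rep u) 0 := hγ.hasDerivAt_image Γ
  obtain ⟨a, ha⟩ := exists_dotProduct_eq (hγ.image_ne_zero hΓ) 1
  change q 0 ⬝ᵥ a = 1 at ha
  have hdot : ∀ b : Fin 3 → ℂ, HasDerivAt (fun s => b ⬝ᵥ q s)
      (b ⬝ᵥ fun j => polyDiff (Γ j) x.1.rep u) 0 := fun b =>
    HasDerivAt.fun_sum fun j _ => (hasDerivAt_pi.1 hq' j).const_mul (b j)
  have haq : a ⬝ᵥ q 0 ≠ 0 := by rw [dotProduct_comm, ha]; exact one_ne_zero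
  have hwq : w ⬝ᵥ q 0 = 0 := by rw [hq0]; exact h0
  -- The correction along `a` keeps `τ s` orthogonal to `q s`. It vanishes at `0` to second order
  -- because `w` annihilates both `q 0` and `q' 0`.
  let τ : ℂ → Fin 3 → ℂ := fun s => w - ((w ⬝ᵥ q s) / (a ⬝ᵥ q s)) • a
  have hτ0 : τ 0 = w := by simp only [τ]; rw [hwq, zero_div, zero_smul, sub_zero]
  have hτ : HasDerivAt τ 0 0 := by
    have h2 := (((hdot w).fun_div (hdot a) haq).smul_const a).const_sub w
    rwa [h1, hwq, zero_mul, zero_mul, sub_zero, zero_div, zero_smul, neg_zero] at h2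
  have hc : HasDerivAt (fun s => (Sum.elim (γ s) (τ s) : Fin (n + 1) ⊕ Fin 3 → ℂ))
      (Sum.elim u 0) 0 := by
    refine hasDerivAt_pi.2 fun i => ?_
    rcases i with i | i
    · exact hasDerivAt_pi.1 hγ.hasDerivAt i
    · exact hasDerivAt_pi.1 hτ i
  have hd := hasDerivAt_eval_comp G hc
  simp only [hγ.map_zero, hτ0] at hd
  refine hd.unique ((hasDerivAt_const (0 : ℂ) (0 : ℂ)).congr_of_eventuallyEq ?_)
  have hτne : ∀ᶠ s in 𝓝 (0 : ℂ), τ s ≠ 0 :=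
    hτ.continuousAt.eventually_ne (by rw [hτ0]; exact hw)
  filter_upwards [hγ.eventually_image hΓ, hτne,
    (hdot a).continuousAt.eventually_ne haq] with s ⟨h, hC, hqs, hs⟩ hts has
  have hX : ((Projectivization.mk ℂ (γ s) h, Projectivization.mk ℂ (τ s) hts) :
      PSpace n × DualPlane) ∈ incidenceSurface ν := by
    refine ⟨hC, ?_⟩
    change OnLine (ν ⟨Projectivization.mk ℂ (γ s) h, hC⟩) _
    rw [hs, onLine_mk_mk]
    change q s ⬝ᵥ (w - ((w ⬝ᵥ q s) / (a ⬝ᵥ q s)) • a) = 0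
    rw [dotProduct_sub, dotProduct_smul, dotProduct_comm (q s) w, dotProduct_comm (q s) a,
      smul_eq_mul, div_mul_cancel₀ _ has, sub_self]
  exact (PSpace.val₂_mk_eq_zero he _ h _ hts).1 (hG _ hX)

/-- As the branch locus is closed, tangent lines at smooth points suffice; there the gradient of `F`
annihilates both the point and the velocity of any arc. -/
theorem dualCurve_subset_branchLocus {F : MvPolynomial (Fin 3) ℂ} {d : ℕ} (hF : F.IsHomogeneous d)
    (hν : IsNormalization (planeCurve F) Chat ν) :
    dualCurve F ⊆ branchLocus₂ (incidenceProj ν) := by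
  refine closure_minimal ?_
    (isClosed_branchLocus (isZariskiClosed_incidenceSurface hν.closed hν.regular))
  rintro t ⟨q, hqF, hq, rfl⟩
  rw [← hν.range_eq] at hqF
  obtain ⟨x, rfl⟩ := hqF
  obtain ⟨u, hu, γ, hγ⟩ := exists_arc_of_smooth hν.smooth x.2
  obtain ⟨Γ, hΓ⟩ := hν.regular x
  have hνx : ν x = Projectivization.mk ℂ (fun j => MvPolynomial.eval (γ 0) (Γ j))
      (hγ.image_ne_zero hΓ) := by
    rw [hΓ.2.2 x hΓ.2.1]
    simp only [hγ.map_zero]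
    rfl
  obtain ⟨g0, g1⟩ := gradientAt_dotProduct_of_arc hF (hγ.hasDerivAt_image Γ) (hγ.image_ne_zero hΓ)
    (hγ.eventually_eval_eq_zero hF hν.range_eq hΓ)
  rw [← hνx] at g0 g1
  simp only [hγ.map_zero] at g0
  have hX : ((x.1, Projectivization.mk ℂ (gradientAt F (ν x)) hq) : PSpace n × DualPlane) ∈
      incidenceSurface ν := by
    refine ⟨x.2, ?_⟩
    have hon : ∀ (g : Fin 3 → ℂ) (hg : g ≠ 0),
        g ⬝ᵥ (fun j => MvPolynomial.eval x.1.rep (Γ j)) = 0 →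
        OnLine (ν x) (Projectivization.mk ℂ g hg) := fun g hg h => by
      rw [hΓ.2.2 x hΓ.2.1, onLine_mk_mk, dotProduct_comm]
      exact h
    exact hon _ hq g0
  refine ⟨⟨_, hX⟩, (isCriticalPoint_incidenceProj_iff _).2 ⟨u, ?_, hu⟩, rfl⟩
  obtain ⟨a, ha, hrep⟩ := PSpace.exists_rep_mk (gradientAt F (ν x)) hq
  refine hγ.isVerticalTangent hΓ (Projectivization.rep_nonzero _) ?_ ?_
  · rw [hrep, smul_dotProduct, g0, smul_zero]
  · rw [hrep, smul_dotProduct, g1, smul_zero]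

/-- Since `ν` is an immersion, a critical value `t` is the line spanned by a point of an arc on the
curve and its velocity. It is the limit of the corresponding lines at nearby parameters. -/
theorem branchLocus_subset_dualCurve {F : MvPolynomial (Fin 3) ℂ} {d : ℕ} (hF : IsNodalCurve F d)
    {p : PSpace 2} (hp : p ∉ planeCurve F) (hν : IsNormalization (planeCurve F) Chat ν) :
    branchLocus₂ (incidenceProj ν) ⊆ dualCurve F := by
  rintro _ ⟨⟨⟨x₀, t⟩, hx₀, hl⟩, hz, rfl⟩
  obtain ⟨u, hvt, hu⟩ := (isCriticalPoint_incidenceProj_iff _).1 hz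
  lift x₀ to Chat using hx₀
  rename' x₀ => x
  change t ∈ dualCurve F
  change OnLine (ν x) t at hl
  change IsVerticalTangent (incidenceSurface ν) x.1.rep t.rep u at hvt
  change ∀ a, u ≠ a • x.1.rep at hu
  obtain ⟨K, -, hK, harc⟩ := exists_tangentSpace_arc hν.smooth x.2
  -- Forms vanishing on `Chat` pull back to forms vanishing on the surface, so `u` is tangent to
  -- `Chat`.
  obtain ⟨γ, hγ⟩ := harc u (hK u fun G ⟨e, he⟩ hG => by
    have h1 := hvt _ ⟨_, isBihomogeneous_rename_inl he⟩ fun y hy => by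
      rw [PSpace.val₂_rename_inl]
      exact hG _ hy.1
    rw [polyDiff_rename_inl] at h1
    exact h1)
  obtain ⟨Γ, hΓ⟩ := hν.regular x
  have ht1 := hΓ.dotProduct_eq_zero_of_isVerticalTangent hvt
  have ht0 : t.rep ⬝ᵥ (fun j => MvPolynomial.eval x.1.rep (Γ j)) = 0 := by
    rw [hΓ.2.2 x hΓ.2.1, onLine_mk_iff] at hl
    exact hl
  have himm := hγ.crossProduct_ne_zero hF hν hu hΓ
  have ht := mk_eq_mk_crossProduct t.rep_nonzero himm ht0 ht1
  rw [t.mk_rep] at ht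
  set q : ℂ → Fin 3 → ℂ := fun s j => MvPolynomial.eval (γ s) (Γ j) with hq
  have hqa : AnalyticAt ℂ q 0 := hγ.analyticAt_image Γ
  let w : ℂ → Fin 3 → ℂ := fun s => crossProduct (q s) (deriv q s)
  have hwc : ContinuousAt w 0 := by
    have h1 := hqa.continuousAt
    have h2 := hqa.deriv.continuousAt
    refine continuousAt_pi.2 fun i => ?_
    have h1 := fun i => (continuousAt_pi.1 h1 i)
    have h2 := fun i => (continuousAt_pi.1 h2 i)
    fin_cases i <;> simp only [w, cross_apply]
    · exact ((h1 1).mul (h2 2)).sub ((h1 2).mul (h2 1))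
    · exact ((h1 2).mul (h2 0)).sub ((h1 0).mul (h2 2))
    · exact ((h1 0).mul (h2 1)).sub ((h1 1).mul (h2 0))
  have hw0 : w 0 = crossProduct (fun j => MvPolynomial.eval x.1.rep (Γ j))
      (fun j => polyDiff (Γ j) x.1.rep u) := by
    simp only [w]
    rw [(hγ.hasDerivAt_image Γ).deriv, hq]
    simp only [hγ.map_zero]
  have hF0 : ∀ᶠ s in 𝓝 (0 : ℂ), MvPolynomial.eval (q s) F = 0 :=
    hγ.eventually_eval_eq_zero hF.homogeneous hν.range_eq hΓ
  have hfin := finite_singularPoints hF.degree_pos hF.homogeneous hF.squarefree hp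
  rw [dualCurve, mem_closure_iff]
  intro o ho hto
  have hmem := eventually_mk_mem ho hwc (by rw [hw0]; exact himm) (by simpa only [hw0, ← ht])
  -- For small `s ≠ 0` the arc avoids the finitely many singular points, so the line spanned by `q
  -- s` and `q' s` is the tangent line given by the gradient.
  have hall := ((hmem.and (hF0.eventually_nhds.and (hqa.eventually_analyticAt.and
    (hγ.eventually_image hΓ)))).filter_mono nhdsWithin_le_nhds).and
      (hγ.eventually_notMem hu hν.finite_fibers hfin)
  obtain ⟨s, ⟨⟨hws, hwo⟩, hFs, hqs, hs, hC, hq0, hνs⟩, hsing⟩ := hall.exists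
  have hns := hsing hs hC
  rw [hνs] at hns
  have hcurve : Projectivization.mk ℂ (q s) hq0 ∈ planeCurve F :=
    (mk_mem_planeCurve_iff hF.homogeneous hq0).2 hFs.self_of_nhds
  have hgrad : gradientAt F (Projectivization.mk ℂ (q s) hq0) ≠ 0 := fun h => hns ⟨hcurve, h⟩
  obtain ⟨g0, g1⟩ := gradientAt_dotProduct_of_arc hF.homogeneous
    hqs.differentiableAt.hasDerivAt hq0 hFs
  exact ⟨_, hwo, _, hcurve, hgrad, (mk_eq_mk_crossProduct hgrad hws g0 g1).symm⟩

end

/-! ### The preimage of a pencil -/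

section

variable {n : ℕ} {Chat : Set (PSpace n)} {ν : Chat → PSpace 2} {p : PSpace 2}

theorem onLine_lineThrough {q : PSpace 2} (h : p ≠ q) :
    OnLine p (lineThrough p q) ∧ OnLine q (lineThrough p q) := by
  classical
  exact ⟨Projectivization.orthogonal_cross_left h, Projectivization.orthogonal_cross_right h⟩

theorem lineThrough_mk_mk {v w : Fin 3 → ℂ} (hv : v ≠ 0) (hw : w ≠ 0)
    (h : crossProduct v w ≠ 0) :
    lineThrough (Projectivization.mk ℂ v hv) (Projectivization.mk ℂ w hw) =
      Projectivization.mk ℂ (crossProduct v w) h := by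
  classical
  exact Projectivization.cross_mk_of_cross_ne_zero hv hw h

theorem eq_lineThrough {q : PSpace 2} (h : p ≠ q) {t : DualPlane} (hp : OnLine p t)
    (hq : OnLine q t) : t = lineThrough p q := by
  induction p using Projectivization.ind with | h v hv =>
  induction q using Projectivization.ind with | h w hw =>
  rw [Ne, Projectivization.mk_eq_mk_iff_crossProduct_eq_zero] at h
  rw [onLine_mk_iff] at hp hq
  rw [lineThrough_mk_mk hv hw h, ← mk_eq_mk_crossProduct t.rep_nonzero h hp hq, t.mk_rep]

/-- The isomorphism `x ↦ (x, line through p and ν x)`. -/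
noncomputable def pencilEquiv (ν : Chat → PSpace 2) (hp : ∀ x, p ≠ ν x) :
    Chat ≃ incidencePreimage ν p where
  toFun x := ⟨(x.1, lineThrough p (ν x)), ⟨x.2, (onLine_lineThrough (hp x)).2⟩,
    (onLine_lineThrough (hp x)).1⟩
  invFun w := ⟨w.1.1, w.2.fst.1⟩
  left_inv _ := rfl
  right_inv := by
    rintro ⟨⟨x, t⟩, ⟨hx, hl⟩, ht⟩
    exact Subtype.ext (Prod.ext rfl (eq_lineThrough (hp ⟨x, hx⟩) ht hl).symm)

theorem isRegularMap_subtype_val : IsRegularMap fun x : Chat => x.1 := by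
  intro x
  refine ⟨MvPolynomial.X, ⟨1, MvPolynomial.isHomogeneous_X ℂ⟩, ?_, fun y h => ?_⟩
  · simpa [PSpace.val] using! x.1.rep_nonzero
  · change y.1 = _
    conv_lhs => rw [← y.1.mk_rep]
    simp [PSpace.val]

/-- The cross product of `p` with a local representation of `ν` represents the projection; it is
nonzero because `p` is never equal to `ν x`. -/
theorem isRegularMap_lineThrough (hν : IsRegularMap ν) (hp : ∀ x, p ≠ ν x) :
    IsRegularMap fun x : Chat => lineThrough p (ν x) := by
  intro x
  obtain ⟨Γ, ⟨e, he⟩, hx, hΓ⟩ := hν x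
  let Δ : Fin 3 → MvPolynomial (Fin (n + 1)) ℂ :=
    crossProduct (fun i => MvPolynomial.C (p.rep i)) Γ
  have hC : ∀ i j, (MvPolynomial.C (p.rep i) * Γ j).IsHomogeneous e := fun i j => by
    simpa using (MvPolynomial.isHomogeneous_C _ (p.rep i)).mul (he j)
  have hval : ∀ y : PSpace n, (fun j => y.val (Δ j)) =
      crossProduct p.rep (fun j => y.val (Γ j)) := by
    intro y
    ext j
    fin_cases j <;> simp [Δ, PSpace.val, cross_apply]
  refine ⟨Δ, ⟨e, fun j => ?_⟩, ?_, fun y h => ?_⟩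
  · fin_cases j <;> simp only [Δ, cross_apply]
    · exact (hC 1 2).sub (hC 2 1)
    · exact (hC 2 0).sub (hC 0 2)
    · exact (hC 0 1).sub (hC 1 0)
  · rw [hval]
    have := hp x
    rwa [hΓ x hx, ← p.mk_rep, Ne, Projectivization.mk_eq_mk_iff_crossProduct_eq_zero] at this
  · simp only [hval] at h ⊢
    have hy : (fun j => y.1.val (Γ j)) ≠ 0 := by
      intro h0
      rw [h0, map_zero] at h
      exact h rfl
    rw [hΓ y hy, ← lineThrough_mk_mk p.rep_nonzero hy h, p.mk_rep]

theorem isVarietyIso_pencilEquiv (hν : IsRegularMap ν) (hp : ∀ x, p ≠ ν x) :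
    IsVarietyIso (pencilEquiv ν hp) := by
  refine ⟨isRegularMap_subtype_val, isRegularMap_lineThrough hν hp, fun w => ?_⟩
  refine ⟨fun i => MvPolynomial.X (Sum.inl i), ⟨(1, 0), isBihomogeneous_X_inl⟩, ?_, fun y h => ?_⟩
  · simpa [PSpace.val₂, PSpace.coords] using! w.1.1.rep_nonzero
  · change y.1.1 = _
    conv_lhs => rw [← y.1.1.mk_rep]
    simp [PSpace.val₂, PSpace.coords]

end

/-! ### The theorem on the incidence surface -/

theorem mainTheorem7 (F : MvPolynomial (Fin 3) ℂ) (d : ℕ) (hF : IsNodalCurve F d)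
    (hline : ∀ t : DualPlane, ∃ x, OnLine x t ∧ x ∉ planeCurve F)
    (n : ℕ) (Chat : Set (PSpace n)) (ν : Chat → PSpace 2)
    (hν : IsNormalization (planeCurve F) Chat ν) :
    -- `X_C` is a smooth projective surface
    IsZariskiClosed₂ (incidenceSurface ν) ∧ IsSmoothOfDim₂ (incidenceSurface ν) 2 ∧
    -- `f_C` is finite of degree `d`, with branch locus the dual curve
    IsFiniteMorphism₂ (incidenceProj ν) ∧ HasDegree₂ (incidenceProj ν) d ∧
    branchLocus₂ (incidenceProj ν) = dualCurve F ∧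
    -- `f_C⁻¹(p^⊥)` is isomorphic to `Chat`, compatibly with `pr_p ∘ ν`
    ∀ p, p ∉ planeCurve F → ∃ φ : Chat ≃ incidencePreimage ν p, IsVarietyIso φ ∧
      ∀ x : Chat, incidenceProj ν ⟨(φ x).1, (φ x).2.fst⟩ = lineThrough p (ν x) := by
  -- The choice of line is immaterial: it only supplies a point off the curve.
  obtain ⟨p₀, -, hp₀⟩ := hline (Projectivization.mk ℂ 1 one_ne_zero)
  refine ⟨isZariskiClosed_incidenceSurface hν.closed hν.regular,
    isSmoothOfDim_incidenceSurface hν.smooth hν.regular,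
    isFiniteMorphism_incidenceProj hF.homogeneous hline hν,
    hasDegree_incidenceProj hF.degree_pos hF.homogeneous hF.squarefree hp₀ hν,
    (branchLocus_subset_dualCurve hF hp₀ hν).antisymm
      (dualCurve_subset_branchLocus hF.homogeneous hν), fun p hp => ?_⟩
  have hpν : ∀ x, p ≠ ν x := by
    rintro x rfl
    exact hp (hν.range_eq ▸ Set.mem_range_self x)
  exact ⟨pencilEquiv ν hpν, isVarietyIso_pencilEquiv hν.regular hpν, fun x => rfl⟩
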